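/- Let $\beta>0$. Let $\mathcal G$ be the set of right-continuous nondecreasing functions $g:[0,1)\to[0,1]$ with the $L^2([0,1],dx)$-distance and its Borel $\sigma$-algebra, and let $\mathbb Q^\beta$ be the law on $\mathcal G$ of the Dirichlet process with parameter $\beta$, i.e. the probability measure such that for all $0=t_0<t_1<\dots<t_n<t_{n+1}=1$ the law of $(g(t_1),\dots,g(t_n))$ has Lebesgue density $$\frac{\Gamma(\beta)}{\prod_{i=0}^{n}\Gamma(\beta(t_{i+1}-t_i))}\prod_{i=0}^{n}(x^{i+1}-x^i)^{\beta(t_{i+1}-t_i)-1}$$ on $\{0=x^0\le x^1\le\dots\le x^n\le x^{n+1}=1\}$. For $N\ge1$ let $\Sigma_N=\{x\in\mathbb R^{N-1}:0\le x^1\le\dots\le x^{N-1}\le1\}$ and $$q_N(dx)=\frac{\Gamma(\beta)}{\Gamma(\beta/N)^N}\prod_{i=1}^N(x^i-x^{i-1})^{\frac{\beta}{N}-1}\,dx\quad\text{on }\Sigma_N\qquad(x^0=0,\ x^N=1).$$ Put $H=L^2(\mathcal G,\mathbb Q^\beta)$, $H^N=L^2(\Sigma_N,q_N)$, and let $\Phi^N:H\to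 H^N$ be the conditional expectation $(\Phi^Nu)(x)=\mathbb E(u\mid g(i/N)=x^i,\ i=1,\dots,N-1)$. A sequence $u_N\in H^N$ converges strongly to $u\in H$ if there are $\tilde u_k\in H$ with $\tilde u_k\to u$ in $H$ and $\lim_k\limsup_N\|\Phi^N\tilde u_k-u_N\|_{H^N}=0$. Let $(\mathcal E^N,\mathcal D(\mathcal E^N))$ be the closure in $H^N$ of $\mathcal E^N(f,f)=\int_{\Sigma_N}|\nabla f|^2\,dq_N$, $f\in C^\infty(\Sigma_N)$. Let $(\mathcal E,\mathcal D(\mathcal E))$ be the closure in $H$ of $\mathcal E(u,u)=\int_{\mathcal G}\|\nabla u|_g\|^2_{L^2([0,1])}\,\mathbb Q^\beta(dg)$ on the functions $u(g)=U(\langle f_1,g\rangle,\dots,\langle f_m,g\rangle)$, $U\in C^1_c(\mathbb R^m)$, $f_i\in L^2([0,1])$, with gradient $\nabla u|_g=\sum_i\partial_iU(\langle f_1,g\rangle,\dots,\langle f_m,g\rangle)\,f_i$; here $\langle f,g\rangle=\int_0^1f(t)g(t)\,dt=:l_f(g)$. Proposition (Mosco II'). Let $K$ be the linear span of the products $\prod_{i=1}^m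 l_{f_i}^{k_i}$ with $m\in\mathbb N$, $k_i\in\mathbb N=\{0,1,2,\dots\}$, $f_i\in C([0,1])$; that is, $K$ is the set of all functions $u=P(l_{f_1},\dots,l_{f_m})$ with $P$ a real polynomial and $f_i\in C([0,1])$. (1) $K$ is a core of $\mathcal E$: $K\subset\mathcal D(\mathcal E)$, and $K$ is dense in $\mathcal D(\mathcal E)$ for the norm $(\|u\|_H^2+\mathcal E(u,u))^{1/2}$. (2) Let $u=P(l_{f_1},\dots,l_{f_m})\in K$ and $u_N=P(\Phi^Nl_{f_1},\dots,\Phi^Nl_{f_m})$; in particular $u_N=\prod_i(\Phi^Nl_{f_i})^{k_i}$ if $u=\prod_il_{f_i}^{k_i}$. Then $u_N\in\mathcal D(\mathcal E^N)$ for all $N\ge1$, $u_N\to u$ strongly, and $N\cdot\mathcal E^N(u_N,u_N)\to\mathcal E(u,u)$ as $N\to\infty$. -/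

import Mathlib

open MeasureTheory Filter Topology
open scoped ENNReal ContDiff

noncomputable section

namespace WassersteinDiffusion

/-! ### The space of quantile functions -/

/-- The half-open unit interval `[0,1)`; as a measure space it carries Lebesgue measure. -/
abbrev I01 : Type := Set.Ico (0 : ℝ) 1

instance instMeasureSpaceI01 : MeasureSpace I01 := Measure.Subtype.measureSpace

instance : IsProbabilityMeasure (volume : Measure I01) := by
  refine ⟨?_⟩
  have h : (volume : Measure I01) = Measure.comap Subtype.val (volume : Measure ℝ) := rfl
  rw [h, comap_subtype_coe_apply measurableSet_Ico, Set.image_univ, Subtype.range_coe]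
  simp

/-- The set `𝒢` of right continuous nondecreasing functions `[0,1) → [0,1]`
(left limits exist automatically by monotonicity). -/
def QuantileFun : Type :=
  {g : I01 → ℝ // (∀ t, g t ∈ Set.Icc (0 : ℝ) 1) ∧ Monotone g ∧
    ∀ t, ContinuousWithinAt g (Set.Ici t) t}

instance : CoeFun QuantileFun (fun _ => I01 → ℝ) := ⟨fun g => g.1⟩

theorem QuantileFun.memLp (g : QuantileFun) : MemLp (g : I01 → ℝ) 2 volume := by
  refine MemLp.of_bound g.2.2.1.measurable.aestronglyMeasurable 1 (ae_of_all _ fun t => ?_)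
  rw [Real.norm_eq_abs, abs_le]
  exact ⟨by linarith [(g.2.1 t).1], (g.2.1 t).2⟩

/-- The inclusion of `𝒢` into `L²([0,1],dx)`. -/
def QuantileFun.toL2 (g : QuantileFun) : Lp ℝ 2 (volume : Measure I01) := g.memLp.toLp _

/-- The topology of `𝒢` is that of the `L²` distance. -/
instance : TopologicalSpace QuantileFun := TopologicalSpace.induced QuantileFun.toL2 inferInstance

/-- `𝒢` carries its Borel `σ`-algebra. -/
instance : MeasurableSpace QuantileFun := borel QuantileFun

instance : BorelSpace QuantileFun := ⟨rfl⟩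

/-- The linear functional `l_f(g) = ⟨f,g⟩ = ∫₀¹ f(t) g(t) dt`. -/
def pairing (f : I01 → ℝ) (g : QuantileFun) : ℝ := ∫ t : I01, f t * g t

/-! ### Ordered Dirichlet distributions, the measures `q_N` and the law `Q^β` -/

/-- The vector `(0, x¹, …, xⁿ, 1)`. -/
def withEnds {n : ℕ} (x : Fin n → ℝ) : Fin (n + 2) → ℝ :=
  Fin.cons (0 : ℝ) (Fin.snoc x (1 : ℝ) : Fin (n + 1) → ℝ)

/-- The increments `x^{i+1} - x^i`, `i = 0, …, n`, with `x^0 = 0` and `x^{n+1} = 1`. -/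
def increment {n : ℕ} (x : Fin n → ℝ) (i : Fin (n + 1)) : ℝ :=
  withEnds x i.succ - withEnds x i.castSucc

/-- The ordered simplex `{0 ≤ x¹ ≤ … ≤ xⁿ ≤ 1}`; this is `Σ_N` for `N = n + 1`. -/
def orderedSimplex (n : ℕ) : Set (EuclideanSpace ℝ (Fin n)) :=
  {x | Monotone (withEnds fun i => x i)}

/-- The measure on the ordered simplex with Lebesgue density
`Γ(∑ aᵢ) / ∏ Γ(aᵢ) · ∏ᵢ (x^{i+1} - x^i)^{aᵢ - 1}`. -/
def orderedDirichlet {n : ℕ} (a : Fin (n + 1) → ℝ) : Measure (EuclideanSpace ℝ (Fin n)) :=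
  (volume.restrict (orderedSimplex n)).withDensity fun x =>
    ENNReal.ofReal (Real.Gamma (∑ i, a i) / (∏ i, Real.Gamma (a i)) *
      ∏ i, (increment (fun j => x j) i) ^ (a i - 1))

/-- The measure `q_N` on `Σ_N`, for `N = n + 1`: all the exponents are `β / N - 1`. -/
def q (β : ℝ) (n : ℕ) : Measure (EuclideanSpace ℝ (Fin n)) :=
  orderedDirichlet fun _ : Fin (n + 1) => β / ((n + 1 : ℕ) : ℝ)

/-- Evaluation of a quantile function at finitely many times. -/
def evalAt {n : ℕ} (t : Fin n → I01) (g : QuantileFun) : EuclideanSpace ℝ (Fin n) :=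
  WithLp.toLp 2 fun i => g (t i)

/-- `Q` is the law `Q^β` on `𝒢` of the Dirichlet process over `[0,1]` with parameter `β`, i.e. the
probability measure whose finite dimensional distribution at `0 < t₁ < … < tₙ < 1` is the ordered
Dirichlet distribution with parameters `β (t_{i+1} - t_i)` (with `t₀ = 0`, `t_{n+1} = 1`). -/
def IsDirichletLaw (β : ℝ) (Q : Measure QuantileFun) : Prop :=
  IsProbabilityMeasure Q ∧
    ∀ (n : ℕ) (t : Fin n → I01), StrictMono (withEnds fun i => (t i : ℝ)) →
      Q.map (evalAt t) = orderedDirichlet fun i => β * increment (fun j => (t j : ℝ)) i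

/-! ### The `L²`-closure of a form given by a gradient -/

section Closure

variable {α α' V : Type*} [MeasurableSpace α] [MeasurableSpace α'] [NormedAddCommGroup V]

/-- Let `S` be a set of pairs (function, its gradient). `G` is a gradient of `u` in the closure
if `(u, G)` is the limit in `L²(μ) × L²(ν)` of a sequence in `S`. -/
def IsClosureGradient (μ : Measure α) (ν : Measure α') (S : Set ((α → ℝ) × (α' → V)))
    (u : α → ℝ) (G : α' → V) : Prop :=
  MemLp u 2 μ ∧ MemLp G 2 ν ∧ ∃ p : ℕ → (α → ℝ) × (α' → V), (∀ k, p k ∈ S) ∧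
    Tendsto (fun k => eLpNorm ((p k).1 - u) 2 μ) atTop (𝓝 0) ∧
    Tendsto (fun k => eLpNorm ((p k).2 - G) 2 ν) atTop (𝓝 0)

/-- The domain of the closure in `L²(μ)` of the form `u ↦ ‖∇u‖²_{L²(ν)}`. -/
def formDomain (μ : Measure α) (ν : Measure α') (S : Set ((α → ℝ) × (α' → V))) : Set (α → ℝ) :=
  {u | ∃ G, IsClosureGradient μ ν S u G}

/-- The value at `(u, u)` of the closure in `L²(μ)` of the form `u ↦ ‖∇u‖²_{L²(ν)}`, with value
`∞` off the domain. (For a closable form the gradient in the closure is unique up to null sets, so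
that the infimum is over a single value.) -/
def formValue (μ : Measure α) (ν : Measure α') (S : Set ((α → ℝ) × (α' → V))) (u : α → ℝ) : ℝ≥0∞ :=
  ⨅ (G : α' → V) (_ : IsClosureGradient μ ν S u G), eLpNorm G 2 ν ^ 2

end Closure

/-! ### The forms `ℰ^N` and `ℰ` -/

/-- Pairs `(f, ∇f)` with `f ∈ C^∞(Σ_N)`, `N = n + 1`. -/
def smoothGradients (n : ℕ) :
    Set ((EuclideanSpace ℝ (Fin n) → ℝ) × (EuclideanSpace ℝ (Fin n) → EuclideanSpace ℝ (Fin n))) :=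
  {p | ContDiff ℝ ∞ p.1 ∧ p.2 = fun x => gradient p.1 x}

/-- `𝒟(ℰ^N)`, for `N = n + 1`, as a set of functions (a subset of `ℒ²(Σ_N, q_N)`). -/
def domainN (β : ℝ) (n : ℕ) : Set (EuclideanSpace ℝ (Fin n) → ℝ) :=
  formDomain (q β n) (q β n) (smoothGradients n)

/-- `ℰ^N(u,u)`, for `N = n + 1`. -/
def energyN (β : ℝ) (n : ℕ) (u : EuclideanSpace ℝ (Fin n) → ℝ) : ℝ≥0∞ :=
  formValue (q β n) (q β n) (smoothGradients n) u

/-- Pairs `(u, ∇u)` with `u(g) = U(⟨f₁,g⟩, …, ⟨f_m,g⟩)`, `U ∈ C¹_c(ℝ^m)`, `fᵢ ∈ L²([0,1])`,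
where the `L²([0,1])`-gradient of `u` at `g` is `∇u|_g(t) = ∑ᵢ ∂ᵢU(⟨f₁,g⟩, …, ⟨f_m,g⟩) fᵢ(t)`. -/
def cylinderGradients : Set ((QuantileFun → ℝ) × (QuantileFun × I01 → ℝ)) :=
  {p | ∃ (m : ℕ) (U : (Fin m → ℝ) → ℝ) (f : Fin m → I01 → ℝ),
    ContDiff ℝ 1 U ∧ HasCompactSupport U ∧ (∀ i, MemLp (f i) 2 volume) ∧
    p.1 = (fun g => U fun i => pairing (f i) g) ∧
    p.2 = fun z => ∑ i, fderiv ℝ U (fun j => pairing (f j) z.1) (Pi.single i 1) * f i z.2}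

/-- `D(ℰ)`, as a set of functions (a subset of `ℒ²(𝒢, Q)`). -/
def domain (Q : Measure QuantileFun) : Set (QuantileFun → ℝ) :=
  formDomain Q (Q.prod (volume : Measure I01)) cylinderGradients

/-- `ℰ(u,u)`. -/
def energy (Q : Measure QuantileFun) (u : QuantileFun → ℝ) : ℝ≥0∞ :=
  formValue Q (Q.prod (volume : Measure I01)) cylinderGradients u

/-- `K` is a core of `ℰ`: it is contained in `D(ℰ)` and dense there for the form norm
`(‖u‖²_{L²} + ℰ(u,u))^{1/2}`. -/
def IsCore (Q : Measure QuantileFun) (K : Set (QuantileFun → ℝ)) : Prop :=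
  K ⊆ domain Q ∧ ∀ u ∈ domain Q, ∀ ε : ℝ≥0∞, 0 < ε →
    ∃ w ∈ K, eLpNorm (u - w) 2 Q ^ 2 + energy Q (u - w) < ε

/-! ### Conditional expectations and strong convergence -/

/-- The grid points `i / N`, `i = 1, …, N - 1`, where `N = n + 1`. -/
def gridPoint (n : ℕ) (i : Fin n) : I01 :=
  ⟨((i : ℕ) + 1 : ℝ) / ((n : ℝ) + 1), by positivity, by
    rw [div_lt_one (by positivity)]
    have : ((i : ℕ) : ℝ) < n := by exact_mod_cast i.2
    linarith⟩

/-- The map `g ↦ (g(1/N), …, g((N-1)/N))`, where `N = n + 1`. -/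
def gridEval (n : ℕ) : QuantileFun → EuclideanSpace ℝ (Fin n) := evalAt (gridPoint n)

theorem exists_gridCondExp (Q : Measure QuantileFun) (n : ℕ) (u : QuantileFun → ℝ) :
    ∃ v : EuclideanSpace ℝ (Fin n) → ℝ, Measurable v ∧
      Q[u | MeasurableSpace.comap (gridEval n) inferInstance] = v ∘ gridEval n := by
  obtain ⟨v, hv, h⟩ := (stronglyMeasurable_condExp (μ := Q) (f := u)
    (m := MeasurableSpace.comap (gridEval n) inferInstance)).exists_eq_measurable_comp
  exact ⟨v, hv.measurable, h⟩

/-- `(Φ^N u)(x) = 𝔼(u | g(i/N) = xⁱ, i = 1, …, N-1)`, where `N = n + 1`: a measurable function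
whose composition with the grid evaluation is the conditional expectation of `u` given
`g(1/N), …, g((N-1)/N)`. -/
def Phi (Q : Measure QuantileFun) (n : ℕ) (u : QuantileFun → ℝ) : EuclideanSpace ℝ (Fin n) → ℝ :=
  (exists_gridCondExp Q n u).choose

/-- Strong convergence, along the maps `Φ^N`, of `u_N ∈ L²(Σ_N, q_N)` to `u ∈ L²(𝒢, Q)`; the
sequence is indexed by `n = N - 1`. -/
def StrongConv (β : ℝ) (Q : Measure QuantileFun)
    (uN : (n : ℕ) → EuclideanSpace ℝ (Fin n) → ℝ) (u : QuantileFun → ℝ) : Prop :=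
  MemLp u 2 Q ∧ (∀ n, MemLp (uN n) 2 (q β n)) ∧
    ∃ v : ℕ → QuantileFun → ℝ, (∀ k, MemLp (v k) 2 Q) ∧
      Tendsto (fun k => eLpNorm (v k - u) 2 Q) atTop (𝓝 0) ∧
      Tendsto (fun k => limsup (fun n => eLpNorm (Phi Q n (v k) - uN n) 2 (q β n)) atTop)
        atTop (𝓝 0)

/-! ### Polynomials in the linear functionals -/

/-- The functional `l_f` for `f ∈ C([0,1])`. -/
def linFun (f : C(Set.Icc (0 : ℝ) 1, ℝ)) : QuantileFun → ℝ :=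
  pairing fun t => f ⟨t, Set.Ico_subset_Icc_self t.2⟩

/-- The function `u(g) = P(l_{f₁}(g), …, l_{f_m}(g))`; for a monomial `P` this is a product
`∏ l_{fᵢ}^{kᵢ}`. -/
def polyFun {m : ℕ} (P : MvPolynomial (Fin m) ℝ) (f : Fin m → C(Set.Icc (0 : ℝ) 1, ℝ)) :
    QuantileFun → ℝ :=
  fun g => MvPolynomial.eval (fun i => linFun (f i) g) P

/-- The set `K` of polynomials, the linear span of the products `∏ l_{fᵢ}^{kᵢ}`. -/
def polyClass : Set (QuantileFun → ℝ) :=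
  {u | ∃ (m : ℕ) (P : MvPolynomial (Fin m) ℝ) (f : Fin m → C(Set.Icc (0 : ℝ) 1, ℝ)),
    u = polyFun P f}

/-- The approximation `u_N = P(Φ^N l_{f₁}, …, Φ^N l_{f_m})`, where `N = n + 1`; for a monomial `P`
this is the product of conditional expectations `∏ (Φ^N l_{fᵢ})^{kᵢ}`. -/
def polyApprox (Q : Measure QuantileFun) {m : ℕ} (P : MvPolynomial (Fin m) ℝ)
    (f : Fin m → C(Set.Icc (0 : ℝ) 1, ℝ)) (n : ℕ) : EuclideanSpace ℝ (Fin n) → ℝ :=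
  fun x => MvPolynomial.eval (fun i => Phi Q n (linFun (f i)) x) P

end WassersteinDiffusion

end

open WassersteinDiffusion

/-! Everything in (2) rests on one formula. Given the grid values `g(i/N)`, the value `g(t)` splits
the increment over its cell by a Beta variable whose mean is the relative position of `t` in the
cell, so the conditional expectation of `g(t)` is the linear interpolation of the grid values. Hence
`Φ^N l_f` agrees a.e. with an affine function whose coefficients are the integrals of `f` against
hat functions (`Phi_pairing_ae_eq`), and `u_N` has a smooth representative, a polynomial in such
affine functions. For every `g` the interpolation converges to `g` at a.e. `t`, so these polynomials
converge boundedly to `u`. As conditional expectation is a contraction of L², the constant sequence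
`ũ_k = u` witnesses strong convergence. For the energies, `N |∇u_N|²` and `‖∇u‖²` are the same
expression `gradForm`, evaluated once at `N` times the Gram matrix of the affine coefficients and
once at the L² Gram matrix of the `fᵢ`; `tendsto_sum_linCoef_mul` says that the former matrix tends
to the latter.

The value of a form is an infimum over all gradients in the closure, so computing an energy requires
that the gradient be unique, i.e. closability. Both forms are closable by integration by parts for
ordered Dirichlet measures along fields tangential to the boundary (`integral_divergence_eq_zero`).
On the simplex the field is a coordinate direction times the two adjacent increments. On `𝒢` it is
`g ↦ φ ∘ g` with `φ(0) = φ(1) = 0`: its divergence on the grid is bounded independently of `N`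
(`abs_integral_fderiv_comp_le`), and `N → ∞` bounds the integral of `∇u` against the field by the L¹
norm of `u`. A closure gradient `G` of `0` is then orthogonal to each `φ ∘ g` used, for a.e. `g`.
Since a.e. `g` is strictly increasing, this forces `G(g, ·) = 0`. The one-coordinate integration by
parts also yields the interpolation formula, without any conditional law being computed.

For (1), the pairings with fixed `fᵢ` are bounded on `𝒢`, so only the behaviour of `U` on a ball
matters. The `fᵢ` are approximated by continuous functions in L², and `U` by polynomials, boundedly
together with first derivatives (`exists_polynomial_approx`). Conversely a bump function turns a
polynomial into an admissible `U` without changing the cylinder function. -/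

noncomputable section

namespace WassersteinDiffusion

/-! ### Coordinates with end points -/

section Coordinates

variable {n : ℕ}

/-- The vector `(0, v¹, …, vⁿ, 0)`. -/
def zeroEnds (v : Fin n → ℝ) : Fin (n + 2) → ℝ :=
  Fin.cons (0 : ℝ) (Fin.snoc v (0 : ℝ) : Fin (n + 1) → ℝ)

theorem ends_cases {p : Fin (n + 2) → Prop} (h0 : p 0) (hl : p (Fin.last (n + 1)))
    (hm : ∀ j : Fin n, p j.castSucc.succ) (k : Fin (n + 2)) : p k := by
  refine Fin.cases h0 (fun k => ?_) k
  refine Fin.lastCases ?_ (fun j => hm j) k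
  simpa using hl

@[simp] theorem withEnds_zero (x : Fin n → ℝ) : withEnds x 0 = 0 := rfl

@[simp] theorem withEnds_last (x : Fin n → ℝ) : withEnds x (Fin.last (n + 1)) = 1 := by
  rw [← Fin.succ_last, withEnds, Fin.cons_succ, Fin.snoc_last]

@[simp] theorem withEnds_mid (x : Fin n → ℝ) (j : Fin n) : withEnds x j.castSucc.succ = x j := by
  rw [withEnds, Fin.cons_succ, Fin.snoc_castSucc]

@[simp] theorem withEnds_mid' (x : Fin n → ℝ) (j : Fin n) : withEnds x j.succ.castSucc = x j := by
  rw [← Fin.succ_castSucc, withEnds_mid]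

@[simp] theorem zeroEnds_zero (x : Fin n → ℝ) : zeroEnds x 0 = 0 := rfl

@[simp] theorem zeroEnds_last (x : Fin n → ℝ) : zeroEnds x (Fin.last (n + 1)) = 0 := by
  rw [← Fin.succ_last, zeroEnds, Fin.cons_succ, Fin.snoc_last]

@[simp] theorem zeroEnds_mid (x : Fin n → ℝ) (j : Fin n) : zeroEnds x j.castSucc.succ = x j := by
  rw [zeroEnds, Fin.cons_succ, Fin.snoc_castSucc]

/-- The linear part of `x ↦ withEnds x k`. -/
def endCLM (n : ℕ) (k : Fin (n + 2)) : EuclideanSpace ℝ (Fin n) →L[ℝ] ℝ :=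
  (Fin.cons 0 (Fin.snoc (fun j => EuclideanSpace.proj j) 0 :
    Fin (n + 1) → (EuclideanSpace ℝ (Fin n) →L[ℝ] ℝ)) :
    Fin (n + 2) → (EuclideanSpace ℝ (Fin n) →L[ℝ] ℝ)) k

theorem endCLM_apply (k : Fin (n + 2)) (v : EuclideanSpace ℝ (Fin n)) :
    endCLM n k v = zeroEnds (fun j => v j) k := by
  induction k using ends_cases with
  | h0 => simp [endCLM]
  | hl => rw [← Fin.succ_last, endCLM, Fin.cons_succ, Fin.snoc_last]; simp
  | hm j => simp [endCLM]

theorem withEnds_eq_add (x : Fin n → ℝ) (k : Fin (n + 2)) :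
    withEnds x k = withEnds (fun _ : Fin n => (0 : ℝ)) k + zeroEnds x k := by
  induction k using ends_cases <;> simp

theorem hasFDerivAt_withEnds (k : Fin (n + 2)) (x : EuclideanSpace ℝ (Fin n)) :
    HasFDerivAt (fun x : EuclideanSpace ℝ (Fin n) => withEnds (fun j => x j) k) (endCLM n k) x := by
  have h : (fun x : EuclideanSpace ℝ (Fin n) => withEnds (fun j => x j) k) =
      fun x => withEnds (fun _ : Fin n => (0 : ℝ)) k + endCLM n k x := by
    ext x; rw [withEnds_eq_add, endCLM_apply]
  rw [h]
  exact (endCLM n k).hasFDerivAt.const_add _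

/-- The increments of `(0, v, 0)`. -/
def zeroIncrement (v : Fin n → ℝ) (i : Fin (n + 1)) : ℝ :=
  zeroEnds v i.succ - zeroEnds v i.castSucc

/-- The linear part of `x ↦ increment x i`. -/
def incCLM (n : ℕ) (i : Fin (n + 1)) : EuclideanSpace ℝ (Fin n) →L[ℝ] ℝ :=
  endCLM n i.succ - endCLM n i.castSucc

theorem incCLM_apply (i : Fin (n + 1)) (v : EuclideanSpace ℝ (Fin n)) :
    incCLM n i v = zeroIncrement (fun j => v j) i := by
  simp [incCLM, zeroIncrement, endCLM_apply]

theorem hasFDerivAt_increment (i : Fin (n + 1)) (x : EuclideanSpace ℝ (Fin n)) :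
    HasFDerivAt (fun x : EuclideanSpace ℝ (Fin n) => increment (fun j => x j) i) (incCLM n i) x :=
  (hasFDerivAt_withEnds _ x).sub (hasFDerivAt_withEnds _ x)

theorem contDiff_withEnds {m : WithTop ℕ∞} (k : Fin (n + 2)) :
    ContDiff ℝ m (fun x : EuclideanSpace ℝ (Fin n) => withEnds (fun j => x j) k) := by
  have h : (fun x : EuclideanSpace ℝ (Fin n) => withEnds (fun j => x j) k) =
      fun x => withEnds (fun _ : Fin n => (0 : ℝ)) k + endCLM n k x := by
    ext x; rw [withEnds_eq_add, endCLM_apply]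
  rw [h]
  exact contDiff_const.add (endCLM n k).contDiff

theorem contDiff_increment {m : WithTop ℕ∞} (i : Fin (n + 1)) :
    ContDiff ℝ m (fun x : EuclideanSpace ℝ (Fin n) => increment (fun j => x j) i) :=
  (contDiff_withEnds _).sub (contDiff_withEnds _)

theorem continuous_increment (i : Fin (n + 1)) :
    Continuous (fun x : EuclideanSpace ℝ (Fin n) => increment (fun j => x j) i) :=
  (contDiff_increment (m := 0) i).continuous

theorem sum_succ_sub_castSucc {m : ℕ} (F : Fin (m + 1) → ℝ) :
    ∑ i : Fin m, (F i.succ - F i.castSucc) = F (Fin.last m) - F 0 := by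
  have h1 := Fin.sum_univ_succ F
  have h2 := Fin.sum_univ_castSucc F
  rw [Finset.sum_sub_distrib]
  linarith

theorem sum_increment (x : Fin n → ℝ) : ∑ i, increment x i = 1 := by
  simp_rw [increment]
  rw [sum_succ_sub_castSucc, withEnds_last, withEnds_zero, sub_zero]

/-! ### The open ordered simplex -/

/-- The open ordered simplex `{0 < x¹ < … < xⁿ < 1}`. -/
def openSimplex (n : ℕ) : Set (EuclideanSpace ℝ (Fin n)) :=
  {x | ∀ i, 0 < increment (fun j => x j) i}

theorem mem_orderedSimplex_iff {x : EuclideanSpace ℝ (Fin n)} :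
    x ∈ orderedSimplex n ↔ ∀ i, 0 ≤ increment (fun j => x j) i := by
  simp only [orderedSimplex, Set.mem_ofPred_eq, Fin.monotone_iff_le_succ, increment, sub_nonneg]

theorem openSimplex_subset : openSimplex n ⊆ orderedSimplex n :=
  fun _ hx => mem_orderedSimplex_iff.2 fun i => (hx i).le

theorem isOpen_openSimplex : IsOpen (openSimplex n) := by
  simp only [openSimplex, Set.ofPred_forall]
  exact isOpen_iInter_of_finite fun i => isOpen_lt continuous_const (continuous_increment i)

theorem withEnds_mem_Icc {x : Fin n → ℝ} (hx : Monotone (withEnds x)) (k : Fin (n + 2)) :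
    withEnds x k ∈ Set.Icc (0 : ℝ) 1 := by
  constructor
  · simpa using hx (Fin.zero_le k)
  · simpa using hx (Fin.le_last k)

theorem isCompact_orderedSimplex : IsCompact (orderedSimplex n) := by
  apply Metric.isCompact_of_isClosed_isBounded
  · have : orderedSimplex n = ⋂ i, {x | 0 ≤ increment (fun j => x j) i} := by
      ext x; simp [mem_orderedSimplex_iff]
    rw [this]
    exact isClosed_iInter fun i => isClosed_le continuous_const (continuous_increment i)
  · refine (Metric.isBounded_closedBall (x := (0 : EuclideanSpace ℝ (Fin n)))
      (r := Real.sqrt n)).subset fun x hx => ?_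
    rw [mem_closedBall_zero_iff, EuclideanSpace.norm_eq]
    apply Real.sqrt_le_sqrt
    calc ∑ i, ‖x i‖ ^ 2 ≤ ∑ _i : Fin n, (1 : ℝ) := by
          refine Finset.sum_le_sum fun i _ => ?_
          have h := withEnds_mem_Icc hx i.castSucc.succ
          rw [withEnds_mid] at h
          rw [Real.norm_eq_abs, sq_abs]
          nlinarith [h.1, h.2]
      _ = n := by simp

theorem withEnds_gridPoint (k : Fin (n + 2)) :
    withEnds (fun j => (gridPoint n j : ℝ)) k = (k : ℝ) / ((n : ℝ) + 1) := by
  induction k using ends_cases with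
  | h0 => simp
  | hl => rw [withEnds_last, Fin.val_last]; push_cast; field_simp
  | hm j => rw [withEnds_mid]; simp [gridPoint]

theorem increment_gridPoint (i : Fin (n + 1)) :
    increment (fun j => (gridPoint n j : ℝ)) i = 1 / ((n : ℝ) + 1) := by
  rw [increment, withEnds_gridPoint, withEnds_gridPoint]
  simp
  field_simp
  ring

/-- The face is empty or an affine subspace. It is proper because the equally spaced point has all
increments equal to `1 / (n + 1)`. -/
theorem volume_increment_eq_zero (i : Fin (n + 1)) :
    volume {x : EuclideanSpace ℝ (Fin n) | increment (fun j => x j) i = 0} = 0 := by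
  set S := {x : EuclideanSpace ℝ (Fin n) | increment (fun j => x j) i = 0} with hS
  rcases S.eq_empty_or_nonempty with h | ⟨p, hp⟩
  · rw [h, measure_empty]
  have hlin : ∀ x : EuclideanSpace ℝ (Fin n), increment (fun j => x j) i =
      increment (fun j => p j) i + incCLM n i (x - p) := by
    intro x
    rw [map_sub, incCLM_apply, incCLM_apply, increment, increment, zeroIncrement, zeroIncrement,
      withEnds_eq_add, withEnds_eq_add (fun j => x j) i.castSucc, withEnds_eq_add (fun j => p j),
      withEnds_eq_add (fun j => p j) i.castSucc]
    ring
  have hp' : increment (fun j => p j) i = 0 := hp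
  have h1 : S = (AffineSubspace.mk' p (LinearMap.ker (incCLM n i).toLinearMap) :
      Set (EuclideanSpace ℝ (Fin n))) := by
    ext x
    rw [SetLike.mem_coe, AffineSubspace.mem_mk', LinearMap.mem_ker, hS, Set.mem_ofPred_eq, hlin, hp',
      zero_add]
    simp
  rw [h1]
  apply Measure.addHaar_affineSubspace
  intro htop
  have h2 : (WithLp.toLp 2 fun j => (gridPoint n j : ℝ)) ∈ S := by
    rw [h1, htop]; trivial
  have h3 : increment (fun j => (gridPoint n j : ℝ)) i = 0 := h2
  rw [increment_gridPoint] at h3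
  have : (0 : ℝ) < 1 / ((n : ℝ) + 1) := by positivity
  linarith

/-- Discarding the boundary lets the Dirichlet density be handled only where every increment is
positive and its real powers are differentiable. -/
theorem openSimplex_ae_eq :
    (openSimplex n : Set (EuclideanSpace ℝ (Fin n))) =ᵐ[volume] orderedSimplex n := by
  refine openSimplex_subset.eventuallyLE.antisymm ?_
  have h : ∀ᵐ x : EuclideanSpace ℝ (Fin n), ∀ i, increment (fun j => x j) i ≠ 0 :=
    ae_all_iff.2 fun i => by
      rw [ae_iff]; simpa using volume_increment_eq_zero i
  filter_upwards [h] with x hx hx'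
  exact fun i => lt_of_le_of_ne (mem_orderedSimplex_iff.1 hx' i) (Ne.symm (hx i))

end Coordinates

/-! ### Integration by parts for ordered Dirichlet measures -/

section Cutoff

/-- A smooth function that vanishes for `s ≤ 1` and equals `1` for `s ≥ 2`. -/
def cutoff (s : ℝ) : ℝ := Real.smoothTransition (s - 1)

theorem contDiff_cutoff : ContDiff ℝ ∞ cutoff :=
  Real.smoothTransition.contDiff.comp (contDiff_id.sub contDiff_const)

theorem cutoff_of_le {s : ℝ} (hs : s ≤ 1) : cutoff s = 0 :=
  Real.smoothTransition.zero_of_nonpos (by linarith)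

theorem cutoff_of_ge {s : ℝ} (hs : 2 ≤ s) : cutoff s = 1 :=
  Real.smoothTransition.one_of_one_le (by linarith)

theorem cutoff_nonneg (s : ℝ) : 0 ≤ cutoff s := Real.smoothTransition.nonneg _

theorem cutoff_le_one (s : ℝ) : cutoff s ≤ 1 := Real.smoothTransition.le_one _

theorem abs_cutoff_le (s : ℝ) : |cutoff s| ≤ 1 := by
  rw [abs_of_nonneg (cutoff_nonneg s)]; exact cutoff_le_one s

theorem deriv_cutoff_of_lt {s : ℝ} (hs : s < 1) : deriv cutoff s = 0 := by
  have : cutoff =ᶠ[𝓝 s] fun _ => 0 := by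
    filter_upwards [Iio_mem_nhds hs] with r hr using cutoff_of_le (le_of_lt hr)
  rw [this.deriv_eq, deriv_const]

theorem deriv_cutoff_of_gt {s : ℝ} (hs : 2 < s) : deriv cutoff s = 0 := by
  have : cutoff =ᶠ[𝓝 s] fun _ => 1 := by
    filter_upwards [Ioi_mem_nhds hs] with r hr using cutoff_of_ge (le_of_lt hr)
  rw [this.deriv_eq, deriv_const]

theorem continuous_deriv_cutoff : Continuous (deriv cutoff) :=
  contDiff_cutoff.continuous_deriv (by simp)

/-- The derivative lives on `[1, 2]`. Taken at `s = r / ε`, this bounds `r` times the derivative of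
`r ↦ cutoff (r / ε)` uniformly in `ε`, which is what survives when the cut-off is removed. -/
theorem exists_deriv_cutoff_mul_le : ∃ M : ℝ, 0 ≤ M ∧ ∀ s, |deriv cutoff s * s| ≤ M := by
  obtain ⟨M, hM⟩ := (isCompact_Icc (a := (1 : ℝ)) (b := 2)).exists_bound_of_continuousOn
    (f := fun s => deriv cutoff s * s) (continuous_deriv_cutoff.mul continuous_id).continuousOn
  refine ⟨max M 0, le_max_right _ _, fun s => ?_⟩
  rcases lt_or_ge s 1 with h | h
  · simp [deriv_cutoff_of_lt h]
  rcases lt_or_ge 2 s with h' | h'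
  · simp [deriv_cutoff_of_gt h']
  · exact (hM s ⟨h, h'⟩).trans (le_max_left _ _)

/-- The function `r ^ b` cut off near `0`. -/
def cutPow (ε b r : ℝ) : ℝ := cutoff (r / ε) * r ^ b

variable {ε : ℝ}

theorem cutPow_of_le (hε : 0 < ε) (b : ℝ) {r : ℝ} (hr : r ≤ ε) : cutPow ε b r = 0 := by
  rw [cutPow, cutoff_of_le ((div_le_one hε).2 hr), zero_mul]

theorem contDiff_cutPow (hε : 0 < ε) (b : ℝ) : ContDiff ℝ 1 (cutPow ε b) := by
  rw [contDiff_iff_contDiffAt]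
  intro r
  rcases lt_or_ge r ε with h | h
  · have : cutPow ε b =ᶠ[𝓝 r] fun _ => 0 := by
      filter_upwards [Iio_mem_nhds h] with s hs using cutPow_of_le hε b (le_of_lt hs)
    exact contDiffAt_const.congr_of_eventuallyEq this
  · refine ContDiffAt.mul ?_ (Real.contDiffAt_rpow_const_of_ne (by linarith))
    exact ((contDiff_cutoff.of_le (by simp)).comp (contDiff_id.div_const ε)).contDiffAt

theorem deriv_cutPow_of_lt (hε : 0 < ε) (b : ℝ) {r : ℝ} (hr : r < ε) :
    deriv (cutPow ε b) r = 0 := by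
  have : cutPow ε b =ᶠ[𝓝 r] fun _ => 0 := by
    filter_upwards [Iio_mem_nhds hr] with s hs using cutPow_of_le hε b (le_of_lt hs)
  rw [this.deriv_eq, deriv_const]

/-- The factor `r` makes the coefficient of `r ^ b` a function of the scale-free variable `r / ε`,
hence bounded uniformly in `ε`. -/
theorem mul_deriv_cutPow (b : ℝ) {r : ℝ} (hr : 0 < r) :
    r * deriv (cutPow ε b) r =
      (deriv cutoff (r / ε) * (r / ε) + b * cutoff (r / ε)) * r ^ b := by
  have h1 : HasDerivAt (fun r => cutoff (r / ε)) (deriv cutoff (r / ε) * (1 / ε)) r :=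
    HasDerivAt.comp (h₂ := cutoff) r (contDiff_cutoff.differentiable (by simp) _).hasDerivAt
      ((hasDerivAt_id r).div_const ε)
  have h2 : HasDerivAt (fun r : ℝ => r ^ b) (b * r ^ (b - 1)) r :=
    Real.hasDerivAt_rpow_const (Or.inl hr.ne')
  have h3 : deriv (cutPow ε b) r = _ := (h1.mul h2).deriv
  rw [h3, Real.rpow_sub_one hr.ne']
  field_simp

end Cutoff

/-! ### Dirichlet weights and the divergence theorem for tangential fields. -/

section Dirichlet

variable {n : ℕ}

/-- The density of the ordered Dirichlet measure, up to the constant factor. -/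
def dirichletWeight (a : Fin (n + 1) → ℝ) (x : EuclideanSpace ℝ (Fin n)) : ℝ :=
  ∏ i, (increment (fun j => x j) i) ^ (a i - 1)

theorem measurable_increment (i : Fin (n + 1)) :
    Measurable fun x : EuclideanSpace ℝ (Fin n) => increment (fun j => x j) i :=
  (continuous_increment i).measurable

theorem measurable_dirichletWeight (a : Fin (n + 1) → ℝ) : Measurable (dirichletWeight a) :=
  Finset.measurable_prod _ fun i _ => (measurable_increment i).pow_const _

theorem orderedDirichlet_eq (a : Fin (n + 1) → ℝ) :
    orderedDirichlet a = (volume.restrict (openSimplex n)).withDensity fun x =>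
      ENNReal.ofReal (Real.Gamma (∑ i, a i) / (∏ i, Real.Gamma (a i)) * dirichletWeight a x) := by
  rw [orderedDirichlet, Measure.restrict_congr_set openSimplex_ae_eq]
  rfl

theorem ae_mem_openSimplex (a : Fin (n + 1) → ℝ) :
    ∀ᵐ x ∂(orderedDirichlet a), x ∈ openSimplex n := by
  rw [orderedDirichlet_eq]
  exact (withDensity_absolutelyContinuous _ _).ae_le
    (ae_restrict_mem isOpen_openSimplex.measurableSet)

theorem integral_orderedDirichlet (a : Fin (n + 1) → ℝ) (ha : ∀ i, 0 < a i)
    (F : EuclideanSpace ℝ (Fin n) → ℝ) :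
    ∫ x, F x ∂(orderedDirichlet a) = Real.Gamma (∑ i, a i) / (∏ i, Real.Gamma (a i)) *
      ∫ x in openSimplex n, dirichletWeight a x * F x := by
  have hC : 0 ≤ Real.Gamma (∑ i, a i) / (∏ i, Real.Gamma (a i)) :=
    div_nonneg (Real.Gamma_nonneg_of_nonneg (Finset.sum_nonneg fun i _ => (ha i).le))
      (Finset.prod_nonneg fun i _ => Real.Gamma_nonneg_of_nonneg (ha i).le)
  rw [orderedDirichlet_eq, integral_withDensity_eq_integral_toReal_smul
    (((measurable_dirichletWeight a).const_mul _).ennreal_ofReal)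
    (ae_of_all _ fun x => ENNReal.ofReal_lt_top), ← integral_const_mul]
  refine setIntegral_congr_fun isOpen_openSimplex.measurableSet fun x hx => ?_
  have : 0 ≤ dirichletWeight a x := Finset.prod_nonneg fun i _ => Real.rpow_nonneg (hx i).le _
  simp only [smul_eq_mul]
  rw [ENNReal.toReal_ofReal (mul_nonneg hC this), mul_assoc]

theorem integral_fderiv_mul_add_mul_fderiv {w : EuclideanSpace ℝ (Fin n) → ℝ}
    (hw : ContDiff ℝ 1 w) (hc : HasCompactSupport w) {Z : EuclideanSpace ℝ (Fin n) → ℝ}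
    (hZ : ContDiff ℝ 1 Z) (v : EuclideanSpace ℝ (Fin n)) :
    Integrable (fun x => fderiv ℝ w x v * Z x + w x * fderiv ℝ Z x v) ∧
    ∫ x, (fderiv ℝ w x v * Z x + w x * fderiv ℝ Z x v) = 0 := by
  have h1 : Continuous fun x => fderiv ℝ w x v :=
    (hw.continuous_fderiv (by simp)).clm_apply continuous_const
  have h2 : Continuous fun x => fderiv ℝ Z x v :=
    (hZ.continuous_fderiv (by simp)).clm_apply continuous_const
  have hc' : HasCompactSupport fun x => fderiv ℝ w x v := hc.fderiv_apply (𝕜 := ℝ) v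
  have i1 : Integrable (fun x => fderiv ℝ w x v * Z x) :=
    (h1.mul hZ.continuous).integrable_of_hasCompactSupport hc'.mul_right
  have i2 : Integrable (fun x => w x * fderiv ℝ Z x v) :=
    (hw.continuous.mul h2).integrable_of_hasCompactSupport hc.mul_right
  have i3 : Integrable (fun x => w x * Z x) :=
    (hw.continuous.mul hZ.continuous).integrable_of_hasCompactSupport hc.mul_right
  refine ⟨i1.add i2, ?_⟩
  rw [integral_add i1 i2, integral_mul_fderiv_eq_neg_fderiv_mul_of_integrable i1 i2 i3
    (fun x _ => hw.differentiable (by simp) x) (fun x _ => hZ.differentiable (by simp) x)]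
  ring

/-- The weight `∏ᵢ Dᵢ ^ (aᵢ - 1)`, cut off near the boundary of the simplex. -/
def cutWeight (ε : ℝ) (a : Fin (n + 1) → ℝ) (x : EuclideanSpace ℝ (Fin n)) : ℝ :=
  ∏ i, cutPow ε (a i - 1) (increment (fun j => x j) i)

variable {ε : ℝ} (a : Fin (n + 1) → ℝ)

theorem contDiff_cutWeight (hε : 0 < ε) : ContDiff ℝ 1 (cutWeight ε a) :=
  contDiff_prod fun i _ => (contDiff_cutPow hε _).comp (contDiff_increment i)

theorem cutWeight_eq_zero (hε : 0 < ε) {x : EuclideanSpace ℝ (Fin n)}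
    (hx : x ∉ openSimplex n) : cutWeight ε a x = 0 := by
  simp only [openSimplex, Set.mem_ofPred_eq, not_forall, not_lt] at hx
  obtain ⟨i, hi⟩ := hx
  exact Finset.prod_eq_zero (Finset.mem_univ i) (cutPow_of_le hε _ (by linarith))

theorem hasCompactSupport_cutWeight (hε : 0 < ε) : HasCompactSupport (cutWeight ε a) :=
  HasCompactSupport.intro isCompact_orderedSimplex fun _ hx =>
    cutWeight_eq_zero a hε fun h => hx (openSimplex_subset h)

theorem fderiv_cutWeight (hε : 0 < ε) (x v : EuclideanSpace ℝ (Fin n)) :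
    fderiv ℝ (cutWeight ε a) x v =
      ∑ i, (∏ k ∈ Finset.univ.erase i, cutPow ε (a k - 1) (increment (fun j => x j) k)) *
        (deriv (cutPow ε (a i - 1)) (increment (fun j => x j) i) *
          zeroIncrement (fun j => v j) i) := by
  have h : ∀ i ∈ Finset.univ, HasFDerivAt
      (fun x : EuclideanSpace ℝ (Fin n) => cutPow ε (a i - 1) (increment (fun j => x j) i))
      (deriv (cutPow ε (a i - 1)) (increment (fun j => x j) i) • incCLM n i) x := fun i _ =>
    HasDerivAt.comp_hasFDerivAt x
      ((contDiff_cutPow hε (a i - 1)).differentiable (by simp) _).hasDerivAt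
      (hasFDerivAt_increment i x)
  have h2 : fderiv ℝ (cutWeight ε a) x = _ := (HasFDerivAt.finsetProd h).fderiv
  rw [h2]
  simp [incCLM_apply]

theorem fderiv_cutWeight_eq_zero (hε : 0 < ε) {x : EuclideanSpace ℝ (Fin n)}
    (hx : x ∉ openSimplex n) (v : EuclideanSpace ℝ (Fin n)) :
    fderiv ℝ (cutWeight ε a) x v = 0 := by
  rw [fderiv_cutWeight a hε]
  simp only [openSimplex, Set.mem_ofPred_eq, not_forall, not_lt] at hx
  obtain ⟨k, hk⟩ := hx
  refine Finset.sum_eq_zero fun i _ => ?_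
  by_cases hik : i = k
  · subst hik
    rw [deriv_cutPow_of_lt hε _ (by linarith), zero_mul, mul_zero]
  · rw [Finset.prod_eq_zero (Finset.mem_erase.2 ⟨Ne.symm hik, Finset.mem_univ k⟩)
      (cutPow_of_le hε _ (by linarith)), zero_mul]

theorem cutWeight_eq_mul (x : EuclideanSpace ℝ (Fin n)) :
    cutWeight ε a x =
      dirichletWeight a x * ∏ i, cutoff (increment (fun j => x j) i / ε) := by
  simp only [cutWeight, dirichletWeight, cutPow, ← Finset.prod_mul_distrib]
  exact Finset.prod_congr rfl fun i _ => mul_comm _ _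

/-- Factoring out the uncut weight leaves a logarithmic derivative. It stays bounded as `ε → 0` as
long as the increments of `v` are dominated by those of `x`, which is the meaning of tangential
here. -/
theorem fderiv_cutWeight_eq_mul (hε : 0 < ε) {x : EuclideanSpace ℝ (Fin n)}
    (hx : x ∈ openSimplex n) (v : EuclideanSpace ℝ (Fin n)) :
    fderiv ℝ (cutWeight ε a) x v = dirichletWeight a x *
      ∑ i, (zeroIncrement (fun j => v j) i / increment (fun j => x j) i) *
        ((deriv cutoff (increment (fun j => x j) i / ε) * (increment (fun j => x j) i / ε) +
          (a i - 1) * cutoff (increment (fun j => x j) i / ε)) *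
          ∏ k ∈ Finset.univ.erase i, cutoff (increment (fun j => x j) k / ε)) := by
  rw [fderiv_cutWeight a hε, Finset.mul_sum]
  refine Finset.sum_congr rfl fun i _ => ?_
  have h1 := mul_deriv_cutPow (ε := ε) (a i - 1) (hx i)
  have h2 : dirichletWeight a x = increment (fun j => x j) i ^ (a i - 1) *
      ∏ k ∈ Finset.univ.erase i, increment (fun j => x j) k ^ (a k - 1) :=
    (Finset.mul_prod_erase _ _ (Finset.mem_univ i)).symm
  have h3 : deriv (cutPow ε (a i - 1)) (increment (fun j => x j) i) =
      (deriv cutoff (increment (fun j => x j) i / ε) * (increment (fun j => x j) i / ε) +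
        (a i - 1) * cutoff (increment (fun j => x j) i / ε)) *
        increment (fun j => x j) i ^ (a i - 1) / increment (fun j => x j) i := by
    rw [← h1, mul_div_cancel_left₀ _ (hx i).ne']
  rw [h3, h2]
  simp only [cutPow, Finset.prod_mul_distrib]
  ring

/-- Integration by parts: the divergence of a vector field with respect to an ordered Dirichlet
measure has mean zero if the field is tangential at the boundary. -/
theorem integral_divergence_eq_zero (ha : ∀ i, 0 < a i) [IsFiniteMeasure (orderedDirichlet a)]
    (Z : Fin n → EuclideanSpace ℝ (Fin n) → ℝ) (hZ : ∀ j, ContDiff ℝ 1 (Z j)) (C : ℝ)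
    (hC : ∀ x ∈ openSimplex n, ∀ i,
      |zeroIncrement (fun j => Z j x) i / increment (fun j => x j) i| ≤ C) :
    ∫ x, (∑ j, fderiv ℝ (Z j) x (EuclideanSpace.single j 1) +
      ∑ i, (a i - 1) * (zeroIncrement (fun j => Z j x) i / increment (fun j => x j) i))
        ∂(orderedDirichlet a) = 0 := by
  let b : Fin (n + 1) → EuclideanSpace ℝ (Fin n) → ℝ := fun i x =>
    zeroIncrement (fun j => Z j x) i / increment (fun j => x j) i
  let div : EuclideanSpace ℝ (Fin n) → ℝ := fun x =>
    ∑ j, fderiv ℝ (Z j) x (EuclideanSpace.single j 1)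
  -- The divergence of `Z` with respect to the cut-off weight, divided by the uncut weight; its
  -- integral vanishes exactly for each `ε > 0`.
  let F : ℝ → EuclideanSpace ℝ (Fin n) → ℝ := fun ε x =>
    (∏ i, cutoff (increment (fun j => x j) i / ε)) * div x +
    ∑ i, b i x *
      ((deriv cutoff (increment (fun j => x j) i / ε) * (increment (fun j => x j) i / ε) +
        (a i - 1) * cutoff (increment (fun j => x j) i / ε)) *
        ∏ k ∈ Finset.univ.erase i, cutoff (increment (fun j => x j) k / ε))
  have hdiv : Continuous div := continuous_finsetSum _ fun j _ =>
    ((hZ j).continuous_fderiv (by simp)).clm_apply continuous_const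
  have hbm : ∀ i, Measurable (b i) := fun i => by
    refine Measurable.div ?_ (measurable_increment i)
    have : (fun x : EuclideanSpace ℝ (Fin n) => zeroIncrement (fun j => Z j x) i) =
        fun x => incCLM n i (WithLp.toLp 2 fun j => Z j x) := by
      ext x; rw [incCLM_apply]
    rw [this]
    refine ((incCLM n i).continuous.comp ?_).measurable
    exact (PiLp.continuous_toLp 2 _).comp (continuous_pi fun j => (hZ j).continuous)
  have hε : ∀ ε, 0 < ε → ∫ x, F ε x ∂(orderedDirichlet a) = 0 := by
    intro ε hε
    rw [integral_orderedDirichlet a ha]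
    have key : ∫ x, ∑ j, (fderiv ℝ (cutWeight ε a) x (EuclideanSpace.single j 1) * Z j x +
        cutWeight ε a x * fderiv ℝ (Z j) x (EuclideanSpace.single j 1)) = 0 := by
      have := fun j => integral_fderiv_mul_add_mul_fderiv (contDiff_cutWeight a hε)
        (hasCompactSupport_cutWeight a hε) (hZ j) (EuclideanSpace.single j 1)
      rw [integral_finsetSum _ fun j _ => (this j).1]
      exact Finset.sum_eq_zero fun j _ => (this j).2
    rw [← setIntegral_eq_integral_of_forall_compl_eq_zero (s := openSimplex n)] at key
    · rw [← mul_zero (Real.Gamma (∑ i, a i) / (∏ i, Real.Gamma (a i))), ← key]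
      congr 1
      refine setIntegral_congr_fun isOpen_openSimplex.measurableSet fun x hx => ?_
      rw [Finset.sum_add_distrib, ← Finset.mul_sum]
      have h1 : ∑ j, fderiv ℝ (cutWeight ε a) x (EuclideanSpace.single j 1) * Z j x =
          fderiv ℝ (cutWeight ε a) x (WithLp.toLp 2 fun j => Z j x) := by
        conv_rhs => rw [← (EuclideanSpace.basisFun (Fin n) ℝ).sum_repr
          (WithLp.toLp 2 fun j => Z j x)]
        simp [map_sum, mul_comm]
      rw [h1, fderiv_cutWeight_eq_mul a hε hx, cutWeight_eq_mul]
      simp only [F, div, b]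
      ring
    · intro x hx
      refine Finset.sum_eq_zero fun j _ => ?_
      rw [cutWeight_eq_zero a hε hx, fderiv_cutWeight_eq_zero a hε hx]
      ring
  obtain ⟨M, hM0, hM⟩ := exists_deriv_cutoff_mul_le
  obtain ⟨K, hK⟩ := isCompact_orderedSimplex.exists_bound_of_continuousOn hdiv.continuousOn
  have hεpos : ∀ k : ℕ, (0 : ℝ) < 1 / ((k : ℝ) + 1) := fun k => by positivity
  have hprod : ∀ (s : Finset (Fin (n + 1))) (ε : ℝ) (x : EuclideanSpace ℝ (Fin n)),
      |∏ i ∈ s, cutoff (increment (fun j => x j) i / ε)| ≤ 1 := fun s ε x => by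
    rw [Finset.abs_prod]
    exact Finset.prod_le_one (fun i _ => abs_nonneg _) fun i _ => abs_cutoff_le _
  -- The dominating constant is uniform in `ε`: `K` bounds the Euclidean divergence, `C` the
  -- quotients of increments, and `M + |a i - 1|` the scale-free factors.
  have hlim := tendsto_integral_of_dominated_convergence (μ := orderedDirichlet a)
    (F := fun k : ℕ => F (1 / ((k : ℝ) + 1))) (f := fun x => div x + ∑ i, (a i - 1) * b i x)
    (fun _ => K + ∑ i : Fin (n + 1), C * (M + |a i - 1|)) ?_ (integrable_const _) ?_ ?_
  · refine tendsto_nhds_unique hlim ?_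
    simp only [hε _ (hεpos _)]
    exact tendsto_const_nhds
  · intro k
    refine Measurable.aestronglyMeasurable ?_
    have hc : ∀ i, Measurable fun x : EuclideanSpace ℝ (Fin n) =>
        cutoff (increment (fun j => x j) i / (1 / ((k : ℝ) + 1))) := fun i =>
      contDiff_cutoff.continuous.measurable.comp ((measurable_increment i).div_const _)
    have hd : ∀ i, Measurable fun x : EuclideanSpace ℝ (Fin n) =>
        deriv cutoff (increment (fun j => x j) i / (1 / ((k : ℝ) + 1))) := fun i =>
      continuous_deriv_cutoff.measurable.comp ((measurable_increment i).div_const _)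
    refine Measurable.add ((Finset.measurable_prod _ fun i _ => hc i).mul hdiv.measurable) ?_
    refine Finset.measurable_sum _ fun i _ => (hbm i).mul (Measurable.mul ?_
      (Finset.measurable_prod _ fun i _ => hc i))
    exact ((hd i).mul ((measurable_increment i).div_const _)).add ((hc i).const_mul _)
  · intro k
    filter_upwards [ae_mem_openSimplex a] with x hx
    refine (norm_add_le _ _).trans (add_le_add ?_ ((norm_sum_le _ _).trans
      (Finset.sum_le_sum fun i _ => ?_)))
    · rw [norm_mul]
      have h1 := hprod Finset.univ (1 / ((k : ℝ) + 1)) x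
      have h2 := hK x (openSimplex_subset hx)
      rw [Real.norm_eq_abs]
      calc _ ≤ 1 * ‖div x‖ := mul_le_mul_of_nonneg_right h1 (norm_nonneg _)
        _ ≤ K := by linarith
    · have hC0 : 0 ≤ C := (abs_nonneg _).trans (hC x hx i)
      simp only [norm_mul, Real.norm_eq_abs]
      refine mul_le_mul (hC x hx i) ?_ (by positivity) hC0
      calc _ ≤ (M + |a i - 1|) * 1 := by
            refine mul_le_mul ?_ (hprod _ _ x) (abs_nonneg _) (by positivity)
            refine (abs_add_le _ _).trans (add_le_add (hM _) ?_)
            rw [abs_mul]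
            exact mul_le_of_le_one_right (abs_nonneg _) (abs_cutoff_le _)
        _ = _ := mul_one _
  · filter_upwards [ae_mem_openSimplex a] with x hx
    have h1 : ∀ i, Tendsto (fun k : ℕ => increment (fun j => x j) i / (1 / ((k : ℝ) + 1))) atTop
        atTop := fun i => by
      simp only [div_div_eq_mul_div, div_one]
      exact ((tendsto_natCast_atTop_atTop).atTop_add tendsto_const_nhds).const_mul_atTop (hx i)
    -- At an interior point every cut-off is eventually `1` with derivative `0`, so the sequence is
    -- eventually constant.
    have h2 : ∀ᶠ k : ℕ in atTop, ∀ i, 2 < increment (fun j => x j) i / (1 / ((k : ℝ) + 1)) :=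
      eventually_all.2 fun i => (h1 i).eventually_gt_atTop 2
    refine tendsto_const_nhds.congr' ?_
    filter_upwards [h2] with k hk
    simp only [F]
    simp only [deriv_cutoff_of_gt (hk _), cutoff_of_ge (hk _).le, Finset.prod_const_one]
    simp [mul_comm]

end Dirichlet

/-! ### The two families of vector fields: single coordinates, and one function applied to all
coordinates. -/

section Consequences

variable {n : ℕ}

theorem zeroEnds_single (j : Fin n) (c : ℝ) (k : Fin (n + 2)) :
    zeroEnds (Pi.single j c) k = if k = j.castSucc.succ then c else 0 := by
  induction k using ends_cases with
  | h0 => rw [zeroEnds_zero, if_neg (Fin.succ_ne_zero _).symm]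
  | hl =>
    rw [zeroEnds_last, if_neg]
    rw [← Fin.succ_last, Fin.succ_inj]
    exact (Fin.castSucc_lt_last j).ne'
  | hm i =>
    rw [zeroEnds_mid, Pi.single_apply]
    simp only [Fin.succ_inj, Fin.castSucc_inj]

theorem zeroIncrement_single (j : Fin n) (c : ℝ) (i : Fin (n + 1)) :
    zeroIncrement (Pi.single j c) i =
      (if i = j.castSucc then c else 0) - (if i = j.succ then c else 0) := by
  rw [zeroIncrement, zeroEnds_single, zeroEnds_single]
  simp only [Fin.succ_inj]
  simp only [Fin.succ_castSucc j, Fin.castSucc_inj]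

theorem increment_le_one {x : EuclideanSpace ℝ (Fin n)} (hx : x ∈ orderedSimplex n)
    (i : Fin (n + 1)) : increment (fun j => x j) i ≤ 1 := by
  have h1 := withEnds_mem_Icc hx i.succ
  have h2 := withEnds_mem_Icc hx i.castSucc
  rw [increment]
  linarith [h1.2, h2.1]

theorem increment_nonneg {x : EuclideanSpace ℝ (Fin n)} (hx : x ∈ orderedSimplex n)
    (i : Fin (n + 1)) : 0 ≤ increment (fun j => x j) i :=
  mem_orderedSimplex_iff.1 hx i

/-- Integration by parts in a single coordinate. -/
theorem integral_coordinate_parts {a : Fin (n + 1) → ℝ} (ha : ∀ i, 0 < a i)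
    [IsFiniteMeasure (orderedDirichlet a)] {F : EuclideanSpace ℝ (Fin n) → ℝ}
    (hF : ContDiff ℝ 1 F) (j : Fin n) :
    ∫ x, (fderiv ℝ F x (EuclideanSpace.single j 1) *
        (increment (fun k => x k) j.castSucc * increment (fun k => x k) j.succ) +
      F x * (a j.castSucc * increment (fun k => x k) j.succ -
        a j.succ * increment (fun k => x k) j.castSucc)) ∂(orderedDirichlet a) = 0 := by
  -- Moving the coordinate `j` changes only the two adjacent increments. The factor formed by their
  -- product cancels both denominators, so the field is tangential and no singular term remains.
  let c : EuclideanSpace ℝ (Fin n) → ℝ := fun x =>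
    F x * (increment (fun k => x k) j.castSucc * increment (fun k => x k) j.succ)
  have hc : ContDiff ℝ 1 c := hF.mul ((contDiff_increment _).mul (contDiff_increment _))
  let Z : Fin n → EuclideanSpace ℝ (Fin n) → ℝ := fun k x => (Pi.single j (c x) : Fin n → ℝ) k
  have hZeq : ∀ k, k ≠ j → Z k = fun _ => 0 := fun k hk => by ext x; simp [Z, hk]
  have hZj : Z j = c := by ext x; simp [Z]
  have hZ : ∀ k, ContDiff ℝ 1 (Z k) := fun k => by
    by_cases hk : k = j
    · rw [hk, hZj]; exact hc
    · rw [hZeq k hk]; exact contDiff_const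
  have hb : ∀ x ∈ openSimplex n, ∀ i,
      zeroIncrement (fun k => Z k x) i / increment (fun k => x k) i =
        (if i = j.castSucc then F x * increment (fun k => x k) j.succ else 0) -
        (if i = j.succ then F x * increment (fun k => x k) j.castSucc else 0) := by
    intro x hx i
    have h1 : zeroIncrement (fun k => Z k x) i = zeroIncrement (Pi.single j (c x)) i := rfl
    have h2 := (hx i).ne'
    rw [h1, zeroIncrement_single]
    by_cases e1 : i = j.castSucc
    · have e2 : i ≠ j.succ := by rw [e1]; exact Fin.castSucc_lt_succ.ne
      subst e1
      simp only [e2, if_true, if_false, c, sub_zero]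
      field_simp
    · by_cases e2 : i = j.succ
      · subst e2
        simp only [e1, if_true, if_false, c, zero_sub]
        field_simp
      · simp [e1, e2]
  obtain ⟨K, hK⟩ := isCompact_orderedSimplex.exists_bound_of_continuousOn hF.continuous.continuousOn
  have key := integral_divergence_eq_zero a ha Z hZ (K + K) ?_
  · rw [← key]
    refine integral_congr_ae ?_
    filter_upwards [ae_mem_openSimplex a] with x hx
    simp only [hb x hx]
    rw [Finset.sum_eq_single j (fun k _ hk => by rw [hZeq k hk]; simp) (by simp), hZj]
    have h3 : HasFDerivAt c _ x := (hF.differentiable (by simp) x).hasFDerivAt.mul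
      ((hasFDerivAt_increment j.castSucc x).mul (hasFDerivAt_increment j.succ x))
    rw [h3.fderiv]
    have h4 : (fun k => EuclideanSpace.single j (1 : ℝ) k) = Pi.single j (1 : ℝ) := by
      ext k; simp [Pi.single_apply]
    have e : j.castSucc ≠ j.succ := Fin.castSucc_lt_succ.ne
    simp only [add_apply, smul_apply, incCLM_apply, h4, zeroIncrement_single,
      smul_eq_mul, mul_sub, Finset.sum_sub_distrib, mul_ite, mul_zero,
      Finset.sum_ite_eq', Finset.mem_univ, if_true, e, e.symm, if_false]
    ring
  · intro x hx i
    have hx' := openSimplex_subset hx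
    have hFx : |F x| ≤ K := hK x hx'
    have hK0 : 0 ≤ K := (abs_nonneg _).trans hFx
    have h1 : ∀ i, |F x * increment (fun k => x k) i| ≤ K := fun i => by
      rw [abs_mul, abs_of_nonneg (increment_nonneg hx' i)]
      calc _ ≤ K * 1 := mul_le_mul hFx (increment_le_one hx' i) (increment_nonneg hx' i) hK0
        _ = K := mul_one K
    rw [hb x hx i]
    refine (abs_sub _ _).trans (add_le_add ?_ ?_)
    · split_ifs
      · exact h1 _
      · simpa
    · split_ifs
      · exact h1 _
      · simpa

/-- Along the vector field `x ↦ (φ(x¹), …, φ(xⁿ))`, derivatives are controlled in mean by the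
function, uniformly in the dimension. -/
theorem abs_integral_fderiv_comp_le {c : ℝ} (hc : 0 < c)
    [IsFiniteMeasure (orderedDirichlet fun _ : Fin (n + 1) => c)] {φ : ℝ → ℝ}
    (hφ : ContDiff ℝ 2 φ) (h0 : φ 0 = 0) (h1 : φ 1 = 0) {B : ℝ}
    (hB : ∀ y ∈ Set.Icc (0 : ℝ) 1, |deriv φ y| ≤ B)
    (hB' : ∀ y ∈ Set.Icc (0 : ℝ) 1, ∀ z ∈ Set.Icc (0 : ℝ) 1, |deriv φ y - deriv φ z| ≤ B * |y - z|)
    {F : EuclideanSpace ℝ (Fin n) → ℝ} (hF : ContDiff ℝ 1 F) :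
    |∫ x, fderiv ℝ F x (WithLp.toLp 2 fun j => φ (x j))
        ∂(orderedDirichlet fun _ : Fin (n + 1) => c)| ≤
      (((n : ℝ) + 1) * c + 2) * B * ∫ x, |F x| ∂(orderedDirichlet fun _ : Fin (n + 1) => c) := by
  set μ := orderedDirichlet fun _ : Fin (n + 1) => c with hμ
  have hB0 : 0 ≤ B := (abs_nonneg _).trans (hB 0 (by simp))
  let Z : Fin n → EuclideanSpace ℝ (Fin n) → ℝ := fun j x => F x * φ (x j)
  have hpr : ∀ j : Fin n, ContDiff ℝ 1 fun x : EuclideanSpace ℝ (Fin n) => x j := fun j =>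
    (EuclideanSpace.proj (𝕜 := ℝ) j).contDiff
  have hφ1 : ContDiff ℝ 1 φ := hφ.of_le (by norm_num)
  have hZ : ∀ j, ContDiff ℝ 1 (Z j) := fun j => hF.mul (hφ1.comp (hpr j))
  -- Difference quotients of `φ` between neighbouring coordinates; because `φ` vanishes at `0` and
  -- `1`, they also describe the field at the two end points, which stay fixed.
  let s : Fin (n + 1) → EuclideanSpace ℝ (Fin n) → ℝ := fun i x =>
    (φ (withEnds (fun j => x j) i.succ) - φ (withEnds (fun j => x j) i.castSucc)) /
      increment (fun j => x j) i
  have hzero : ∀ (x : EuclideanSpace ℝ (Fin n)) k, zeroEnds (fun j => F x * φ (x j)) k =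
      F x * φ (withEnds (fun j => x j) k) := fun x k => by
    induction k using ends_cases <;> simp [h0, h1]
  have hb : ∀ (x : EuclideanSpace ℝ (Fin n)) i,
      zeroIncrement (fun j => Z j x) i / increment (fun j => x j) i = F x * s i x := by
    intro x i
    simp only [s, Z, zeroIncrement, hzero]
    ring
  have hmv : ∀ x ∈ openSimplex n, ∀ i : Fin (n + 1), ∃ ξ ∈ Set.Ioo (withEnds (fun j => x j) i.castSucc)
      (withEnds (fun j => x j) i.succ), s i x = deriv φ ξ := by
    intro x hx i
    have := hx i
    rw [increment, sub_pos] at this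
    obtain ⟨ξ, hξ, h⟩ := exists_deriv_eq_slope φ this hφ.continuous.continuousOn
      (hφ.differentiable (by simp)).differentiableOn
    exact ⟨ξ, hξ, h.symm⟩
  have hIoo : ∀ x ∈ openSimplex n, ∀ i : Fin (n + 1), Set.Ioo (withEnds (fun j => x j) i.castSucc)
      (withEnds (fun j => x j) i.succ) ⊆ Set.Icc 0 1 := fun x hx i y hy =>
    ⟨(withEnds_mem_Icc (openSimplex_subset hx) _).1.trans hy.1.le,
      hy.2.le.trans (withEnds_mem_Icc (openSimplex_subset hx) _).2⟩
  have hs : ∀ x ∈ openSimplex n, ∀ i, |s i x| ≤ B := by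
    intro x hx i
    obtain ⟨ξ, hξ, h⟩ := hmv x hx i
    rw [h]
    exact hB ξ (hIoo x hx i hξ)
  obtain ⟨K, hK⟩ := isCompact_orderedSimplex.exists_bound_of_continuousOn hF.continuous.continuousOn
  have key := integral_divergence_eq_zero (fun _ => c) (fun _ => hc) Z hZ (K * B) (by
    intro x hx i
    rw [hb, abs_mul]
    exact mul_le_mul (hK x (openSimplex_subset hx)) (hs x hx i) (abs_nonneg _)
      ((norm_nonneg _).trans (hK x (openSimplex_subset hx))))
  let κ : EuclideanSpace ℝ (Fin n) → ℝ := fun x =>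
    ∑ j : Fin n, deriv φ (x j) + ∑ i, (c - 1) * s i x
  have hκ : ∀ x ∈ openSimplex n, |κ x| ≤ (((n : ℝ) + 1) * c + 2) * B := by
    intro x hx
    -- The naive bound on `κ` grows with `n`. Pairing each `φ'(x^{i+1})` with the slope `s i` leaves
    -- three bounded pieces: the slopes give `(n + 1) c B`; the Lipschitz bound makes the
    -- differences at most `B` times increments of total `1`; and the end value `φ'(1)`, absent from
    -- the sum over `j`, costs one more `B`.
    have e : κ x = c * ∑ i, s i x +
        ∑ i : Fin (n + 1), (deriv φ (withEnds (fun j => x j) i.succ) - s i x) - deriv φ 1 := by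
      have := Fin.sum_univ_castSucc fun i : Fin (n + 1) => deriv φ (withEnds (fun j => x j) i.succ)
      simp only [withEnds_mid, Fin.succ_last, withEnds_last] at this
      simp only [κ, Finset.sum_sub_distrib, this, ← Finset.mul_sum]
      ring
    rw [e]
    have e1 : |∑ i, s i x| ≤ ((n : ℝ) + 1) * B := by
      refine (Finset.abs_sum_le_sum_abs _ _).trans ((Finset.sum_le_sum fun i _ => hs x hx i).trans ?_)
      simp
    have e2 : |∑ i : Fin (n + 1), (deriv φ (withEnds (fun j => x j) i.succ) - s i x)| ≤ B := by
      refine (Finset.abs_sum_le_sum_abs _ _).trans ?_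
      calc _ ≤ ∑ i, B * increment (fun j => x j) i := by
            refine Finset.sum_le_sum fun i _ => ?_
            obtain ⟨ξ, hξ, h⟩ := hmv x hx i
            rw [h]
            refine (hB' _ (withEnds_mem_Icc (openSimplex_subset hx) _) _ (hIoo x hx i hξ)).trans ?_
            refine mul_le_mul_of_nonneg_left ?_ hB0
            rw [abs_of_nonneg (by linarith [hξ.2]), increment]
            linarith [hξ.1]
        _ = B := by rw [← Finset.mul_sum, sum_increment, mul_one]
    have e3 := hB 1 (by simp)
    refine (abs_sub _ _).trans ?_
    refine (add_le_add ((abs_add_le _ _).trans (add_le_add ?_ e2)) e3).trans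
      (b := ((n : ℝ) + 1) * c * B + B + B) ?_
    · rw [abs_mul, abs_of_pos hc]
      nlinarith
    · linarith
  have hsm : ∀ i, Measurable (s i) := fun i => by
    refine Measurable.div ?_ (measurable_increment i)
    exact ((hφ.continuous.comp (contDiff_withEnds (m := 0) _).continuous).sub
      (hφ.continuous.comp (contDiff_withEnds (m := 0) _).continuous)).measurable
  have hdφ : Continuous (deriv φ) := hφ.continuous_deriv (by norm_num)
  have hκm : Measurable κ := by
    refine Measurable.add (Finset.measurable_sum _ fun j _ => ?_)
      (Finset.measurable_sum _ fun i _ => (hsm i).const_mul _)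
    exact (hdφ.comp (hpr j).continuous).measurable
  have hFi : Integrable F μ := by
    refine Integrable.of_bound hF.continuous.aestronglyMeasurable K ?_
    filter_upwards [ae_mem_openSimplex _] with x hx using hK x (openSimplex_subset hx)
  have hFκ : Integrable (fun x => F x * κ x) μ := by
    refine hFi.mul_bdd (c := (((n : ℝ) + 1) * c + 2) * B) hκm.aestronglyMeasurable ?_
    filter_upwards [ae_mem_openSimplex _] with x hx using hκ x hx
  have hdc : Continuous fun x : EuclideanSpace ℝ (Fin n) =>
      fderiv ℝ F x (WithLp.toLp 2 fun j => φ (x j)) :=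
    (hF.continuous_fderiv (by simp)).clm_apply ((PiLp.continuous_toLp 2 _).comp
      (continuous_pi fun j => hφ.continuous.comp (hpr j).continuous))
  obtain ⟨K', hK'⟩ := isCompact_orderedSimplex.exists_bound_of_continuousOn hdc.continuousOn
  have hdi : Integrable (fun x => fderiv ℝ F x (WithLp.toLp 2 fun j => φ (x j))) μ := by
    refine Integrable.of_bound hdc.aestronglyMeasurable K' ?_
    filter_upwards [ae_mem_openSimplex _] with x hx using hK' x (openSimplex_subset hx)
  have key2 : ∫ x, (fderiv ℝ F x (WithLp.toLp 2 fun j => φ (x j)) + F x * κ x) ∂μ = 0 := by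
    rw [← key]
    refine integral_congr_ae (ae_of_all _ fun x => ?_)
    simp only [hb]
    have hd : ∀ j, fderiv ℝ (Z j) x (EuclideanSpace.single j 1) =
        fderiv ℝ F x (EuclideanSpace.single j 1) * φ (x j) + F x * deriv φ (x j) := fun j => by
      have h3 : HasFDerivAt (fun x : EuclideanSpace ℝ (Fin n) => φ (x j))
          (deriv φ (x j) • EuclideanSpace.proj (𝕜 := ℝ) j) x :=
        HasDerivAt.comp_hasFDerivAt x (hφ.differentiable (by simp) _).hasDerivAt
          (EuclideanSpace.proj (𝕜 := ℝ) j).hasFDerivAt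
      have h4 : HasFDerivAt (Z j) _ x := (hF.differentiable (by simp) x).hasFDerivAt.mul h3
      rw [h4.fderiv]
      simp
      ring
    have h5 : fderiv ℝ F x (WithLp.toLp 2 fun j => φ (x j)) =
        ∑ j, fderiv ℝ F x (EuclideanSpace.single j 1) * φ (x j) := by
      conv_lhs => rw [← (EuclideanSpace.basisFun (Fin n) ℝ).sum_repr
          (WithLp.toLp 2 fun j => φ (x j))]
      simp [map_sum, mul_comm]
    simp only [hd, h5, κ, Finset.sum_add_distrib, mul_add, Finset.mul_sum]
    rw [add_assoc]
    congr 2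
    exact Finset.sum_congr rfl fun i _ => by ring
  rw [integral_add hdi hFκ] at key2
  rw [eq_neg_of_add_eq_zero_left key2, abs_neg]
  refine (abs_integral_le_integral_abs).trans ?_
  rw [← integral_const_mul]
  refine integral_mono_ae hFκ.abs (hFi.abs.const_mul _) ?_
  filter_upwards [ae_mem_openSimplex _] with x hx
  rw [abs_mul, mul_comm]
  exact mul_le_mul_of_nonneg_right (hκ x hx) (abs_nonneg _)

end Consequences

/-! ### Closures of gradient forms -/

section Closure

variable {α α' V : Type*} [MeasurableSpace α] [MeasurableSpace α'] [NormedAddCommGroup V]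
  {μ : Measure α} {ν : Measure α'} {S : Set ((α → ℝ) × (α' → V))}

theorem IsClosureGradient.of_mem {u : α → ℝ} {G : α' → V} (h : (u, G) ∈ S) (hu : MemLp u 2 μ)
    (hG : MemLp G 2 ν) : IsClosureGradient μ ν S u G :=
  ⟨hu, hG, fun _ => (u, G), fun _ => h, by simp, by simp⟩

theorem IsClosureGradient.congr {u u' : α → ℝ} {G : α' → V} (h : IsClosureGradient μ ν S u G)
    (huu' : u =ᵐ[μ] u') : IsClosureGradient μ ν S u' G := by
  obtain ⟨hu, hG, p, hp, h1, h2⟩ := h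
  refine ⟨(memLp_congr_ae huu').1 hu, hG, p, hp, ?_, h2⟩
  refine h1.congr fun k => eLpNorm_congr_ae ?_
  filter_upwards [huu'] with x hx
  simp [hx]

theorem tendsto_eLpNorm_sub_sub {f g : ℕ → α → V} {f' g' : α → V}
    (hf : ∀ k, AEStronglyMeasurable (f k) μ) (hg : ∀ k, AEStronglyMeasurable (g k) μ)
    (hf' : AEStronglyMeasurable f' μ) (hg' : AEStronglyMeasurable g' μ)
    (h1 : Tendsto (fun k => eLpNorm (f k - f') 2 μ) atTop (𝓝 0))
    (h2 : Tendsto (fun k => eLpNorm (g k - g') 2 μ) atTop (𝓝 0)) :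
    Tendsto (fun k => eLpNorm ((f k - g k) - (f' - g')) 2 μ) atTop (𝓝 0) := by
  have h3 := h1.add h2
  rw [add_zero] at h3
  refine tendsto_of_tendsto_of_tendsto_of_le_of_le tendsto_const_nhds h3 (fun _ => zero_le)
    fun k => ?_
  have e : (f k - g k) - (f' - g') = (f k - f') - (g k - g') := by abel
  simp only [e]
  exact eLpNorm_sub_le ((hf k).sub hf') ((hg k).sub hg') (by norm_num)

theorem IsClosureGradient.sub (hS : ∀ p ∈ S, ∀ r ∈ S, p - r ∈ S)
    (hm : ∀ p ∈ S, AEStronglyMeasurable p.1 μ ∧ AEStronglyMeasurable p.2 ν)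
    {u v : α → ℝ} {G H : α' → V} (hu : IsClosureGradient μ ν S u G)
    (hv : IsClosureGradient μ ν S v H) : IsClosureGradient μ ν S (u - v) (G - H) := by
  obtain ⟨hu, hG, p, hp, h1, h2⟩ := hu
  obtain ⟨hv, hH, r, hr, h3, h4⟩ := hv
  exact ⟨hu.sub hv, hG.sub hH, fun k => p k - r k, fun k => hS _ (hp k) _ (hr k),
    tendsto_eLpNorm_sub_sub (fun k => (hm _ (hp k)).1) (fun k => (hm _ (hr k)).1) hu.1 hv.1 h1 h3,
    tendsto_eLpNorm_sub_sub (fun k => (hm _ (hp k)).2) (fun k => (hm _ (hr k)).2) hG.1 hH.1 h2 h4⟩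

theorem formValue_le {u : α → ℝ} {G : α' → V} (hu : IsClosureGradient μ ν S u G) :
    formValue μ ν S u ≤ eLpNorm G 2 ν ^ 2 :=
  iInf₂_le G hu

/-- If the form is closable, its closure is computed by any gradient in the closure. -/
theorem formValue_eq (hS : ∀ p ∈ S, ∀ r ∈ S, p - r ∈ S)
    (hm : ∀ p ∈ S, AEStronglyMeasurable p.1 μ ∧ AEStronglyMeasurable p.2 ν)
    (hcl : ∀ G, IsClosureGradient μ ν S 0 G → G =ᵐ[ν] 0)
    {u : α → ℝ} {G : α' → V} (hu : IsClosureGradient μ ν S u G) :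
    formValue μ ν S u = eLpNorm G 2 ν ^ 2 := by
  refine le_antisymm (formValue_le hu) (le_iInf₂ fun H hH => le_of_eq ?_)
  have h := IsClosureGradient.sub hS hm hu hH
  rw [sub_self] at h
  congr 1
  refine eLpNorm_congr_ae ?_
  filter_upwards [hcl _ h] with x hx
  exact sub_eq_zero.1 hx

/-- Hölder's inequality: L² convergence implies convergence of pairings with a fixed L² function. -/
theorem tendsto_integral_mul_of_tendsto_eLpNorm {v : ℕ → α → ℝ} {v' h : α → ℝ}
    (hv : ∀ k, MemLp (v k) 2 μ) (hv' : MemLp v' 2 μ) (hh : MemLp h 2 μ)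
    (hlim : Tendsto (fun k => eLpNorm (v k - v') 2 μ) atTop (𝓝 0)) :
    Tendsto (fun k => ∫ x, v k x * h x ∂μ) atTop (𝓝 (∫ x, v' x * h x ∂μ)) := by
  refine tendsto_integral_of_L1' _ (hv'.integrable_mul hh).1
    (Eventually.of_forall fun k => (hv k).integrable_mul hh) ?_
  have h1 : Tendsto (fun k => eLpNorm (v k - v') 2 μ * eLpNorm h 2 μ) atTop (𝓝 0) := by
    have := ENNReal.Tendsto.mul_const (b := eLpNorm h 2 μ) hlim (Or.inr hh.2.ne)
    rwa [zero_mul] at this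
  refine tendsto_of_tendsto_of_tendsto_of_le_of_le tendsto_const_nhds h1 (fun _ => zero_le)
    fun k => ?_
  have h2 := eLpNorm_smul_le_mul_eLpNorm (p := 2) (q := 2) (r := 1) hh.1 ((hv k).sub hv').1
  refine le_trans (le_of_eq ?_) h2
  congr 1
  ext x
  simp [sub_mul]

end Closure

/-! ### Closability on the ordered simplex -/

section SimplexForm

variable {n : ℕ}

theorem smoothGradients_sub : ∀ p ∈ smoothGradients n, ∀ r ∈ smoothGradients n,
    p - r ∈ smoothGradients n := by
  rintro ⟨f, F⟩ ⟨hf, hF⟩ ⟨g, G⟩ ⟨hg, hG⟩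
  simp only at hf hF hg hG
  refine ⟨hf.sub hg, ?_⟩
  subst hF hG
  ext1 x
  have h : fderiv ℝ (f - g) x = _ :=
    fderiv_sub (hf.differentiable (by simp) x) (hg.differentiable (by simp) x)
  simp only [Prod.mk_sub_mk, Pi.sub_apply, gradient, h, map_sub]

theorem gradient_apply (f : EuclideanSpace ℝ (Fin n) → ℝ) (x : EuclideanSpace ℝ (Fin n))
    (j : Fin n) : gradient f x j = fderiv ℝ f x (EuclideanSpace.single j 1) := by
  rw [← inner_gradient_left, EuclideanSpace.inner_single_right]
  simp only [one_mul, conj_trivial]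

theorem continuous_gradient {f : EuclideanSpace ℝ (Fin n) → ℝ} (hf : ContDiff ℝ 1 f) :
    Continuous fun x => gradient f x :=
  (InnerProductSpace.toDual ℝ _).symm.continuous.comp (hf.continuous_fderiv (by simp))

theorem smoothGradients_aestronglyMeasurable (μ : Measure (EuclideanSpace ℝ (Fin n))) :
    ∀ p ∈ smoothGradients n, AEStronglyMeasurable p.1 μ ∧ AEStronglyMeasurable p.2 μ := by
  rintro ⟨f, F⟩ ⟨hf, hF⟩
  simp only at hf hF
  subst hF
  exact ⟨hf.continuous.aestronglyMeasurable,
    (continuous_gradient (hf.of_le (by simp))).aestronglyMeasurable⟩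

theorem memLp_of_continuous {V : Type*} [NormedAddCommGroup V] (a : Fin (n + 1) → ℝ)
    [IsFiniteMeasure (orderedDirichlet a)] {F : EuclideanSpace ℝ (Fin n) → V}
    [SecondCountableTopologyEither (EuclideanSpace ℝ (Fin n)) V]
    (hF : Continuous F) {p : ℝ≥0∞} : MemLp F p (orderedDirichlet a) := by
  obtain ⟨K, hK⟩ := isCompact_orderedSimplex.exists_bound_of_continuousOn hF.continuousOn
  refine MemLp.of_bound hF.aestronglyMeasurable K ?_
  filter_upwards [ae_mem_openSimplex a] with x hx using hK x (openSimplex_subset hx)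

/-- Integrating `∂_j f_k` against `θ D`, with `D` the product of the increments adjacent to `j`,
moves the derivative off `f_k` without a boundary term. If `f_k → 0` in L² the result tends to `0`,
so `D G_j` is orthogonal to every test function; and `D > 0` a.e. -/
theorem smoothGradients_closable {a : Fin (n + 1) → ℝ} (ha : ∀ i, 0 < a i)
    [IsFiniteMeasure (orderedDirichlet a)]
    (G : EuclideanSpace ℝ (Fin n) → EuclideanSpace ℝ (Fin n))
    (hG : IsClosureGradient (orderedDirichlet a) (orderedDirichlet a) (smoothGradients n) 0 G) :
    G =ᵐ[orderedDirichlet a] 0 := by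
  set μ := orderedDirichlet a with hμ
  obtain ⟨-, hGL, p, hp, h1, h2⟩ := hG
  suffices h : ∀ j, ∀ᵐ x ∂μ, G x j = 0 by
    filter_upwards [ae_all_iff.2 h] with x hx
    ext j
    simpa using hx j
  intro j
  have hpj : ∀ k, ContDiff ℝ ∞ (p k).1 := fun k => (hp k).1
  have hGj : MemLp (fun x => G x j) 2 μ :=
    hGL.mono (((EuclideanSpace.proj (𝕜 := ℝ) j).continuous.comp_aestronglyMeasurable hGL.1))
      (ae_of_all _ fun x => PiLp.norm_apply_le (G x) j)
  let D : EuclideanSpace ℝ (Fin n) → ℝ := fun x =>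
    increment (fun k => x k) j.castSucc * increment (fun k => x k) j.succ
  let D' : EuclideanSpace ℝ (Fin n) → ℝ := fun x =>
    a j.castSucc * increment (fun k => x k) j.succ -
        a j.succ * increment (fun k => x k) j.castSucc
  have hD : Continuous D := (continuous_increment _).mul (continuous_increment _)
  have hD' : Continuous D' :=
    ((continuous_increment _).const_mul _).sub ((continuous_increment _).const_mul _)
  suffices h : ∀ᵐ x ∂μ, D x * G x j = 0 by
    filter_upwards [h, ae_mem_openSimplex a] with x hx hxs
    exact (mul_eq_zero.1 hx).resolve_left (mul_pos (hxs _) (hxs _)).ne'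
  have hDG : Integrable (fun x => D x * G x j) μ :=
    (memLp_of_continuous a hD (p := 2)).integrable_mul hGj
  refine ae_eq_zero_of_integral_contDiff_smul_eq_zero hDG.locallyIntegrable fun θ hθ _ => ?_
  let e : EuclideanSpace ℝ (Fin n) := EuclideanSpace.single j 1
  have hθ1 : ContDiff ℝ 1 θ := hθ.of_le (by simp)
  have hθd : Continuous fun x => fderiv ℝ θ x e :=
    (hθ1.continuous_fderiv (by simp)).clm_apply continuous_const
  have hk : ∀ k, ∫ x, fderiv ℝ (p k).1 x e * (θ x * D x) ∂μ =
      - ∫ x, (p k).1 x * (fderiv ℝ θ x e * D x + θ x * D' x) ∂μ := by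
    intro k
    have hp1 : ContDiff ℝ 1 (p k).1 := (hpj k).of_le (by simp)
    have hpd : Continuous fun x => fderiv ℝ (p k).1 x e :=
      (hp1.continuous_fderiv (by simp)).clm_apply continuous_const
    have key := integral_coordinate_parts ha (hp1.mul hθ1) j
    have i1 : Integrable (fun x => fderiv ℝ (p k).1 x e * (θ x * D x)) μ :=
      memLp_one_iff_integrable.1 (memLp_of_continuous a (hpd.mul (hθ1.continuous.mul hD)))
    have i2 : Integrable (fun x => (p k).1 x * (fderiv ℝ θ x e * D x + θ x * D' x)) μ :=
      memLp_one_iff_integrable.1 (memLp_of_continuous a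
        (hp1.continuous.mul ((hθd.mul hD).add (hθ1.continuous.mul hD'))))
    rw [eq_neg_iff_add_eq_zero, ← integral_add i1 i2, ← key]
    refine integral_congr_ae (ae_of_all _ fun x => ?_)
    have h3 : HasFDerivAt ((p k).1 * θ) _ x := (hp1.differentiable (by simp) x).hasFDerivAt.mul
      (hθ1.differentiable (by simp) x).hasFDerivAt
    have h4 : fderiv ℝ (fun x => (p k).1 x * θ x) x = _ := h3.fderiv
    simp only [h4, add_apply, smul_apply, smul_eq_mul, D, D', e]
    ring
  have hgj : ∀ k, MemLp (fun x => fderiv ℝ (p k).1 x e) 2 μ := fun k =>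
    memLp_of_continuous a ((((hpj k).of_le (by simp) : ContDiff ℝ 1 (p k).1).continuous_fderiv
      (by simp)).clm_apply continuous_const)
  have l1 := tendsto_integral_mul_of_tendsto_eLpNorm hgj hGj
    (memLp_of_continuous a (hθ1.continuous.mul hD)) (by
      refine tendsto_of_tendsto_of_tendsto_of_le_of_le tendsto_const_nhds h2 (fun _ => zero_le)
        fun k => eLpNorm_mono fun x => ?_
      have h3 : ((p k).2 - G) x j = fderiv ℝ (p k).1 x e - G x j := by
        rw [(hp k).2]
        simp [gradient_apply, e]
      have h4 := PiLp.norm_apply_le (((p k).2 - G) x) j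
      rwa [h3] at h4)
  have l2 := tendsto_integral_mul_of_tendsto_eLpNorm (v' := 0)
    (fun k => memLp_of_continuous a (hpj k).continuous) (MemLp.zero' ) 
    (memLp_of_continuous a ((hθd.mul hD).add (hθ1.continuous.mul hD'))) h1
  have l3 := tendsto_nhds_unique l1 ((l2.neg).congr fun k => (hk k).symm)
  simp only [Pi.zero_apply, zero_mul, integral_zero, neg_zero] at l3
  rw [← l3]
  refine integral_congr_ae (ae_of_all _ fun x => ?_)
  simp only [smul_eq_mul, D, Pi.mul_apply]
  ring

end SimplexForm

/-! ### Measurability on the space of quantile functions -/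

section Measurability

theorem QuantileFun.nonneg (g : QuantileFun) (t : I01) : 0 ≤ g t := (g.2.1 t).1

theorem QuantileFun.le_one (g : QuantileFun) (t : I01) : g t ≤ 1 := (g.2.1 t).2

theorem QuantileFun.abs_le_one (g : QuantileFun) (t : I01) : |g t| ≤ 1 := by
  rw [abs_of_nonneg (g.nonneg t)]; exact g.le_one t

theorem QuantileFun.mono (g : QuantileFun) : Monotone (g : I01 → ℝ) := g.2.2.1

theorem QuantileFun.measurable (g : QuantileFun) : Measurable (g : I01 → ℝ) := g.mono.measurable

theorem QuantileFun.continuous_toL2 : Continuous QuantileFun.toL2 := continuous_induced_dom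

theorem pairing_eq_inner {f : I01 → ℝ} (hf : MemLp f 2 volume) (g : QuantileFun) :
    pairing f g = inner ℝ (hf.toLp f) g.toL2 := by
  rw [L2.inner_def]
  refine integral_congr_ae ?_
  filter_upwards [hf.coeFn_toLp, g.memLp.coeFn_toLp] with t h1 h2
  simp only [QuantileFun.toL2, h1, h2]
  simp [mul_comm]

theorem continuous_pairing {f : I01 → ℝ} (hf : MemLp f 2 volume) : Continuous (pairing f) := by
  have : pairing f = fun g => inner ℝ (hf.toLp f) g.toL2 := by
    ext g; exact pairing_eq_inner hf g
  rw [this]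
  exact continuous_const.inner QuantileFun.continuous_toL2

theorem measurable_pairing {f : I01 → ℝ} (hf : MemLp f 2 volume) : Measurable (pairing f) :=
  (continuous_pairing hf).measurable

/-- Supplies the normalisation of the right averages that recover point values of `g`. -/
theorem volume_Ico_I01 (t : I01) {δ : ℝ} (hδ : 0 ≤ δ) (h : (t : ℝ) + δ ≤ 1) :
    (volume : Measure I01).real {s | t ≤ s ∧ (s : ℝ) < t + δ} = δ := by
  have h1 : (volume : Measure I01) = Measure.comap Subtype.val (volume : Measure ℝ) := rfl
  have h2 : Subtype.val '' {s : I01 | t ≤ s ∧ (s : ℝ) < t + δ} = Set.Ico (t : ℝ) (t + δ) := by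
    ext s
    constructor
    · rintro ⟨s, hs, rfl⟩
      exact hs
    · rintro ⟨hs1, hs2⟩
      exact ⟨⟨s, t.2.1.trans hs1, by linarith⟩, ⟨hs1, hs2⟩, rfl⟩
  rw [Measure.real, h1, comap_subtype_coe_apply measurableSet_Ico, h2]
  simp [hδ]

instance : NullSingletonClass (volume : Measure I01) := ⟨fun t => by
  have h : (volume : Measure I01) = Measure.comap Subtype.val (volume : Measure ℝ) := rfl
  rw [h, comap_subtype_coe_apply measurableSet_Ico, Set.image_singleton]
  simp⟩

theorem ae_pos_I01 : ∀ᵐ t : I01, 0 < (t : ℝ) := by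
  filter_upwards [Measure.ae_ne volume (⟨0, by simp⟩ : I01)] with t ht
  exact lt_of_le_of_ne t.2.1 fun h => ht (Subtype.ext h.symm)

theorem measurableSet_Ico_I01 (t : I01) (r : ℝ) :
    MeasurableSet {s : I01 | t ≤ s ∧ (s : ℝ) < r} :=
  measurableSet_Ici.inter (measurableSet_lt measurable_subtype_coe measurable_const)

/-- Point evaluation is a pointwise limit of L²-continuous functionals: monotonicity squeezes the
average of `g` over `[t, t + δ)` between `g t` and `g (t + δ)`, and right continuity closes the gap.
-/
theorem measurable_eval (t : I01) : Measurable fun g : QuantileFun => g t := by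
  have ht : 0 < 1 - (t : ℝ) := by linarith [t.2.2]
  -- The denominator `k + 2` keeps `t + δ k` strictly below `1` already for `k = 0`.
  let δ : ℕ → ℝ := fun k => (1 - t) / (k + 2)
  have hδ : ∀ k, 0 < δ k := fun k => by positivity
  have hδ1 : ∀ k, (t : ℝ) + δ k < 1 := fun k => by
    have : δ k < 1 - t := div_lt_self ht (by have : (0 : ℝ) ≤ k := k.cast_nonneg; linarith)
    linarith
  let A : ℕ → Set I01 := fun k => {s | t ≤ s ∧ (s : ℝ) < t + δ k}
  have hA : ∀ k, MeasurableSet (A k) := fun k => measurableSet_Ico_I01 _ _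
  have hAμ : ∀ k, (volume : Measure I01).real (A k) = δ k := fun k =>
    volume_Ico_I01 t (hδ k).le (hδ1 k).le
  let T : ℕ → I01 := fun k => ⟨t + δ k, by linarith [t.2.1, hδ k], hδ1 k⟩
  have hm : ∀ k, Measurable fun g : QuantileFun =>
      (δ k)⁻¹ * pairing ((A k).indicator fun _ => 1) g := fun k =>
    (measurable_pairing ((memLp_const 1).indicator (hA k))).const_mul _
  refine measurable_of_tendsto_metrizable hm ?_
  rw [tendsto_pi_nhds]
  intro g
  have hp : ∀ k, pairing ((A k).indicator fun _ => 1) g = ∫ s in A k, g s := fun k => by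
    rw [← integral_indicator (hA k)]
    refine integral_congr_ae (ae_of_all _ fun s => ?_)
    by_cases hs : s ∈ A k <;> simp [hs]
  have hgi : ∀ k, IntegrableOn (fun s => g s) (A k) := fun k =>
    (g.memLp.integrable (by norm_num)).integrableOn
  have hlow : ∀ k, g t ≤ (δ k)⁻¹ * pairing ((A k).indicator fun _ => 1) g := fun k => by
    rw [hp, ← div_eq_inv_mul, le_div_iff₀ (hδ k)]
    have := setIntegral_mono_on (f := fun _ => g t) (integrableOn_const (by simp)) (hgi k) (hA k)
      fun s hs => g.mono hs.1
    simpa [hAμ, mul_comm] using this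
  have hup : ∀ k, (δ k)⁻¹ * pairing ((A k).indicator fun _ => 1) g ≤ g (T k) := fun k => by
    rw [hp, ← div_eq_inv_mul, div_le_iff₀ (hδ k)]
    have := setIntegral_mono_on (g := fun _ => g (T k)) (hgi k) (integrableOn_const (by simp)) (hA k)
      fun s hs => g.mono (show s ≤ T k from hs.2.le)
    simpa [hAμ, mul_comm] using this
  have hT : Tendsto T atTop (𝓝[Set.Ici t] t) := by
    refine tendsto_nhdsWithin_iff.2 ⟨?_, Eventually.of_forall fun k => ?_⟩
    · rw [tendsto_subtype_rng]
      have : Tendsto δ atTop (𝓝 0) :=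
        tendsto_const_nhds.div_atTop (tendsto_natCast_atTop_atTop.atTop_add tendsto_const_nhds)
      simpa using this.const_add (t : ℝ)
    · change (t : ℝ) ≤ t + δ k
      linarith [hδ k]
  exact tendsto_of_tendsto_of_tendsto_of_le_of_le tendsto_const_nhds ((g.2.2.2 t).tendsto.comp hT)
    hlow hup

theorem measurable_evalAt {n : ℕ} (t : Fin n → I01) : Measurable (evalAt t) :=
  (MeasurableEquiv.toLp 2 (Fin n → ℝ)).measurable.comp
    (measurable_pi_lambda _ fun i => measurable_eval (t i))

theorem measurable_gridEval (n : ℕ) : Measurable (gridEval n) := measurable_evalAt _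

/-- The index `k` of the grid cell `[k/N, (k+1)/N)` containing `t`, where `N = n + 1`. -/
def cell (n : ℕ) (t : I01) : Fin (n + 1) :=
  ⟨⌊((n : ℝ) + 1) * t⌋₊, by
    rw [Nat.floor_lt (mul_nonneg (by positivity) t.2.1)]
    push_cast
    have := t.2.2
    nlinarith [(n.cast_nonneg : (0 : ℝ) ≤ n)]⟩

theorem measurable_cell (n : ℕ) : Measurable (cell n) := by
  refine measurable_to_countable' fun k => ?_
  have : cell n ⁻¹' {k} = (fun t : I01 => ⌊((n : ℝ) + 1) * t⌋₊) ⁻¹' {(k : ℕ)} := by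
    ext t; simp [cell, Fin.ext_iff]
  rw [this]
  exact (Nat.measurable_floor.comp (measurable_subtype_coe.const_mul _)) (measurableSet_singleton _)

theorem cell_le (n : ℕ) (t : I01) : ((cell n t : ℕ) : ℝ) ≤ ((n : ℝ) + 1) * t :=
  Nat.floor_le (mul_nonneg (by positivity) t.2.1)

theorem lt_cell_add_one (n : ℕ) (t : I01) : ((n : ℝ) + 1) * t < ((cell n t : ℕ) : ℝ) + 1 :=
  Nat.lt_floor_add_one _

theorem monotone_withEnds {n : ℕ} {x : Fin n → ℝ} (hx : Monotone x)
    (h01 : ∀ i, x i ∈ Set.Icc (0 : ℝ) 1) : Monotone (withEnds x) := by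
  intro a b hab
  induction b using ends_cases with
  | h0 => rw [Fin.le_zero_iff.1 hab]
  | hl => induction a using ends_cases <;> simp [(h01 _).2]
  | hm k =>
    induction a using ends_cases with
    | h0 => simp [(h01 _).1]
    | hl =>
      rw [← Fin.succ_last, Fin.succ_le_succ_iff] at hab
      exact absurd (Fin.castSucc_lt_last k) (not_lt.2 hab)
    | hm j =>
      rw [withEnds_mid, withEnds_mid]
      exact hx (by simpa using hab)

theorem strictMono_withEnds {n : ℕ} {x : Fin n → ℝ} (hx : StrictMono x)
    (h01 : ∀ i, x i ∈ Set.Ioo (0 : ℝ) 1) : StrictMono (withEnds x) := by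
  intro a b hab
  induction b using ends_cases with
  | h0 => exact absurd hab (Fin.not_lt_zero a)
  | hl =>
    induction a using ends_cases with
    | h0 => simp
    | hl => exact absurd hab (lt_irrefl _)
    | hm j => simp [(h01 _).2]
  | hm k =>
    induction a using ends_cases with
    | h0 => simp [(h01 _).1]
    | hl => exact absurd hab (not_lt.2 (Fin.le_last _))
    | hm j =>
      rw [withEnds_mid, withEnds_mid]
      exact hx (by simpa using hab)

theorem gridPoint_strictMono (n : ℕ) : StrictMono (gridPoint n) := by
  intro i j hij
  have : ((i : ℕ) : ℝ) < (j : ℕ) := by exact_mod_cast hij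
  change ((i : ℕ) + 1 : ℝ) / ((n : ℝ) + 1) < ((j : ℕ) + 1 : ℝ) / ((n : ℝ) + 1)
  gcongr

theorem gridPoint_pos {n : ℕ} (i : Fin n) : (0 : ℝ) < gridPoint n i := by
  change (0 : ℝ) < ((i : ℕ) + 1 : ℝ) / ((n : ℝ) + 1)
  positivity

theorem gridEval_mem (n : ℕ) (g : QuantileFun) : gridEval n g ∈ orderedSimplex n :=
  monotone_withEnds (x := fun i => g (gridPoint n i))
    (g.mono.comp (gridPoint_strictMono n).monotone) fun _ => g.2.1 _

/-- The values of `g` on the grid `{0, 1/N, …, 1}`, where `N = n + 1`, with the values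
`0` and `1` at the ends. -/
def gridVal (n : ℕ) (g : QuantileFun) (k : Fin (n + 2)) : ℝ :=
  withEnds (fun j => gridEval n g j) k

theorem gridVal_mem_Icc (n : ℕ) (g : QuantileFun) (k : Fin (n + 2)) :
    gridVal n g k ∈ Set.Icc (0 : ℝ) 1 :=
  withEnds_mem_Icc (gridEval_mem n g) k

/-- The index `0` must be excluded: there the grid value is `0` by convention, while `g 0` may be
positive. The last index is excluded by `s < 1`. -/
theorem gridVal_of_eq {n : ℕ} (g : QuantileFun) (k : Fin (n + 2)) (s : I01) (h0 : 0 < (k : ℕ))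
    (h : (s : ℝ) = (k : ℕ) / ((n : ℝ) + 1)) : gridVal n g k = g s := by
  induction k using ends_cases with
  | h0 => simp at h0
  | hl =>
    exfalso
    have h2 := s.2.2
    rw [h, Fin.val_last] at h2
    push_cast at h2
    rw [div_self (by positivity)] at h2
    exact lt_irrefl _ h2
  | hm j =>
    rw [gridVal, withEnds_mid]
    change g (gridPoint n j) = g s
    refine congrArg g.1 (Subtype.ext ?_)
    rw [h]
    simp [gridPoint]

theorem measurable_gridVal (n : ℕ) (k : Fin (n + 2)) : Measurable fun g => gridVal n g k :=
  (contDiff_withEnds (m := 0) k).continuous.measurable.comp (measurable_gridEval n)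

theorem measurable_gridVal_cell (n : ℕ) (e : Fin (n + 1) → Fin (n + 2)) :
    Measurable fun z : QuantileFun × I01 => gridVal n z.1 (e (cell n z.2)) := by
  have h : Measurable fun z : QuantileFun × Fin (n + 1) => gridVal n z.1 (e z.2) :=
    measurable_from_prod_countable_left fun k => measurable_gridVal n (e k)
  exact h.comp (measurable_fst.prodMk ((measurable_cell n).comp measurable_snd))

/-- Right step approximations converge. -/
theorem tendsto_gridVal_succ (g : QuantileFun) (t : I01) :
    Tendsto (fun n => gridVal n g (cell n t).succ) atTop (𝓝 (g t)) := by
  have hN : Tendsto (fun n : ℕ => 1 / ((n : ℝ) + 1)) atTop (𝓝 0) :=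
    tendsto_one_div_add_atTop_nhds_zero_nat
  have hev : ∀ᶠ n : ℕ in atTop, (t : ℝ) + 1 / ((n : ℝ) + 1) < 1 := by
    have h1 := hN.const_add (t : ℝ)
    rw [add_zero] at h1
    exact h1.eventually_lt_const t.2.2
  -- The next grid point to the right of `t`. The default value `t` is used only when that point is
  -- `1`, which does not happen for large `n`.
  let s : ℕ → I01 := fun n => if h : (((cell n t : ℕ) : ℝ) + 1) / ((n : ℝ) + 1) < 1 then
    ⟨(((cell n t : ℕ) : ℝ) + 1) / ((n : ℝ) + 1), by positivity, h⟩ else t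
  have hup : ∀ n : ℕ, (((cell n t : ℕ) : ℝ) + 1) / ((n : ℝ) + 1) ≤ t + 1 / ((n : ℝ) + 1) := by
    intro n
    rw [add_div, add_le_add_iff_right, div_le_iff₀ (by positivity), mul_comm]
    exact cell_le n t
  have hlow : ∀ n : ℕ, (t : ℝ) ≤ (((cell n t : ℕ) : ℝ) + 1) / ((n : ℝ) + 1) := by
    intro n
    rw [le_div_iff₀ (by positivity), mul_comm]
    exact (lt_cell_add_one n t).le
  have hs : ∀ᶠ n in atTop, gridVal n g (cell n t).succ = g (s n) := by
    filter_upwards [hev] with n hn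
    have h : (((cell n t : ℕ) : ℝ) + 1) / ((n : ℝ) + 1) < 1 := (hup n).trans_lt hn
    refine gridVal_of_eq g _ (s n) (by simp) ?_
    simp [s, h]
  have hst : Tendsto s atTop (𝓝[Set.Ici t] t) := by
    refine tendsto_nhdsWithin_iff.2 ⟨?_, Eventually.of_forall fun n => ?_⟩
    · rw [tendsto_subtype_rng]
      have h1 := hN.const_add (t : ℝ)
      rw [add_zero] at h1
      refine tendsto_of_tendsto_of_tendsto_of_le_of_le tendsto_const_nhds h1 (fun n => ?_) fun n => ?_
      · simp only [s]
        split_ifs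
        · exact hlow n
        · exact le_rfl
      · simp only [s]
        split_ifs
        · exact hup n
        · have : 0 < 1 / ((n : ℝ) + 1) := by positivity
          linarith
    · change (t : ℝ) ≤ s n
      simp only [s]
      split_ifs
      · exact hlow n
      · exact le_rfl
  exact ((g.2.2.2 t).tendsto.comp hst).congr' (hs.mono fun n hn => hn.symm)

/-- The right step approximations are jointly measurable, having finitely many cells, and they
converge at every point. -/
theorem measurable_eval_prod : Measurable fun z : QuantileFun × I01 => z.1 z.2 :=
  measurable_of_tendsto_metrizable (fun n => measurable_gridVal_cell n Fin.succ)
    (tendsto_pi_nhds.2 fun z => tendsto_gridVal_succ z.1 z.2)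

end Measurability

/-! ### The law of the Dirichlet process -/

section Law

variable {β : ℝ} {Q : Measure QuantileFun}

theorem IsDirichletLaw.map_gridEval (hQ : IsDirichletLaw β Q) (n : ℕ) :
    Q.map (gridEval n) = q β n := by
  rw [gridEval, hQ.2 n _ (strictMono_withEnds (fun _ _ hij => gridPoint_strictMono n hij)
    fun i => ⟨gridPoint_pos i, (gridPoint n i).2.2⟩), q]
  congr 1
  ext i
  rw [increment_gridPoint]
  push_cast
  ring

/-- The Dirichlet normalisation integral need not be computed: the measure is the image of a
probability measure. -/
theorem IsDirichletLaw.isProbabilityMeasure_q (hQ : IsDirichletLaw β Q) (n : ℕ) :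
    IsProbabilityMeasure (q β n) := by
  have := hQ.1
  rw [← hQ.map_gridEval n]
  exact Measure.isProbabilityMeasure_map (measurable_gridEval n).aemeasurable

theorem IsDirichletLaw.ae_lt (hQ : IsDirichletLaw β Q) {s t : I01} (hs : 0 < (s : ℝ)) (hst : s < t) :
    ∀ᵐ g ∂Q, 0 < g s ∧ g s < g t ∧ g t < 1 := by
  have h1 : StrictMono (withEnds fun i => ((![s, t] : Fin 2 → I01) i : ℝ)) := by
    refine strictMono_withEnds ?_ ?_
    · rw [Fin.strictMono_iff_lt_succ]
      intro i
      fin_cases i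
      exact hst
    · intro i
      fin_cases i
      · exact ⟨hs, s.2.2⟩
      · exact ⟨hs.trans hst, t.2.2⟩
  have h2 := hQ.2 2 ![s, t] h1
  have h3 := ae_mem_openSimplex fun i => β * increment (fun j => ((![s, t] : Fin 2 → I01) j : ℝ)) i
  rw [← h2] at h3
  filter_upwards [ae_of_ae_map (measurable_evalAt _).aemeasurable h3] with g hg
  have e0 := hg 0
  have e1 := hg 1
  have e2 := hg 2
  simp only [increment, sub_pos] at e0 e1 e2
  exact ⟨e0, e1, e2⟩

/-- Strictness at all rational pairs holds off one null set, and by monotonicity it passes to any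
two times since two rationals lie between them. Injectivity of `g` is what closability needs. -/
theorem IsDirichletLaw.ae_strictMono (hQ : IsDirichletLaw β Q) :
    ∀ᵐ g ∂Q, StrictMono g.1 ∧ ∀ t : I01, 0 < (t : ℝ) → 0 < g t ∧ g t < 1 := by
  let S : Set (ℚ × ℚ) := {p | 0 < p.1 ∧ p.1 < p.2 ∧ p.2 < 1}
  let T : ∀ p : S, I01 × I01 := fun p =>
    (⟨(p.1.1 : ℝ), by
      have h1 : (0 : ℝ) < p.1.1 := by exact_mod_cast p.2.1
      have h2 : (p.1.1 : ℝ) < 1 := by exact_mod_cast p.2.2.1.trans p.2.2.2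
      exact ⟨h1.le, h2⟩⟩,
     ⟨(p.1.2 : ℝ), by
      have h1 : (0 : ℝ) < p.1.2 := by exact_mod_cast p.2.1.trans p.2.2.1
      have h2 : (p.1.2 : ℝ) < 1 := by exact_mod_cast p.2.2.2
      exact ⟨h1.le, h2⟩⟩)
  have h : ∀ᵐ g ∂Q, ∀ p : S, 0 < g (T p).1 ∧ g (T p).1 < g (T p).2 ∧ g (T p).2 < 1 :=
    ae_all_iff.2 fun p => hQ.ae_lt (by
      change (0 : ℝ) < p.1.1
      exact_mod_cast p.2.1) (by
      change (p.1.1 : ℝ) < p.1.2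
      exact_mod_cast p.2.2.1)
  filter_upwards [h] with g hg
  have key : ∀ s t : ℝ, 0 ≤ s → s < t → t ≤ 1 → ∃ p : S, s < (T p).1 ∧ ((T p).2 : ℝ) < t := by
    intro s t hs hst ht
    obtain ⟨p, hp1, hp2⟩ := exists_rat_btwn hst
    obtain ⟨r, hr1, hr2⟩ := exists_rat_btwn hp2
    refine ⟨⟨(p, r), ?_, ?_, ?_⟩, hp1, hr2⟩
    · exact_mod_cast hs.trans_lt hp1
    · exact_mod_cast hr1
    · exact_mod_cast hr2.trans_le ht
  refine ⟨fun s t hst => ?_, fun t ht => ⟨?_, ?_⟩⟩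
  · obtain ⟨p, hp1, hp2⟩ := key s t s.2.1 hst t.2.2.le
    have h1 : g s ≤ g (T p).1 := g.mono (show s ≤ (T p).1 from hp1.le)
    have h2 : g (T p).2 ≤ g t := g.mono (show (T p).2 ≤ t from hp2.le)
    linarith [(hg p).2.1]
  · obtain ⟨p, hp1, hp2⟩ := key 0 t le_rfl ht t.2.2.le
    have h2 : g (T p).2 ≤ g t := g.mono (show (T p).2 ≤ t from hp2.le)
    linarith [(hg p).2.1, (hg p).1]
  · obtain ⟨p, hp1, hp2⟩ := key t 1 t.2.1 t.2.2 le_rfl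
    have h1 : g t ≤ g (T p).1 := g.mono (show t ≤ (T p).1 from hp1.le)
    linarith [(hg p).2.1, (hg p).2.2]

end Law

/-! ### Affine functions of the grid values -/

section Affine

variable {n : ℕ}

/-- The function `x ↦ ∑ₖ cₖ xᵏ` of the coordinates including the end points `x⁰ = 0`, `x^N = 1`. -/
def affineFun (c : Fin (n + 2) → ℝ) (x : EuclideanSpace ℝ (Fin n)) : ℝ :=
  ∑ k, c k * withEnds (fun j => x j) k

/-- The linear part of `affineFun c`. -/
def affineCLM (c : Fin (n + 2) → ℝ) : EuclideanSpace ℝ (Fin n) →L[ℝ] ℝ :=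
  ∑ k, c k • endCLM n k

theorem affineCLM_apply (c : Fin (n + 2) → ℝ) (v : EuclideanSpace ℝ (Fin n)) :
    affineCLM c v = ∑ k, c k * zeroEnds (fun j => v j) k := by
  simp [affineCLM, endCLM_apply]

theorem hasFDerivAt_affineFun (c : Fin (n + 2) → ℝ) (x : EuclideanSpace ℝ (Fin n)) :
    HasFDerivAt (affineFun c) (affineCLM c) x :=
  HasFDerivAt.fun_sum fun k _ => (hasFDerivAt_withEnds k x).const_mul (c k)

theorem contDiff_affineFun {m : WithTop ℕ∞} (c : Fin (n + 2) → ℝ) :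
    ContDiff ℝ m (affineFun c) :=
  ContDiff.sum fun k _ => contDiff_const.mul (contDiff_withEnds k)

/-- The coefficients of the affine function `∫ f(t) x^{e(cell of t)} dt`. -/
def stepCoef (e : Fin (n + 1) → Fin (n + 2)) (f : I01 → ℝ) (k : Fin (n + 2)) : ℝ :=
  ∫ t, f t * (if k = e (cell n t) then 1 else 0)

/-- Turns the pairing of `f` with a step function of the grid values into a finite linear
combination of these values, to which calculus on the simplex applies. -/
theorem sum_stepCoef_mul (e : Fin (n + 1) → Fin (n + 2)) {f : I01 → ℝ} (hf : Integrable f)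
    (y : Fin (n + 2) → ℝ) : ∑ k, stepCoef e f k * y k = ∫ t, f t * y (e (cell n t)) := by
  have hm : ∀ k, Measurable fun t => if k = e (cell n t) then (1 : ℝ) else 0 := fun k =>
    (measurable_of_finite fun i : Fin (n + 1) => if k = e i then (1 : ℝ) else 0).comp
      (measurable_cell n)
  have hi : ∀ k, Integrable fun t => f t * (if k = e (cell n t) then 1 else 0) := fun k =>
    hf.mul_bdd (c := 1) (hm k).aestronglyMeasurable (ae_of_all _ fun t => by split_ifs <;> simp)
  simp only [stepCoef, ← integral_mul_const]
  rw [← integral_finsetSum _ fun k _ => (hi k).mul_const _]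
  refine integral_congr_ae (ae_of_all _ fun t => ?_)
  simp

end Affine

/-! ### Convergence along bounded arguments -/

section Convergence

/-- The arguments stay in a compact ball, where `T` is bounded, so dominated convergence applies. It
serves both for the limit of the grid inequalities and for the limit of the energies. -/
theorem tendsto_integral_comp_of_bounded {α X : Type*} [MeasurableSpace α] [NormedAddCommGroup X]
    [ProperSpace X] [MeasurableSpace X] [OpensMeasurableSpace X] {μ : Measure α} [IsFiniteMeasure μ]
    {a : ℕ → α → X} {a' : α → X} {M : ℝ} (ha : ∀ n, Measurable (a n)) (hM : ∀ n x, ‖a n x‖ ≤ M)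
    (hlim : ∀ᵐ x ∂μ, Tendsto (fun n => a n x) atTop (𝓝 (a' x))) {T : X → ℝ} (hT : Continuous T) :
    Tendsto (fun n => ∫ x, T (a n x) ∂μ) atTop (𝓝 (∫ x, T (a' x) ∂μ)) := by
  obtain ⟨K, hK⟩ := (isCompact_closedBall (0 : X) M).exists_bound_of_continuousOn hT.continuousOn
  refine tendsto_integral_of_dominated_convergence (fun _ => K)
    (fun n => (hT.measurable.comp (ha n)).aestronglyMeasurable) (integrable_const K)
    (fun n => ae_of_all _ fun x => hK _ (mem_closedBall_zero_iff.2 (hM n x))) ?_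
  filter_upwards [hlim] with x hx using (hT.tendsto _).comp hx

theorem measurable_integral_mul_comp {f : I01 → ℝ} (hf : Integrable f)
    {G : QuantileFun × I01 → ℝ} (hG : Measurable G) :
    Measurable fun g => ∫ t, f t * G (g, t) := by
  obtain ⟨f', hf', hff'⟩ := hf.1
  have : (fun g => ∫ t, f t * G (g, t)) = fun g => ∫ t, f' t * G (g, t) := by
    ext g
    refine integral_congr_ae ?_
    filter_upwards [hff'] with t ht
    rw [ht]
  rw [this]
  have h : StronglyMeasurable fun z : QuantileFun × I01 => f' z.2 * G z :=
    (hf'.comp_measurable measurable_snd).mul hG.stronglyMeasurable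
  exact h.integral_prod_right'.measurable

theorem abs_integral_mul_le {f h : I01 → ℝ} (hf : Integrable f) {M : ℝ} (hM : ∀ t, |h t| ≤ M) :
    |∫ t, f t * h t| ≤ (∫ t, |f t|) * M := by
  rw [← integral_mul_const, ← Real.norm_eq_abs]
  refine norm_integral_le_of_norm_le (hf.abs.mul_const M) (ae_of_all _ fun t => ?_)
  rw [norm_mul]
  exact mul_le_mul_of_nonneg_left (hM t) (abs_nonneg _)

theorem tendsto_integral_mul_comp {f : I01 → ℝ} (hf : Integrable f) {φ : ℝ → ℝ}
    (hφ : Continuous φ) {a : ℕ → I01 → ℝ} {b : I01 → ℝ} (ha : ∀ n, Measurable (a n))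
    (h01 : ∀ n t, a n t ∈ Set.Icc (0 : ℝ) 1)
    (hlim : ∀ᵐ t : I01, Tendsto (fun n => a n t) atTop (𝓝 (b t))) :
    Tendsto (fun n => ∫ t, f t * φ (a n t)) atTop (𝓝 (∫ t, f t * φ (b t))) := by
  obtain ⟨K, hK⟩ := (isCompact_Icc (a := (0 : ℝ)) (b := 1)).exists_bound_of_continuousOn
    hφ.continuousOn
  refine tendsto_integral_of_dominated_convergence (fun t => |f t| * K)
    (fun n => hf.1.mul (hφ.measurable.comp (ha n)).aestronglyMeasurable) (hf.abs.mul_const K)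
    (fun n => ae_of_all _ fun t => ?_) ?_
  · rw [norm_mul]
    exact mul_le_mul_of_nonneg_left (hK _ (h01 n t)) (norm_nonneg _)
  · filter_upwards [hlim] with t ht using ((hφ.tendsto _).comp ht).const_mul _

theorem exists_bound_deriv {φ : ℝ → ℝ} (hφ : ContDiff ℝ 2 φ) : ∃ B : ℝ,
    (∀ y ∈ Set.Icc (0 : ℝ) 1, |φ y| ≤ B) ∧
    (∀ y ∈ Set.Icc (0 : ℝ) 1, |deriv φ y| ≤ B) ∧
    ∀ y ∈ Set.Icc (0 : ℝ) 1, ∀ z ∈ Set.Icc (0 : ℝ) 1, |deriv φ y - deriv φ z| ≤ B * |y - z| := by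
  have h1 : ContDiff ℝ 1 (deriv φ) :=
    ((contDiff_succ_iff_deriv (n := 1)).1 (by simpa [one_add_one_eq_two] using hφ)).2.2
  have h2 : Continuous (deriv (deriv φ)) := h1.continuous_deriv (by simp)
  obtain ⟨B0, hB0⟩ := (isCompact_Icc (a := (0 : ℝ)) (b := 1)).exists_bound_of_continuousOn
    hφ.continuous.continuousOn
  obtain ⟨B1, hB1⟩ := (isCompact_Icc (a := (0 : ℝ)) (b := 1)).exists_bound_of_continuousOn
    h1.continuous.continuousOn
  obtain ⟨B2, hB2⟩ := (isCompact_Icc (a := (0 : ℝ)) (b := 1)).exists_bound_of_continuousOn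
    h2.continuousOn
  refine ⟨max B0 (max B1 B2), fun y hy => (hB0 y hy).trans (le_max_left _ _), fun y hy =>
    (hB1 y hy).trans ((le_max_left _ _).trans (le_max_right _ _)), fun y hy z hz => ?_⟩
  have := (convex_Icc (0 : ℝ) 1).norm_image_sub_le_of_norm_deriv_le
    (fun x _ => h1.differentiable (by simp) x) hB2 hz hy
  refine this.trans ?_
  exact mul_le_mul_of_nonneg_right ((le_max_right _ _).trans (le_max_right _ _)) (norm_nonneg _)

end Convergence

/-! ### Integration by parts for the Dirichlet process -/

section Bound

variable {β : ℝ} {Q : Measure QuantileFun}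

theorem hasFDerivAt_comp_affineFun {n m : ℕ} {U : (Fin m → ℝ) → ℝ} (hU : ContDiff ℝ 1 U)
    (c : Fin m → Fin (n + 2) → ℝ) (x : EuclideanSpace ℝ (Fin n)) :
    HasFDerivAt (fun x => U fun i => affineFun (c i) x)
      ((fderiv ℝ U fun i => affineFun (c i) x).comp
        (ContinuousLinearMap.pi fun i => affineCLM (c i))) x :=
  HasFDerivAt.comp x (hU.differentiable (by simp) _).hasFDerivAt
    (hasFDerivAt_pi.2 fun i => hasFDerivAt_affineFun (c i) x)

theorem zeroEnds_comp {n : ℕ} {φ : ℝ → ℝ} (h0 : φ 0 = 0) (h1 : φ 1 = 0) (x : Fin n → ℝ)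
    (k : Fin (n + 2)) : zeroEnds (fun j => φ (x j)) k = φ (withEnds x k) := by
  induction k using ends_cases <;> simp [h0, h1]

/-- The grid version of the integration by parts bound. -/
theorem IsDirichletLaw.grid_bound (hβ : 0 < β) (hQ : IsDirichletLaw β Q) {φ : ℝ → ℝ}
    (hφ : ContDiff ℝ 2 φ) (h0 : φ 0 = 0) (h1 : φ 1 = 0) {B : ℝ}
    (hB : ∀ y ∈ Set.Icc (0 : ℝ) 1, |deriv φ y| ≤ B)
    (hB' : ∀ y ∈ Set.Icc (0 : ℝ) 1, ∀ z ∈ Set.Icc (0 : ℝ) 1, |deriv φ y - deriv φ z| ≤ B * |y - z|)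
    (n : ℕ) {m l : ℕ} {U : (Fin m → ℝ) → ℝ} (hU : ContDiff ℝ 1 U) {f : Fin m → I01 → ℝ}
    (hf : ∀ i, Integrable (f i)) {V : (Fin l → ℝ) → ℝ} (hV : ContDiff ℝ 1 V) {h : Fin l → I01 → ℝ}
    (hh : ∀ i, Integrable (h i)) :
    |∫ g, fderiv ℝ U (fun i => ∫ t, f i t * gridVal n g (cell n t).succ)
        (fun i => ∫ t, f i t * φ (gridVal n g (cell n t).succ)) *
      V (fun i => ∫ t, h i t * gridVal n g (cell n t).succ) ∂Q| ≤
    (β + 2) * B * (∫ g, |U (fun i => ∫ t, f i t * gridVal n g (cell n t).succ) *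
      V (fun i => ∫ t, h i t * gridVal n g (cell n t).succ)| ∂Q) +
    ∫ g, |U (fun i => ∫ t, f i t * gridVal n g (cell n t).succ) *
      fderiv ℝ V (fun i => ∫ t, h i t * gridVal n g (cell n t).succ)
        (fun i => ∫ t, h i t * φ (gridVal n g (cell n t).succ))| ∂Q := by
  have hqp := hQ.isProbabilityMeasure_q n
  set μ := q β n with hμ
  let a : Fin (n + 1) → ℝ := fun _ => β / ((n + 1 : ℕ) : ℝ)
  have hfin : IsFiniteMeasure (orderedDirichlet fun _ : Fin (n + 1) => β / ((n + 1 : ℕ) : ℝ)) :=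
    (inferInstance : IsFiniteMeasure μ)
  have hfin' : IsFiniteMeasure (orderedDirichlet a) := hfin
  let c : Fin m → Fin (n + 2) → ℝ := fun i => stepCoef Fin.succ (f i)
  let d : Fin l → Fin (n + 2) → ℝ := fun i => stepCoef Fin.succ (h i)
  let Φ : EuclideanSpace ℝ (Fin n) → EuclideanSpace ℝ (Fin n) := fun x =>
    WithLp.toLp 2 fun j => φ (x j)
  let u : EuclideanSpace ℝ (Fin n) → ℝ := fun x => U fun i => affineFun (c i) x
  let v : EuclideanSpace ℝ (Fin n) → ℝ := fun x => V fun i => affineFun (d i) x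
  have hu : ContDiff ℝ 1 u := hU.comp (contDiff_pi.2 fun i => contDiff_affineFun (c i))
  have hv : ContDiff ℝ 1 v := hV.comp (contDiff_pi.2 fun i => contDiff_affineFun (d i))
  have hΦ : Continuous Φ := (PiLp.continuous_toLp 2 _).comp
    (continuous_pi fun j => hφ.continuous.comp (EuclideanSpace.proj (𝕜 := ℝ) j).continuous)
  have hdu : Continuous fun x => fderiv ℝ u x (Φ x) :=
    (hu.continuous_fderiv (by simp)).clm_apply hΦ
  have hdv : Continuous fun x => fderiv ℝ v x (Φ x) :=
    (hv.continuous_fderiv (by simp)).clm_apply hΦ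
  have hint : ∀ F : EuclideanSpace ℝ (Fin n) → ℝ, Continuous F → Integrable F μ := fun F hF =>
    memLp_one_iff_integrable.1 (memLp_of_continuous a hF)
  -- Applied to the product `u v`; the product rule then isolates the derivative of `u`. With `c = β
  -- / (n + 1)` the constant `(n + 1) c + 2` becomes `β + 2`, independent of the grid.
  have key := abs_integral_fderiv_comp_le (n := n) (c := β / ((n + 1 : ℕ) : ℝ)) (by positivity)
    hφ h0 h1 hB hB' (hu.mul hv)
  have hβn : ((n : ℝ) + 1) * (β / ((n + 1 : ℕ) : ℝ)) = β := by push_cast; field_simp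
  rw [hβn] at key
  change |∫ x, fderiv ℝ (fun x => u x * v x) x (Φ x) ∂μ| ≤ (β + 2) * B * ∫ x, |u x * v x| ∂μ at key
  have hprod : ∀ x, fderiv ℝ (fun x => u x * v x) x (Φ x) =
      fderiv ℝ u x (Φ x) * v x + u x * fderiv ℝ v x (Φ x) := fun x => by
    have h3 : HasFDerivAt (fun x => u x * v x) _ x :=
      (hu.differentiable (by simp) x).hasFDerivAt.mul (hv.differentiable (by simp) x).hasFDerivAt
    rw [h3.fderiv]
    simp only [add_apply, smul_apply, smul_eq_mul]
    ring
  simp only [hprod] at key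
  have i1 : Integrable (fun x => fderiv ℝ u x (Φ x) * v x) μ := hint _ (hdu.mul hv.continuous)
  have i2 : Integrable (fun x => u x * fderiv ℝ v x (Φ x)) μ := hint _ (hu.continuous.mul hdv)
  rw [integral_add i1 i2] at key
  have key2 : |∫ x, fderiv ℝ u x (Φ x) * v x ∂μ| ≤ (β + 2) * B * (∫ x, |u x * v x| ∂μ) +
      ∫ x, |u x * fderiv ℝ v x (Φ x)| ∂μ := by
    have h4 : |∫ x, u x * fderiv ℝ v x (Φ x) ∂μ| ≤ ∫ x, |u x * fderiv ℝ v x (Φ x)| ∂μ :=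
      abs_integral_le_integral_abs
    have h5 := abs_sub (∫ x, fderiv ℝ u x (Φ x) * v x ∂μ + ∫ x, u x * fderiv ℝ v x (Φ x) ∂μ)
      (∫ x, u x * fderiv ℝ v x (Φ x) ∂μ)
    rw [add_sub_cancel_right] at h5
    linarith
  have hmap : ∀ F : EuclideanSpace ℝ (Fin n) → ℝ, Continuous F →
      ∫ x, F x ∂μ = ∫ g, F (gridEval n g) ∂Q := fun F hF => by
    rw [hμ, ← hQ.map_gridEval n]
    exact integral_map (measurable_gridEval n).aemeasurable hF.aestronglyMeasurable
  rw [hmap (fun x => fderiv ℝ u x (Φ x) * v x) (hdu.mul hv.continuous),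
    hmap (fun x => |u x * v x|) (hu.continuous.mul hv.continuous).abs,
    hmap (fun x => |u x * fderiv ℝ v x (Φ x)|) (hu.continuous.mul hdv).abs] at key2
  have e1 : ∀ {r : ℕ} (f : Fin r → I01 → ℝ) (_ : ∀ i, Integrable (f i)) (g : QuantileFun),
      (fun i => affineFun (stepCoef Fin.succ (f i)) (gridEval n g)) =
        fun i => ∫ t, f i t * gridVal n g (cell n t).succ := fun f hf g => by
    ext i
    exact sum_stepCoef_mul Fin.succ (hf i) _
  -- The linear part of an affine function sees `0` at both ends; since `φ(0) = φ(1) = 0`, this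
  -- agrees with `φ` of the full grid vector, and the directional derivative becomes a pairing with
  -- `φ` of the step function.
  have e2 : ∀ {r : ℕ} {W : (Fin r → ℝ) → ℝ} (_ : ContDiff ℝ 1 W) (f : Fin r → I01 → ℝ)
      (_ : ∀ i, Integrable (f i)) (g : QuantileFun),
      fderiv ℝ (fun x => W fun i => affineFun (stepCoef Fin.succ (f i)) x) (gridEval n g)
        (Φ (gridEval n g)) =
      fderiv ℝ W (fun i => ∫ t, f i t * gridVal n g (cell n t).succ)
        (fun i => ∫ t, f i t * φ (gridVal n g (cell n t).succ)) := fun hW f hf g => by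
    rw [(hasFDerivAt_comp_affineFun hW _ _).fderiv, e1 f hf]
    rw [ContinuousLinearMap.comp_apply]
    congr 1
    ext i
    rw [ContinuousLinearMap.pi_apply, affineCLM_apply]
    simp only [Φ, zeroEnds_comp h0 h1]
    exact sum_stepCoef_mul Fin.succ (hf i) fun k => φ (gridVal n g k)
  simp only [u, v, c, d] at key2
  simp only [e2 hU f hf, e2 hV h hh, e1 f hf, e1 h hh] at key2
  exact key2

/-- Integration by parts bound for the Dirichlet process along the vector field `g ↦ φ ∘ g`. -/
theorem IsDirichletLaw.bound (hβ : 0 < β) (hQ : IsDirichletLaw β Q) {φ : ℝ → ℝ}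
    (hφ : ContDiff ℝ 2 φ) (h0 : φ 0 = 0) (h1 : φ 1 = 0) {B : ℝ}
    (hB0 : ∀ y ∈ Set.Icc (0 : ℝ) 1, |φ y| ≤ B)
    (hB : ∀ y ∈ Set.Icc (0 : ℝ) 1, |deriv φ y| ≤ B)
    (hB' : ∀ y ∈ Set.Icc (0 : ℝ) 1, ∀ z ∈ Set.Icc (0 : ℝ) 1, |deriv φ y - deriv φ z| ≤ B * |y - z|)
    {m l : ℕ} {U : (Fin m → ℝ) → ℝ} (hU : ContDiff ℝ 1 U) {f : Fin m → I01 → ℝ}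
    (hf : ∀ i, Integrable (f i)) {V : (Fin l → ℝ) → ℝ} (hV : ContDiff ℝ 1 V) {h : Fin l → I01 → ℝ}
    (hh : ∀ i, Integrable (h i)) :
    |∫ g, fderiv ℝ U (fun i => pairing (f i) g) (fun i => ∫ t, f i t * φ (g t)) *
      V (fun i => pairing (h i) g) ∂Q| ≤
    (β + 2) * B * (∫ g, |U (fun i => pairing (f i) g) * V (fun i => pairing (h i) g)| ∂Q) +
    ∫ g, |U (fun i => pairing (f i) g) *
      fderiv ℝ V (fun i => pairing (h i) g) (fun i => ∫ t, h i t * φ (g t))| ∂Q := by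
  have := hQ.1
  let A : ∀ {r : ℕ} (_ : Fin r → I01 → ℝ) (_ : ℝ → ℝ), ℕ → QuantileFun → Fin r → ℝ :=
    fun f φ n g i => ∫ t, f i t * φ (gridVal n g (cell n t).succ)
  let A' : ∀ {r : ℕ} (_ : Fin r → I01 → ℝ) (_ : ℝ → ℝ), QuantileFun → Fin r → ℝ :=
    fun f φ g i => ∫ t, f i t * φ (g t)
  have hAm : ∀ {r : ℕ} (f : Fin r → I01 → ℝ) (_ : ∀ i, Integrable (f i)) (φ : ℝ → ℝ)
      (_ : Continuous φ) (n : ℕ), Measurable (A f φ n) := fun f hf φ hφ n =>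
    measurable_pi_lambda _ fun i => measurable_integral_mul_comp (hf i)
      (hφ.measurable.comp (measurable_gridVal_cell n Fin.succ))
  have hAb : ∀ {r : ℕ} (f : Fin r → I01 → ℝ) (_ : ∀ i, Integrable (f i)) (φ : ℝ → ℝ) (B : ℝ)
      (_ : ∀ y ∈ Set.Icc (0 : ℝ) 1, |φ y| ≤ B), ∃ M, ∀ n g, ‖A f φ n g‖ ≤ M := fun f hf φ B hB => by
    have hB0 : 0 ≤ B := (abs_nonneg _).trans (hB 0 (by simp))
    refine ⟨∑ i, (∫ t, |f i t|) * B, fun n g => ?_⟩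
    have hnn : ∀ i, 0 ≤ (∫ t, |f i t|) * B := fun i =>
      mul_nonneg (integral_nonneg fun _ => abs_nonneg _) hB0
    refine (pi_norm_le_iff_of_nonneg (Finset.sum_nonneg fun i _ => hnn i)).2 fun i => ?_
    exact (abs_integral_mul_le (hf i) fun t => hB _ (gridVal_mem_Icc _ _ _)).trans
      (Finset.single_le_sum (f := fun i => (∫ t, |f i t|) * B) (fun i _ => hnn i)
        (Finset.mem_univ i))
  have hAl : ∀ {r : ℕ} (f : Fin r → I01 → ℝ) (_ : ∀ i, Integrable (f i)) (φ : ℝ → ℝ)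
      (_ : Continuous φ) (g : QuantileFun), Tendsto (fun n => A f φ n g) atTop (𝓝 (A' f φ g)) :=
    fun f hf φ hφ g => tendsto_pi_nhds.2 fun i => tendsto_integral_mul_comp (hf i) hφ
      (fun n => (measurable_of_finite fun k : Fin (n + 1) => gridVal n g k.succ).comp
        (measurable_cell n))
      (fun n t => gridVal_mem_Icc _ _ _) (ae_of_all _ fun t => tendsto_gridVal_succ g t)
  have hid : ∀ y ∈ Set.Icc (0 : ℝ) 1, |id y| ≤ 1 := fun y hy => by
    rw [id, abs_of_nonneg hy.1]; exact hy.2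
  obtain ⟨M1, hM1⟩ := hAb f hf id 1 hid
  obtain ⟨M2, hM2⟩ := hAb f hf φ B hB0
  obtain ⟨M3, hM3⟩ := hAb h hh id 1 hid
  obtain ⟨M4, hM4⟩ := hAb h hh φ B hB0
  let X := ((Fin m → ℝ) × (Fin m → ℝ)) × ((Fin l → ℝ) × (Fin l → ℝ))
  -- All three integrals in the grid inequality have continuous integrands in the same four bounded
  -- vectors, so a single limit statement covers them.
  have hlim : ∀ T : X → ℝ, Continuous T → Tendsto
      (fun n => ∫ g, T ((A f id n g, A f φ n g), (A h id n g, A h φ n g)) ∂Q) atTop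
      (𝓝 (∫ g, T ((A' f id g, A' f φ g), (A' h id g, A' h φ g)) ∂Q)) := fun T hT =>
    tendsto_integral_comp_of_bounded (M := max (max M1 M2) (max M3 M4))
      (fun n => ((hAm f hf id continuous_id n).prodMk (hAm f hf φ hφ.continuous n)).prodMk
        ((hAm h hh id continuous_id n).prodMk (hAm h hh φ hφ.continuous n)))
      (fun n g => by
        simp only [Prod.norm_def]
        exact max_le_max (max_le_max (hM1 n g) (hM2 n g)) (max_le_max (hM3 n g) (hM4 n g)))
      (ae_of_all _ fun g => ((hAl f hf id continuous_id g).prodMk_nhds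
        (hAl f hf φ hφ.continuous g)).prodMk_nhds
        ((hAl h hh id continuous_id g).prodMk_nhds (hAl h hh φ hφ.continuous g))) hT
  have cU : Continuous fun z : X => U z.1.1 := hU.continuous.comp (by fun_prop)
  have cV : Continuous fun z : X => V z.2.1 := hV.continuous.comp (by fun_prop)
  have cdU : Continuous fun z : X => fderiv ℝ U z.1.1 z.1.2 :=
    ((hU.continuous_fderiv (by simp)).comp (by fun_prop)).clm_apply (by fun_prop)
  have cdV : Continuous fun z : X => fderiv ℝ V z.2.1 z.2.2 :=
    ((hV.continuous_fderiv (by simp)).comp (by fun_prop)).clm_apply (by fun_prop)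
  have l1 := (hlim _ (cdU.mul cV)).abs
  have l2 := (hlim _ (cU.mul cV).abs).const_mul ((β + 2) * B)
  have l3 := hlim _ (cU.mul cdV).abs
  exact le_of_tendsto_of_tendsto' l1 (l2.add l3) fun n =>
    hQ.grid_bound hβ hφ h0 h1 hB hB' n hU hf hV hh

end Bound

/-! ### Cylinder functions -/

section Cylinder

/-- The gradient of the cylinder function `g ↦ U(⟨f₁,g⟩, …, ⟨f_m,g⟩)`. -/
def cylGrad {m : ℕ} (U : (Fin m → ℝ) → ℝ) (f : Fin m → I01 → ℝ) : QuantileFun × I01 → ℝ :=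
  fun z => ∑ i, fderiv ℝ U (fun j => pairing (f j) z.1) (Pi.single i 1) * f i z.2

theorem abs_pairing_le {f : I01 → ℝ} (hf : Integrable f) (g : QuantileFun) :
    |pairing f g| ≤ ∫ t, |f t| := by
  have := abs_integral_mul_le hf (h := fun t => g t) (M := 1) g.abs_le_one
  rwa [mul_one] at this

theorem exists_norm_pairing_le {m : ℕ} {f : Fin m → I01 → ℝ} (hf : ∀ i, Integrable (f i)) :
    ∃ M : ℝ, 0 ≤ M ∧ ∀ g, ‖fun i => pairing (f i) g‖ ≤ M := by
  have hnn : ∀ i, 0 ≤ ∫ t, |f i t| := fun i => integral_nonneg fun _ => abs_nonneg _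
  refine ⟨∑ i, ∫ t, |f i t|, Finset.sum_nonneg fun i _ => hnn i, fun g => ?_⟩
  refine (pi_norm_le_iff_of_nonneg (Finset.sum_nonneg fun i _ => hnn i)).2 fun i => ?_
  exact (abs_pairing_le (hf i) g).trans
    (Finset.single_le_sum (f := fun i => ∫ t, |f i t|) (fun i _ => hnn i) (Finset.mem_univ i))

theorem continuous_pairings {m : ℕ} {f : Fin m → I01 → ℝ} (hf : ∀ i, MemLp (f i) 2 volume) :
    Continuous fun (g : QuantileFun) i => pairing (f i) g :=
  continuous_pi fun i => continuous_pairing (hf i)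

theorem integrable_of_memLp_two {f : I01 → ℝ} (hf : MemLp f 2 volume) : Integrable f :=
  hf.integrable (by norm_num)

/-- As `0 ≤ g ≤ 1`, the pairings range in a bounded set. A bump function equal to `1` near that set
gives compact support without affecting the values or the gradient, so the support condition can be
ignored from here on. -/
theorem mem_cylinderGradients {m : ℕ} {U : (Fin m → ℝ) → ℝ} (hU : ContDiff ℝ 1 U)
    {f : Fin m → I01 → ℝ} (hf : ∀ i, MemLp (f i) 2 volume) :
    ((fun g => U fun i => pairing (f i) g), cylGrad U f) ∈ cylinderGradients := by
  obtain ⟨M, hM0, hM⟩ := exists_norm_pairing_le fun i => integrable_of_memLp_two (hf i)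
  let χ : ContDiffBump (0 : Fin m → ℝ) := ⟨M + 1, M + 2, by linarith, by linarith⟩
  have hχ : ∀ g : QuantileFun, (fun x => χ x * U x) =ᶠ[𝓝 fun i => pairing (f i) g] U := fun g => by
    have h : (fun i => pairing (f i) g) ∈ Metric.ball (0 : Fin m → ℝ) χ.rIn := by
      rw [mem_ball_zero_iff]
      exact (hM g).trans_lt (by simp [χ])
    filter_upwards [χ.eventuallyEq_one_of_mem_ball h] with x hx
    rw [hx, Pi.one_apply, one_mul]
  refine ⟨m, fun x => χ x * U x, f, χ.contDiff.mul hU, χ.hasCompactSupport.mul_right, hf, ?_, ?_⟩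
  · ext g
    exact (hχ g).eq_of_nhds.symm
  · ext z
    simp only [cylGrad, (hχ z.1).fderiv_eq]

theorem exists_of_mem_cylinderGradients {p : (QuantileFun → ℝ) × (QuantileFun × I01 → ℝ)}
    (hp : p ∈ cylinderGradients) : ∃ (m : ℕ) (U : (Fin m → ℝ) → ℝ) (f : Fin m → I01 → ℝ),
      ContDiff ℝ 1 U ∧ (∀ i, MemLp (f i) 2 volume) ∧
        p = ((fun g => U fun i => pairing (f i) g), cylGrad U f) := by
  obtain ⟨m, U, f, hU, -, hf, h1, h2⟩ := hp
  exact ⟨m, U, f, hU, hf, Prod.ext h1 h2⟩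

theorem cylinderGradients_sub : ∀ p ∈ cylinderGradients, ∀ r ∈ cylinderGradients,
    p - r ∈ cylinderGradients := by
  intro p hp r hr
  obtain ⟨m, U, f, hU, hf, rfl⟩ := exists_of_mem_cylinderGradients hp
  obtain ⟨l, V, h, hV, hh, rfl⟩ := exists_of_mem_cylinderGradients hr
  -- The two lists of test functions are concatenated; `L` and `R` recover the two blocks of
  -- pairings.
  let L : (Fin (m + l) → ℝ) →L[ℝ] (Fin m → ℝ) :=
    ContinuousLinearMap.pi fun i => ContinuousLinearMap.proj (Fin.castAdd l i)
  let R : (Fin (m + l) → ℝ) →L[ℝ] (Fin l → ℝ) :=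
    ContinuousLinearMap.pi fun i => ContinuousLinearMap.proj (Fin.natAdd m i)
  let W : (Fin (m + l) → ℝ) → ℝ := fun x => U (L x) - V (R x)
  have hW : ContDiff ℝ 1 W := (hU.comp L.contDiff).sub (hV.comp R.contDiff)
  have hL : ∀ g, L (fun i => pairing ((Fin.append f h : Fin (m + l) → I01 → ℝ) i) g) =
      fun i => pairing (f i) g := fun g => by
    ext i; simp [L]
  have hR : ∀ g, R (fun i => pairing ((Fin.append f h : Fin (m + l) → I01 → ℝ) i) g) =
      fun i => pairing (h i) g := fun g => by
    ext i; simp [R]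
  convert! mem_cylinderGradients hW (f := Fin.append f h) ?_ using 1
  · ext z
    · simp only [Prod.fst_sub, Pi.sub_apply, W, hL, hR]
    · have hd : ∀ x v, fderiv ℝ W x v = fderiv ℝ U (L x) (L v) - fderiv ℝ V (R x) (R v) := by
        intro x v
        have : HasFDerivAt W _ x := (HasFDerivAt.comp x (hU.differentiable (by simp) _).hasFDerivAt
          L.hasFDerivAt).sub (HasFDerivAt.comp x (hV.differentiable (by simp) _).hasFDerivAt
          R.hasFDerivAt)
        rw [this.fderiv]
        rfl
      have l1 : ∀ i : Fin m, L (Pi.single (Fin.castAdd l i) 1) = Pi.single i 1 := fun i => by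
        ext k; simp [L, Pi.single_apply]
      have l2 : ∀ i : Fin l, L (Pi.single (Fin.natAdd m i) 1) = 0 := fun i => by
        ext k
        simp only [L, ContinuousLinearMap.pi_apply, ContinuousLinearMap.proj_apply, Pi.zero_apply]
        exact Pi.single_eq_of_ne (Fin.ne_of_lt (by simp [Fin.lt_def]; omega)) _
      have r1 : ∀ i : Fin l, R (Pi.single (Fin.natAdd m i) 1) = Pi.single i 1 := fun i => by
        ext k; simp [R, Pi.single_apply]
      have r2 : ∀ i : Fin m, R (Pi.single (Fin.castAdd l i) 1) = 0 := fun i => by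
        ext k
        simp only [R, ContinuousLinearMap.pi_apply, ContinuousLinearMap.proj_apply, Pi.zero_apply]
        exact Pi.single_eq_of_ne (Fin.ne_of_gt (by simp [Fin.lt_def]; omega)) _
      simp only [Prod.snd_sub, Pi.sub_apply, cylGrad, hd, hL, hR, Fin.sum_univ_add, l1, l2, r1, r2,
        Fin.append_left, Fin.append_right, map_zero]
      simp [sub_eq_add_neg]
  · intro i
    refine Fin.addCases (fun i => ?_) (fun i => ?_) i
    · rw [Fin.append_left]; exact hf i
    · rw [Fin.append_right]; exact hh i

variable {Q : Measure QuantileFun} [IsProbabilityMeasure Q]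

theorem memLp_comp_pairings {m : ℕ} {U : (Fin m → ℝ) → ℝ} (hU : Continuous U)
    {f : Fin m → I01 → ℝ} (hf : ∀ i, MemLp (f i) 2 volume) (p : ℝ≥0∞) :
    MemLp (fun g => U fun i => pairing (f i) g) p Q := by
  obtain ⟨M, hM0, hM⟩ := exists_norm_pairing_le fun i => integrable_of_memLp_two (hf i)
  obtain ⟨K, hK⟩ := (isCompact_closedBall (0 : Fin m → ℝ) M).exists_bound_of_continuousOn
    hU.continuousOn
  exact MemLp.of_bound (hU.comp (continuous_pairings hf)).aestronglyMeasurable K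
    (ae_of_all _ fun g => hK _ (mem_closedBall_zero_iff.2 (hM g)))

theorem memLp_mul_prod {a : QuantileFun → ℝ} (ha : AEStronglyMeasurable a Q) {M : ℝ}
    (hM : ∀ g, |a g| ≤ M) {f : I01 → ℝ} (hf : MemLp f 2 volume) :
    MemLp (fun z : QuantileFun × I01 => a z.1 * f z.2) 2 (Q.prod volume) := by
  have h2 : MemLp (fun z : QuantileFun × I01 => f z.2) 2 (Q.prod volume) :=
    hf.comp_measurePreserving measurePreserving_snd
  refine h2.of_le_mul (c := M) (ha.comp_fst.mul h2.1) (ae_of_all _ fun z => ?_)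
  rw [norm_mul]
  exact mul_le_mul_of_nonneg_right (hM z.1) (norm_nonneg _)

theorem memLp_cylGrad {m : ℕ} {U : (Fin m → ℝ) → ℝ} (hU : ContDiff ℝ 1 U)
    {f : Fin m → I01 → ℝ} (hf : ∀ i, MemLp (f i) 2 volume) :
    MemLp (cylGrad U f) 2 (Q.prod volume) := by
  obtain ⟨M, hM0, hM⟩ := exists_norm_pairing_le fun i => integrable_of_memLp_two (hf i)
  refine memLp_finsetSum _ fun i _ => ?_
  have hc : Continuous fun x => fderiv ℝ U x (Pi.single i 1) :=
    (hU.continuous_fderiv (by simp)).clm_apply continuous_const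
  obtain ⟨K, hK⟩ := (isCompact_closedBall (0 : Fin m → ℝ) M).exists_bound_of_continuousOn
    hc.continuousOn
  exact memLp_mul_prod (hc.comp (continuous_pairings hf)).aestronglyMeasurable
    (fun g => hK _ (mem_closedBall_zero_iff.2 (hM g))) (hf i)

theorem cylinderGradients_memLp {p : (QuantileFun → ℝ) × (QuantileFun × I01 → ℝ)}
    (hp : p ∈ cylinderGradients) : MemLp p.1 2 Q ∧ MemLp p.2 2 (Q.prod volume) := by
  obtain ⟨m, U, f, hU, hf, rfl⟩ := exists_of_mem_cylinderGradients hp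
  exact ⟨memLp_comp_pairings hU.continuous hf 2, memLp_cylGrad hU hf⟩

/-- By linearity, the derivative of a cylinder function along `g ↦ φ ∘ g` is the L² inner product of
its gradient with `φ ∘ g`. -/
theorem fderiv_apply_integral {m : ℕ} (U : (Fin m → ℝ) → ℝ) {f : Fin m → I01 → ℝ}
    (hf : ∀ i, Integrable (f i)) {φ : ℝ → ℝ} (hφ : Continuous φ) (g : QuantileFun) :
    fderiv ℝ U (fun i => pairing (f i) g) (fun i => ∫ t, f i t * φ (g t)) =
      ∫ t, cylGrad U f (g, t) * φ (g t) := by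
  obtain ⟨K, hK⟩ := (isCompact_Icc (a := (0 : ℝ)) (b := 1)).exists_bound_of_continuousOn
    hφ.continuousOn
  have hi : ∀ i, Integrable fun t => f i t * φ (g t) := fun i =>
    (hf i).mul_bdd (hφ.measurable.comp g.measurable).aestronglyMeasurable
      (ae_of_all _ fun t => hK _ (g.2.1 t))
  have h : (fun i => ∫ t, f i t * φ (g t)) =
      ∑ i, (∫ t, f i t * φ (g t)) • (Pi.single i 1 : Fin m → ℝ) := by
    ext k
    simp [Finset.sum_apply, Pi.single_apply]
  rw [h, map_sum]
  simp only [map_smul, smul_eq_mul, cylGrad, Finset.sum_mul, mul_assoc]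
  rw [integral_finsetSum _ fun i _ => (hi i).const_mul _]
  simp only [integral_const_mul]
  exact Finset.sum_congr rfl fun i _ => mul_comm _ _

end Cylinder

/-! ### Measure determining functionals -/

section Determining

variable {Q : Measure QuantileFun}

/-- The functions `cos ⟨f,g⟩` and `sin ⟨f,g⟩` determine integrable functions on `𝒢`. -/
theorem ae_eq_zero_of_integral_cos_sin {X : QuantileFun → ℝ} (hX : Integrable X Q)
    (hcos : ∀ f : I01 → ℝ, MemLp f 2 volume → ∫ g, X g * Real.cos (pairing f g) ∂Q = 0)
    (hsin : ∀ f : I01 → ℝ, MemLp f 2 volume → ∫ g, X g * Real.sin (pairing f g) ∂Q = 0) :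
    X =ᵐ[Q] 0 := by
  have : Fact ((2 : ℝ≥0∞) ≠ ⊤) := ⟨by simp⟩
  borelize ↥(Lp ℝ 2 (volume : Measure I01))
  have hmL : Measurable QuantileFun.toL2 := QuantileFun.continuous_toL2.measurable
  let ν : (QuantileFun → ℝ) → Measure QuantileFun := fun Y =>
    Q.withDensity fun g => ENNReal.ofReal (Y g)
  have hfin : ∀ Y : QuantileFun → ℝ, Integrable Y Q → IsFiniteMeasure (ν Y) := fun Y hY =>
    isFiniteMeasure_withDensity_ofReal hY.2
  have hpos : Integrable (fun g => max (X g) 0) Q := hX.pos_part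
  have hneg : Integrable (fun g => max (-X g) 0) Q := hX.neg_part
  have f1 := hfin _ hpos
  have f2 := hfin _ hneg
  have hchar : ∀ (Y : QuantileFun → ℝ), Integrable Y Q → (∀ g, 0 ≤ Y g) →
      ∀ φ : Lp ℝ 2 (volume : Measure I01), charFun ((ν Y).map QuantileFun.toL2) φ =
        ∫ g, (Y g : ℂ) * Complex.exp ((pairing φ g : ℂ) * Complex.I) ∂Q := by
    intro Y hY hY0 φ
    rw [charFun_apply, integral_map hmL.aemeasurable
      (by fun_prop), integral_withDensity_eq_integral_toReal_smul₀ hY.1.aemeasurable.ennreal_ofReal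
      (ae_of_all _ fun _ => ENNReal.ofReal_lt_top)]
    refine integral_congr_ae (ae_of_all _ fun g => ?_)
    simp only [ENNReal.toReal_ofReal (hY0 g)]
    rw [real_inner_comm, pairing_eq_inner (Lp.memLp φ), Lp.toLp_coeFn]
    exact Complex.real_smul
  have hexp : ∀ (Y : QuantileFun → ℝ), Integrable Y Q → ∀ f : I01 → ℝ, MemLp f 2 volume →
      Integrable (fun g => (Y g : ℂ) * Complex.exp ((pairing f g : ℂ) * Complex.I)) Q := by
    intro Y hY f hf
    refine hY.ofReal.mul_bdd (c := 1) ?_ (ae_of_all _ fun g => ?_)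
    · have := continuous_pairing hf
      exact Continuous.aestronglyMeasurable (by fun_prop)
    · rw [Complex.norm_exp_ofReal_mul_I]
  -- The positive and negative parts of `X` are densities of two finite measures. The hypotheses say
  -- that their images in the Hilbert space L² have the same characteristic function.
  have heq : (ν fun g => max (X g) 0).map QuantileFun.toL2 =
      (ν fun g => max (-X g) 0).map QuantileFun.toL2 := by
    refine Measure.ext_of_charFun (funext fun φ => ?_)
    rw [hchar _ hpos (fun g => le_max_right _ _), hchar _ hneg (fun g => le_max_right _ _),
      ← sub_eq_zero, ← integral_sub (hexp _ hpos _ (Lp.memLp φ)) (hexp _ hneg _ (Lp.memLp φ))]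
    have e : ∀ g, ((max (X g) 0 : ℝ) : ℂ) * Complex.exp ((pairing φ g : ℂ) * Complex.I) -
        ((max (-X g) 0 : ℝ) : ℂ) * Complex.exp ((pairing φ g : ℂ) * Complex.I) =
        ((X g * Real.cos (pairing φ g) : ℝ) : ℂ) +
          ((X g * Real.sin (pairing φ g) : ℝ) : ℂ) * Complex.I := fun g => by
      rw [← sub_mul, ← Complex.ofReal_sub, max_zero_sub_max_neg_zero_eq_self,
        Complex.exp_mul_I]
      push_cast
      ring
    have hb : ∀ T : ℝ → ℝ, Continuous T → (∀ x, |T x| ≤ 1) →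
        Integrable (fun g => X g * T (pairing φ g)) Q := fun T hT h1 =>
      hX.mul_bdd (c := 1) (hT.comp (continuous_pairing (Lp.memLp φ))).aestronglyMeasurable
        (ae_of_all _ fun g => h1 _)
    simp only [e]
    rw [integral_add (hb _ Real.continuous_cos Real.abs_cos_le_one).ofReal
      ((hb _ Real.continuous_sin Real.abs_sin_le_one).ofReal.mul_const _), integral_mul_const,
      integral_complex_ofReal, integral_complex_ofReal, hcos _ (Lp.memLp φ), hsin _ (Lp.memLp φ)]
    simp
  refine hX.ae_eq_zero_of_forall_setIntegral_eq_zero fun s hs _ => ?_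
  -- The topology of `𝒢` is induced from L², so every Borel set is a preimage and equality of the
  -- images suffices.
  have hs' : ∃ B : Set (Lp ℝ 2 (volume : Measure I01)), MeasurableSet B ∧
      QuantileFun.toL2 ⁻¹' B = s := by
    have h1 : (borel QuantileFun) = MeasurableSpace.comap QuantileFun.toL2 (borel _) := borel_comap
    have h2 : @MeasurableSet _ (borel QuantileFun) s := hs
    rw [h1] at h2
    exact h2
  obtain ⟨B, hB, rfl⟩ := hs'
  have h3 := congrArg (fun m => m B) heq
  rw [Measure.map_apply hmL hB, Measure.map_apply hmL hB, withDensity_apply _ hs,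
    withDensity_apply _ hs] at h3
  have h4 := integral_eq_lintegral_pos_part_sub_lintegral_neg_part
    (hX.integrableOn (s := QuantileFun.toL2 ⁻¹' B))
  rw [h4, sub_eq_zero]
  have e1 : ∀ x : ℝ, ENNReal.ofReal (max x 0) = ENNReal.ofReal x := fun x => by
    rcases le_total x 0 with h | h <;> simp [h, ENNReal.ofReal_of_nonpos]
  simp only [e1] at h3
  rw [h3]

end Determining

/-! ### Functions of an increasing function -/

section Injective

open Polynomial in
/-- If `H` is orthogonal to all the functions `φ ∘ g`, `φ(y) = y (1 - y) y^k`, for an injective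
`g`, then it vanishes. -/
theorem ae_eq_zero_of_integral_mul_pow {g : I01 → ℝ} (hg : Measurable g)
    (hinj : Function.Injective g) (h01 : ∀ t, g t ∈ Set.Icc (0 : ℝ) 1)
    (hpos : ∀ᵐ t : I01, 0 < g t ∧ g t < 1) {H : I01 → ℝ} (hH : Integrable H)
    (h : ∀ k : ℕ, ∫ t, H t * (g t * (1 - g t) * g t ^ k) = 0) : ∀ᵐ t : I01, H t = 0 := by
  let w : I01 → ℝ := fun t => H t * (g t * (1 - g t))
  have hbd : ∀ t, |g t * (1 - g t)| ≤ 1 := fun t => by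
    have := h01 t
    rw [abs_of_nonneg (mul_nonneg this.1 (by linarith [this.2]))]
    nlinarith [this.1, this.2]
  have hw : Integrable w := hH.mul_bdd (c := 1)
    (hg.mul (measurable_const.sub hg)).aestronglyMeasurable (ae_of_all _ hbd)
  have hcont : ∀ θ : ℝ → ℝ, Continuous θ → Integrable fun t => w t * θ (g t) := fun θ hθ => by
    obtain ⟨K, hK⟩ := (isCompact_Icc (a := (0 : ℝ)) (b := 1)).exists_bound_of_continuousOn
      hθ.continuousOn
    exact hw.mul_bdd (hθ.measurable.comp hg).aestronglyMeasurable
      (ae_of_all _ fun t => hK _ (h01 t))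
  have hpoly : ∀ p : ℝ[X], ∫ t, w t * p.eval (g t) = 0 := by
    intro p
    simp only [Polynomial.eval_eq_sum_range, Finset.mul_sum]
    rw [integral_finsetSum]
    · refine Finset.sum_eq_zero fun k _ => ?_
      have := h k
      have e : ∀ t, w t * (p.coeff k * g t ^ k) =
          p.coeff k * (H t * (g t * (1 - g t) * g t ^ k)) := fun t => by
        simp only [w]; ring
      simp only [e, integral_const_mul, this, mul_zero]
    · intro k _
      exact hcont (fun y => p.coeff k * y ^ k) (by fun_prop)
  have hθ : ∀ θ : ℝ → ℝ, Continuous θ → ∫ t, w t * θ (g t) = 0 := by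
    intro θ hθ
    have hle : ∀ ε > 0, |∫ t, w t * θ (g t)| ≤ ε * ∫ t, |w t| := by
      intro ε hε
      obtain ⟨p, hp⟩ := exists_polynomial_near_of_continuousOn 0 1 θ hθ.continuousOn ε hε
      have e : ∫ t, w t * θ (g t) = ∫ t, (w t * θ (g t) - w t * p.eval (g t)) := by
        rw [integral_sub (hcont θ hθ) (hcont _ p.continuous), hpoly, sub_zero]
      rw [e, ← integral_const_mul, ← Real.norm_eq_abs]
      refine norm_integral_le_of_norm_le (hw.abs.const_mul _) (ae_of_all _ fun t => ?_)
      rw [← mul_sub, norm_mul, mul_comm, Real.norm_eq_abs, Real.norm_eq_abs, abs_sub_comm]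
      exact mul_le_mul_of_nonneg_right (hp _ (h01 t)).le (abs_nonneg _)
    by_contra hne
    have h1 : 0 < |∫ t, w t * θ (g t)| := abs_pos.2 hne
    have h2 : 0 ≤ ∫ t, |w t| := integral_nonneg fun _ => abs_nonneg _
    -- With this `ε` the bound is strictly smaller than the integral itself; the `+ 1` avoids
    -- division by zero.
    have h3 := hle (|∫ t, w t * θ (g t)| / (2 * ((∫ t, |w t|) + 1))) (by positivity)
    rw [div_mul_eq_mul_div, le_div_iff₀ (by positivity)] at h3
    nlinarith
  have : StandardBorelSpace I01 := measurableSet_Ico.standardBorel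
  -- An injective measurable map of standard Borel spaces is an embedding, so `w` factors as `K ∘ g`
  -- a.e.; then `K` is orthogonal to all test functions for the image measure.
  have hemb : MeasurableEmbedding g := hg.measurableEmbedding hinj
  obtain ⟨w', hw'm, hww'⟩ := hw.1
  obtain ⟨K, hKm, hK⟩ := hemb.exists_measurable_extend hw'm.measurable fun _ => inferInstance
  have hKg : ∀ᵐ t : I01, K (g t) = w t := by
    filter_upwards [hww'] with t ht
    rw [ht, ← hK]
    rfl
  have hKi : Integrable K (Measure.map g volume) := by
    rw [hemb.integrable_map_iff]
    exact hw.congr (hKg.mono fun t ht => ht.symm)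
  have hK0 := ae_eq_zero_of_integral_contDiff_smul_eq_zero hKi.locallyIntegrable fun θ hθs _ => by
    rw [hemb.integral_map]
    refine Eq.trans (integral_congr_ae ?_) (hθ θ hθs.continuous)
    filter_upwards [hKg] with t ht
    rw [ht, smul_eq_mul, mul_comm]
  have hK1 := ae_of_ae_map hg.aemeasurable hK0
  filter_upwards [hK1, hKg, hpos] with t h1 h2 h3
  rw [h1] at h2
  have : H t * (g t * (1 - g t)) = 0 := h2.symm
  exact (mul_eq_zero.1 this).resolve_right (mul_pos h3.1 (by linarith [h3.2])).ne'

end Injective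

/-! ### Closability of the Wasserstein Dirichlet form -/

section Closability

variable {β : ℝ} {Q : Measure QuantileFun}

/-- The field `V · (φ ∘ g)` has, in effect, a bounded divergence. The point is that the constant is
the same for all cylinder functions. -/
theorem IsDirichletLaw.exists_bound (hβ : 0 < β) (hQ : IsDirichletLaw β Q) {φ : ℝ → ℝ}
    (hφ : ContDiff ℝ 2 φ) (h0 : φ 0 = 0) (h1 : φ 1 = 0) {l : ℕ} {V : (Fin l → ℝ) → ℝ}
    (hV : ContDiff ℝ 1 V) {h : Fin l → I01 → ℝ} (hh : ∀ i, MemLp (h i) 2 volume) :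
    ∃ C : ℝ, ∀ p ∈ cylinderGradients,
      |∫ z, p.2 z * (φ (z.1 z.2) * V fun i => pairing (h i) z.1) ∂(Q.prod volume)| ≤
        C * ∫ g, |p.1 g| ∂Q := by
  have := hQ.1
  obtain ⟨B, hB0, hB, hB'⟩ := exists_bound_deriv hφ
  have hBnn : 0 ≤ B := (abs_nonneg _).trans (hB 0 (by simp))
  have hhi := fun i => integrable_of_memLp_two (hh i)
  obtain ⟨M, hM0, hM⟩ := exists_norm_pairing_le hhi
  obtain ⟨K, hK⟩ := (isCompact_closedBall (0 : Fin l → ℝ) M).exists_bound_of_continuousOn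
    hV.continuous.continuousOn
  have hdV : Continuous fun z : (Fin l → ℝ) × (Fin l → ℝ) => fderiv ℝ V z.1 z.2 :=
    ((hV.continuous_fderiv (by simp)).comp continuous_fst).clm_apply continuous_snd
  let M' : ℝ := ∑ i, (∫ t, |h i t|) * B
  have hnn : ∀ i, 0 ≤ (∫ t, |h i t|) * B := fun i =>
    mul_nonneg (integral_nonneg fun _ => abs_nonneg _) hBnn
  have hM' : ∀ g : QuantileFun, ‖fun i => ∫ t, h i t * φ (g t)‖ ≤ M' := fun g => by
    refine (pi_norm_le_iff_of_nonneg (Finset.sum_nonneg fun i _ => hnn i)).2 fun i => ?_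
    exact (abs_integral_mul_le (hhi i) fun t => hB0 _ (g.2.1 t)).trans
      (Finset.single_le_sum (f := fun i => (∫ t, |h i t|) * B) (fun i _ => hnn i)
        (Finset.mem_univ i))
  obtain ⟨K', hK'⟩ := ((isCompact_closedBall (0 : Fin l → ℝ) M).prod
    (isCompact_closedBall (0 : Fin l → ℝ) M')).exists_bound_of_continuousOn hdV.continuousOn
  -- `K` bounds `V` and `K'` bounds the derivative of `V` along the field, on the bounded ranges of
  -- their arguments.
  refine ⟨(β + 2) * B * K + K', fun p hp => ?_⟩
  obtain ⟨hp1, hp2⟩ := cylinderGradients_memLp (Q := Q) hp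
  obtain ⟨m, U, f, hU, hf, rfl⟩ := exists_of_mem_cylinderGradients hp
  have hfi := fun i => integrable_of_memLp_two (hf i)
  have key := hQ.bound hβ hφ h0 h1 hB0 hB hB' hU hfi hV hhi
  have hVb : ∀ g : QuantileFun, |V fun i => pairing (h i) g| ≤ K := fun g =>
    hK _ (mem_closedBall_zero_iff.2 (hM g))
  have hdVb : ∀ g : QuantileFun, |fderiv ℝ V (fun i => pairing (h i) g)
      (fun i => ∫ t, h i t * φ (g t))| ≤ K' := fun g =>
    hK' (_, _) ⟨mem_closedBall_zero_iff.2 (hM g), mem_closedBall_zero_iff.2 (hM' g)⟩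
  have hui : Integrable (fun g => U fun i => pairing (f i) g) Q := hp1.integrable (by norm_num)
  have e1 : ∫ z, cylGrad U f z * (φ (z.1 z.2) * V fun i => pairing (h i) z.1) ∂(Q.prod volume) =
      ∫ g, fderiv ℝ U (fun i => pairing (f i) g) (fun i => ∫ t, f i t * φ (g t)) *
        V (fun i => pairing (h i) g) ∂Q := by
    rw [integral_prod]
    · refine integral_congr_ae (ae_of_all _ fun g => ?_)
      simp only
      rw [fderiv_apply_integral U hfi hφ.continuous, ← integral_mul_const]
      simp only [mul_assoc]
    · refine (hp2.integrable (by norm_num)).mul_bdd (c := B * K) ?_ (ae_of_all _ fun z => ?_)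
      · exact ((hφ.continuous.measurable.comp measurable_eval_prod).mul
          ((hV.continuous.comp (continuous_pairings hh)).measurable.comp
            measurable_fst)).aestronglyMeasurable
      · rw [norm_mul]
        exact mul_le_mul (hB0 _ (z.1.2.1 z.2)) (hVb z.1) (norm_nonneg _) hBnn
  simp only [e1]
  refine key.trans ?_
  rw [add_mul ((β + 2) * B * K)]
  refine add_le_add ?_ ?_
  · rw [mul_assoc _ K, ← integral_const_mul K]
    have : 0 ≤ β + 2 := by linarith
    refine mul_le_mul_of_nonneg_left (integral_mono_of_nonneg (ae_of_all _ fun _ => abs_nonneg _)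
      (hui.abs.const_mul K) (ae_of_all _ fun g => ?_)) (by positivity)
    simp only [abs_mul]
    rw [mul_comm]
    exact mul_le_mul_of_nonneg_right (hVb g) (abs_nonneg _)
  · rw [← integral_const_mul K']
    refine integral_mono_of_nonneg (ae_of_all _ fun _ => abs_nonneg _)
      (hui.abs.const_mul K') (ae_of_all _ fun g => ?_)
    simp only [abs_mul]
    rw [mul_comm]
    exact mul_le_mul_of_nonneg_right (hdVb g) (abs_nonneg _)

/-- Along an approximating sequence the integrals of the gradients are at most a constant times the
L¹ norm of the functions, which tends to `0`; they also converge to the integral of `G`. -/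
theorem IsDirichletLaw.integral_closureGradient_eq_zero (hβ : 0 < β) (hQ : IsDirichletLaw β Q)
    {G : QuantileFun × I01 → ℝ}
    (hG : IsClosureGradient Q (Q.prod volume) cylinderGradients 0 G) {φ : ℝ → ℝ}
    (hφ : ContDiff ℝ 2 φ) (h0 : φ 0 = 0) (h1 : φ 1 = 0) {l : ℕ} {V : (Fin l → ℝ) → ℝ}
    (hV : ContDiff ℝ 1 V) {h : Fin l → I01 → ℝ} (hh : ∀ i, MemLp (h i) 2 volume) :
    ∫ g, (∫ t, G (g, t) * φ (g t)) * (V fun i => pairing (h i) g) ∂Q = 0 := by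
  have := hQ.1
  obtain ⟨-, hGL, p, hp, l1, l2⟩ := hG
  obtain ⟨C, hC⟩ := hQ.exists_bound hβ hφ h0 h1 hV hh
  obtain ⟨B, hB⟩ := (isCompact_Icc (a := (0 : ℝ)) (b := 1)).exists_bound_of_continuousOn
    hφ.continuous.continuousOn
  have hBnn : 0 ≤ B := (norm_nonneg _).trans (hB 0 (by simp))
  obtain ⟨M, hM0, hM⟩ := exists_norm_pairing_le fun i => integrable_of_memLp_two (hh i)
  obtain ⟨K, hK⟩ := (isCompact_closedBall (0 : Fin l → ℝ) M).exists_bound_of_continuousOn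
    hV.continuous.continuousOn
  have hm : MemLp (fun z : QuantileFun × I01 => φ (z.1 z.2) * V fun i => pairing (h i) z.1) 2
      (Q.prod volume) := by
    refine MemLp.of_bound ?_ (B * K) (ae_of_all _ fun z => ?_)
    · exact ((hφ.continuous.measurable.comp measurable_eval_prod).mul
        ((hV.continuous.comp (continuous_pairings hh)).measurable.comp
          measurable_fst)).aestronglyMeasurable
    · rw [norm_mul]
      exact mul_le_mul (hB _ (z.1.2.1 z.2)) (hK _ (mem_closedBall_zero_iff.2 (hM z.1)))
        (norm_nonneg _) hBnn
  have t1 := tendsto_integral_mul_of_tendsto_eLpNorm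
    (fun k => (cylinderGradients_memLp (Q := Q) (hp k)).2) hGL hm l2
  have t2 := tendsto_integral_mul_of_tendsto_eLpNorm (v := fun k g => |(p k).1 g|) (v' := 0)
    (h := fun _ => 1) (fun k => (cylinderGradients_memLp (Q := Q) (hp k)).1.abs) MemLp.zero'
    (memLp_const 1) (l1.congr fun k => by
      rw [sub_zero, sub_zero]
      exact (eLpNorm_norm _).symm)
  simp only [mul_one, Pi.zero_apply, integral_zero] at t2
  have t3 : Tendsto (fun k => ∫ z, (p k).2 z * (φ (z.1 z.2) * V fun i => pairing (h i) z.1)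
      ∂(Q.prod volume)) atTop (𝓝 0) := by
    refine squeeze_zero_norm (fun k => hC _ (hp k)) ?_
    simpa using t2.const_mul C
  have e := tendsto_nhds_unique t1 t3
  have hi : Integrable (fun z : QuantileFun × I01 =>
      G z * (φ (z.1 z.2) * V fun i => pairing (h i) z.1)) (Q.prod volume) := hGL.integrable_mul hm
  rw [integral_prod _ hi] at e
  refine Eq.trans (integral_congr_ae (ae_of_all _ fun g => ?_)) e
  simp only
  rw [← integral_mul_const]
  simp only [mul_assoc]

/-- The Wasserstein Dirichlet form is closable. -/
theorem IsDirichletLaw.closable (hβ : 0 < β) (hQ : IsDirichletLaw β Q)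
    (G : QuantileFun × I01 → ℝ)
    (hG : IsClosureGradient Q (Q.prod volume) cylinderGradients 0 G) :
    G =ᵐ[Q.prod volume] 0 := by
  have := hQ.1
  have hGi : Integrable G (Q.prod volume) := hG.2.1.integrable (by norm_num)
  -- A countable family vanishing at both ends, so one null set of `g` serves for all `k`; the `y ^
  -- k` span the polynomials.
  let φ : ℕ → ℝ → ℝ := fun k y => y * (1 - y) * y ^ k
  have hφ : ∀ k, ContDiff ℝ 2 (φ k) := fun k => by fun_prop
  have hX : ∀ᵐ g ∂Q, ∀ k, ∫ t, G (g, t) * φ k (g t) = 0 := by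
    refine ae_all_iff.2 fun k => ?_
    obtain ⟨B, hB⟩ := (isCompact_Icc (a := (0 : ℝ)) (b := 1)).exists_bound_of_continuousOn
      (hφ k).continuous.continuousOn
    have hint : Integrable (fun z : QuantileFun × I01 => G z * φ k (z.1 z.2)) (Q.prod volume) :=
      hGi.mul_bdd (c := B) ((hφ k).continuous.measurable.comp
        measurable_eval_prod).aestronglyMeasurable (ae_of_all _ fun z => hB _ (z.1.2.1 z.2))
    refine ae_eq_zero_of_integral_cos_sin hint.integral_prod_left (fun f hf => ?_) fun f hf => ?_
    · exact hQ.integral_closureGradient_eq_zero hβ hG (hφ k) (by simp [φ]) (by simp [φ]) (l := 1)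
        (V := fun x => Real.cos (x 0)) (h := fun _ => f) (by fun_prop) fun _ => hf
    · exact hQ.integral_closureGradient_eq_zero hβ hG (hφ k) (by simp [φ]) (by simp [φ]) (l := 1)
        (V := fun x => Real.sin (x 0)) (h := fun _ => f) (by fun_prop) fun _ => hf
  -- A measurable version is needed to read an a.e. statement on the product off the sections.
  obtain ⟨G', hG'm, hGG'⟩ := hG.2.1.1
  have hG'0 : ∀ᵐ z ∂(Q.prod volume), G' z = 0 := by
    rw [Measure.ae_prod_iff_ae_ae (p := fun z => G' z = 0) (hG'm.measurable (measurableSet_singleton 0))]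
    filter_upwards [hX, hQ.ae_strictMono, Measure.ae_ae_of_ae_prod hGG', hGi.prod_right_ae]
      with g h1 h2 h3 h4
    have h5 : ∀ᵐ t : I01, G (g, t) = 0 := by
      refine ae_eq_zero_of_integral_mul_pow g.measurable h2.1.injective g.2.1 ?_ h4 h1
      filter_upwards [ae_pos_I01] with t ht using h2.2 t ht
    filter_upwards [h3, h5] with t h6 h7
    rw [← h6, h7]
  filter_upwards [hGG', hG'0] with z h1 h2
  rw [h1, h2, Pi.zero_apply]

/-- The energy of an element of the domain is computed by any gradient in the closure. -/
theorem IsDirichletLaw.energy_eq (hβ : 0 < β) (hQ : IsDirichletLaw β Q) {u : QuantileFun → ℝ}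
    {G : QuantileFun × I01 → ℝ} (hG : IsClosureGradient Q (Q.prod volume) cylinderGradients u G) :
    energy Q u = eLpNorm G 2 (Q.prod volume) ^ 2 := by
  have := hQ.1
  exact formValue_eq cylinderGradients_sub
    (fun p hp => ⟨(cylinderGradients_memLp hp).1.1, (cylinderGradients_memLp hp).2.1⟩)
    (hQ.closable hβ) hG

theorem IsDirichletLaw.energyN_eq (hβ : 0 < β) (hQ : IsDirichletLaw β Q) {n : ℕ}
    {u : EuclideanSpace ℝ (Fin n) → ℝ} {G : EuclideanSpace ℝ (Fin n) → EuclideanSpace ℝ (Fin n)}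
    (hG : IsClosureGradient (q β n) (q β n) (smoothGradients n) u G) :
    energyN β n u = eLpNorm G 2 (q β n) ^ 2 := by
  have := hQ.isProbabilityMeasure_q n
  have hfin : IsFiniteMeasure (orderedDirichlet fun _ : Fin (n + 1) => β / ((n + 1 : ℕ) : ℝ)) :=
    (inferInstance : IsFiniteMeasure (q β n))
  exact formValue_eq smoothGradients_sub (smoothGradients_aestronglyMeasurable _)
    (fun G hG => smoothGradients_closable (fun _ => by positivity) G hG) hG

end Closability

/-! ### Conditional expectations given the grid values -/

section Interpolation

variable {β : ℝ} {Q : Measure QuantileFun}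

/-- The position of `t` in its grid cell, as a fraction of the length of the cell. -/
def frac (n : ℕ) (t : I01) : ℝ := ((n : ℝ) + 1) * t - (cell n t : ℕ)

theorem frac_nonneg (n : ℕ) (t : I01) : 0 ≤ frac n t := sub_nonneg.2 (cell_le n t)

theorem frac_lt_one (n : ℕ) (t : I01) : frac n t < 1 := by
  have := lt_cell_add_one n t
  rw [frac]
  linarith

theorem measurable_frac (n : ℕ) : Measurable (frac n) :=
  (measurable_subtype_coe.const_mul _).sub
    ((measurable_of_finite fun k : Fin (n + 1) => ((k : ℕ) : ℝ)).comp (measurable_cell n))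

/-- Linear interpolation at `t` of the values of `g` on the grid. -/
def linVal (n : ℕ) (g : QuantileFun) (t : I01) : ℝ :=
  (1 - frac n t) * gridVal n g (cell n t).castSucc + frac n t * gridVal n g (cell n t).succ

/-- With the end point `0` prepended, the inserted coordinate sits at `j.castSucc.succ`; skipping
that index recovers the old vector. -/
theorem withEnds_insertNth {n : ℕ} (j : Fin (n + 1)) (y : ℝ) (x : Fin n → ℝ) (k : Fin (n + 2)) :
    withEnds (j.insertNth y x : Fin (n + 1) → ℝ) (j.castSucc.succ.succAbove k) = withEnds x k := by
  induction k using ends_cases with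
  | h0 => rw [Fin.succ_succAbove_zero, withEnds_zero, withEnds_zero]
  | hl =>
    rw [← Fin.succ_last, Fin.succ_succAbove_succ,
      Fin.succAbove_of_le_castSucc j.castSucc (Fin.last n) (Fin.castSucc_le_castSucc_iff.2 j.le_last),
      Fin.succ_last, Fin.succ_last, withEnds_last, withEnds_last]
  | hm i =>
    rw [Fin.succ_succAbove_succ, Fin.castSucc_succAbove_castSucc, withEnds_mid, withEnds_mid,
      Fin.insertNth_apply_succAbove]

theorem increment_insertNth_castSucc {n : ℕ} (j : Fin (n + 1)) (y : ℝ) (x : Fin n → ℝ) :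
    increment (j.insertNth y x : Fin (n + 1) → ℝ) j.castSucc = y - withEnds x j.castSucc := by
  have h : j.castSucc.succ.succAbove j.castSucc = j.castSucc.castSucc :=
    Fin.succAbove_of_castSucc_lt _ _ (by simp [Fin.lt_def])
  rw [increment, withEnds_mid, Fin.insertNth_apply_same, ← h, withEnds_insertNth]

theorem increment_insertNth_succ {n : ℕ} (j : Fin (n + 1)) (y : ℝ) (x : Fin n → ℝ) :
    increment (j.insertNth y x : Fin (n + 1) → ℝ) j.succ = withEnds x j.succ - y := by
  have h : j.castSucc.succ.succAbove j.succ = j.succ.succ :=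
    Fin.succAbove_of_le_castSucc _ _ (by simp)
  rw [increment, withEnds_mid', Fin.insertNth_apply_same, ← h, withEnds_insertNth]

theorem comp_insertNth {α γ : Type*} {n : ℕ} (φ : α → γ) (j : Fin (n + 1)) (y : α) (x : Fin n → α) :
    (fun k => φ ((j.insertNth y x : Fin (n + 1) → α) k)) =
      (j.insertNth (φ y) (fun i => φ (x i)) : Fin (n + 1) → γ) := by
  ext k
  rcases Fin.eq_self_or_eq_succAbove j k with rfl | ⟨i, rfl⟩ <;> simp

/-- Test functions of the grid values do not see the difference between `g(t)` and the linear
interpolation. -/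
theorem IsDirichletLaw.integral_mul_linVal (hβ : 0 < β) (hQ : IsDirichletLaw β Q) (n : ℕ)
    {θ : EuclideanSpace ℝ (Fin n) → ℝ} (hθ : ContDiff ℝ 1 θ) {t : I01} (ht : 0 < (t : ℝ)) :
    ∫ g, θ (gridEval n g) * (linVal n g t - g t) ∂Q = 0 := by
  have := hQ.1
  have hn : (0 : ℝ) < (n : ℝ) + 1 := by positivity
  -- If the fraction is `0`, then `t` is a grid point of positive index and the interpolation is `g
  -- t` itself. Otherwise `t` lies strictly inside its cell and can be added to the grid.
  rcases (frac_nonneg n t).eq_or_lt with h0 | h0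
  · have h1 : ((n : ℝ) + 1) * t = (cell n t : ℕ) := by rw [frac] at h0; linarith
    have h2 : ∀ g, linVal n g t = g t := fun g => by
      rw [linVal, ← h0, sub_zero, one_mul, zero_mul, add_zero]
      refine gridVal_of_eq g _ t ?_ ?_
      · have : (0 : ℝ) < (cell n t : ℕ) := by rw [← h1]; positivity
        exact_mod_cast this
      · rw [Fin.val_castSucc, ← h1]
        field_simp
    simp [h2]
  · set j := cell n t with hj
    have hlow : ((j : ℕ) : ℝ) / ((n : ℝ) + 1) < t := by
      rw [div_lt_iff₀ hn, mul_comm]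
      rw [frac] at h0
      linarith
    have hup : (t : ℝ) < (((j : ℕ) : ℝ) + 1) / ((n : ℝ) + 1) := by
      rw [lt_div_iff₀ hn, mul_comm]
      exact lt_cell_add_one n t
    let τ : Fin (n + 1) → I01 := j.insertNth t (gridPoint n)
    have hτj : τ j = t := Fin.insertNth_apply_same _ _ _
    have hτi : ∀ i, τ (j.succAbove i) = gridPoint n i := fun i => Fin.insertNth_apply_succAbove _ _ _ _
    have hgp : ∀ i : Fin n, (gridPoint n i : ℝ) = (((i : ℕ) : ℝ) + 1) / ((n : ℝ) + 1) := fun i => rfl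
    have hτm : StrictMono fun i => (τ i : ℝ) := by
      intro a b hab
      rcases Fin.eq_self_or_eq_succAbove j a with rfl | ⟨i, rfl⟩
      · rcases Fin.eq_self_or_eq_succAbove j b with rfl | ⟨k, rfl⟩
        · exact absurd hab (lt_irrefl _)
        · simp only [hτj, hτi, hgp]
          refine hup.trans_le ?_
          have h1 : j ≤ k.castSucc := Fin.lt_succAbove_iff_le_castSucc _ _ |>.1 hab
          have h2 : ((j : ℕ) : ℝ) ≤ (k : ℕ) := by exact_mod_cast h1
          gcongr
      · rcases Fin.eq_self_or_eq_succAbove j b with rfl | ⟨k, rfl⟩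
        · simp only [hτj, hτi, hgp]
          refine lt_of_le_of_lt ?_ hlow
          have h1 : i.castSucc < j := Fin.succAbove_lt_iff_castSucc_lt _ _ |>.1 hab
          have h2 : ((i : ℕ) : ℝ) + 1 ≤ (j : ℕ) := by exact_mod_cast h1
          gcongr
        · simp only [hτi]
          exact gridPoint_strictMono n (Fin.succAbove_lt_succAbove_iff.1 hab)
    have hτ01 : ∀ i, (τ i : ℝ) ∈ Set.Ioo (0 : ℝ) 1 := fun i => by
      refine ⟨?_, (τ i).2.2⟩
      rcases Fin.eq_self_or_eq_succAbove j i with rfl | ⟨k, rfl⟩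
      · rw [hτj]; exact ht
      · rw [hτi]; exact gridPoint_pos k
    have hs := strictMono_withEnds hτm hτ01
    have hmap := hQ.2 (n + 1) τ hs
    set a : Fin (n + 2) → ℝ := fun i => β * increment (fun j => (τ j : ℝ)) i with ha
    have hapos : ∀ i, 0 < a i := fun i => mul_pos hβ (sub_pos.2 (hs Fin.castSucc_lt_succ))
    have hfin : IsFiniteMeasure (orderedDirichlet a) := by
      rw [← hmap]; infer_instance
    have hτr : (fun j => (τ j : ℝ)) =
        (j.insertNth (t : ℝ) (fun i => (gridPoint n i : ℝ)) : Fin (n + 1) → ℝ) :=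
      comp_insertNth (fun s : I01 => (s : ℝ)) j t (gridPoint n)
    -- The parameters on either side of `t` are in the ratio `frac : 1 - frac`. These are exactly
    -- the interpolation weights, so `a j.castSucc` times the right increment minus `a j.succ` times
    -- the left one is `β / (n + 1)` times `linVal n g t - g t`.
    have ha1 : a j.castSucc = β / ((n : ℝ) + 1) * frac n t := by
      rw [ha]
      simp only [hτr]
      rw [increment_insertNth_castSucc, withEnds_gridPoint, Fin.val_castSucc, frac, ← hj]
      field_simp
    have ha2 : a j.succ = β / ((n : ℝ) + 1) * (1 - frac n t) := by
      rw [ha]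
      simp only [hτr]
      rw [increment_insertNth_succ, withEnds_gridPoint, Fin.val_succ, frac]
      push_cast
      field_simp
      ring
    let P : EuclideanSpace ℝ (Fin (n + 1)) →L[ℝ] EuclideanSpace ℝ (Fin n) :=
      (EuclideanSpace.equiv (Fin n) ℝ).symm.toContinuousLinearMap.comp
        (ContinuousLinearMap.pi fun i => EuclideanSpace.proj (j.succAbove i))
    have hP : ∀ x i, P x i = x (j.succAbove i) := fun x i => rfl
    have hF : ContDiff ℝ 1 fun x => θ (P x) := hθ.comp P.contDiff
    have key := integral_coordinate_parts hapos hF j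
    -- `θ ∘ P` ignores the inserted coordinate, so the derivative term of the integration by parts
    -- drops out.
    have hd : ∀ x, fderiv ℝ (fun x => θ (P x)) x (EuclideanSpace.single j 1) = 0 := fun x => by
      have h1 : HasFDerivAt (fun x => θ (P x)) _ x :=
        HasFDerivAt.comp x (hθ.differentiable (by simp) _).hasFDerivAt P.hasFDerivAt
      have h2 : P (EuclideanSpace.single j 1) = 0 := by
        ext i
        rw [hP]
        simp [Fin.succAbove_ne]
      rw [h1.fderiv, ContinuousLinearMap.comp_apply, h2, map_zero]
    simp only [hd, zero_mul, zero_add] at key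
    rw [← hmap, integral_map (measurable_evalAt τ).aemeasurable] at key
    · have hx : ∀ g : QuantileFun, (fun k => evalAt τ g k) =
          (j.insertNth (g t) (fun i => gridEval n g i) : Fin (n + 1) → ℝ) := fun g =>
        comp_insertNth (fun s : I01 => g s) j t (gridPoint n)
      have hPx : ∀ g, P (evalAt τ g) = gridEval n g := fun g => by
        ext i
        rw [hP]
        change g (τ (j.succAbove i)) = g (gridPoint n i)
        rw [hτi]
      simp only [hx, hPx, increment_insertNth_castSucc, increment_insertNth_succ, ha1, ha2] at key
      have hc : β / ((n : ℝ) + 1) ≠ 0 := by positivity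
      refine (mul_eq_zero.1 ?_).resolve_left hc
      rw [← integral_const_mul]
      refine Eq.trans (integral_congr_ae (ae_of_all _ fun g => ?_)) key
      simp only [linVal, gridVal, ← hj]
      ring
    · exact (hF.continuous.mul (((continuous_increment _).const_mul _).sub
        ((continuous_increment _).const_mul _))).aestronglyMeasurable

/-- The coefficients of the affine function `x ↦ ⟨f, gₓ⟩`, where `gₓ` is the linear interpolation
of the grid values `x`. -/
def linCoef (n : ℕ) (f : I01 → ℝ) (k : Fin (n + 2)) : ℝ :=
  stepCoef Fin.castSucc (fun t => f t * (1 - frac n t)) k +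
    stepCoef Fin.succ (fun t => f t * frac n t) k

theorem integrable_mul_frac {f : I01 → ℝ} (hf : Integrable f) (n : ℕ) :
    Integrable fun t => f t * frac n t :=
  hf.mul_bdd (c := 1) (measurable_frac n).aestronglyMeasurable (ae_of_all _ fun t => by
    rw [Real.norm_eq_abs, abs_of_nonneg (frac_nonneg n t)]; exact (frac_lt_one n t).le)

theorem integrable_mul_one_sub_frac {f : I01 → ℝ} (hf : Integrable f) (n : ℕ) :
    Integrable fun t => f t * (1 - frac n t) := by
  simp only [mul_sub, mul_one]
  exact hf.sub (integrable_mul_frac hf n)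

theorem integrable_mul_comp_cell {f : I01 → ℝ} (hf : Integrable f) (n : ℕ) (y : Fin (n + 1) → ℝ) :
    Integrable fun t => f t * y (cell n t) := by
  refine hf.mul_bdd (c := ∑ k, |y k|) ((measurable_of_finite y).comp
    (measurable_cell n)).aestronglyMeasurable (ae_of_all _ fun t => ?_)
  exact Finset.single_le_sum (f := fun k => |y k|) (fun k _ => abs_nonneg _) (Finset.mem_univ _)

theorem sum_linCoef_mul {f : I01 → ℝ} (hf : Integrable f) (n : ℕ) (y : Fin (n + 2) → ℝ) :
    ∑ k, linCoef n f k * y k =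
      ∫ t, f t * ((1 - frac n t) * y (cell n t).castSucc + frac n t * y (cell n t).succ) := by
  simp only [linCoef, add_mul, Finset.sum_add_distrib]
  rw [sum_stepCoef_mul _ (integrable_mul_one_sub_frac hf n),
    sum_stepCoef_mul _ (integrable_mul_frac hf n), ← integral_add
    (integrable_mul_comp_cell (integrable_mul_one_sub_frac hf n) n fun k => y k.castSucc)
    (integrable_mul_comp_cell (integrable_mul_frac hf n) n fun k => y k.succ)]
  refine integral_congr_ae (ae_of_all _ fun t => ?_)
  simp only
  ring

theorem linVal_mem_Icc (n : ℕ) (g : QuantileFun) (t : I01) : linVal n g t ∈ Set.Icc (0 : ℝ) 1 := by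
  have h1 := gridVal_mem_Icc n g (cell n t).castSucc
  have h2 := gridVal_mem_Icc n g (cell n t).succ
  have h3 := frac_nonneg n t
  have h4 := (frac_lt_one n t).le
  have := (convex_Icc (0 : ℝ) 1) h1 h2 (sub_nonneg.2 h4) h3 (by ring)
  simpa [linVal] using this

theorem measurable_linVal (n : ℕ) : Measurable fun z : QuantileFun × I01 => linVal n z.1 z.2 :=
  ((measurable_const.sub ((measurable_frac n).comp measurable_snd)).mul
    (measurable_gridVal_cell n Fin.castSucc)).add
    (((measurable_frac n).comp measurable_snd).mul (measurable_gridVal_cell n Fin.succ))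

theorem affineFun_linCoef_gridEval {f : I01 → ℝ} (hf : Integrable f) (n : ℕ) (g : QuantileFun) :
    affineFun (linCoef n f) (gridEval n g) = ∫ t, f t * linVal n g t :=
  sum_linCoef_mul hf n _

/-- Fubini reduces the identity to fixed `t > 0`, where `g t` and its interpolation have the same
integral against functions of the grid values. -/
theorem IsDirichletLaw.integral_mul_affineFun (hβ : 0 < β) (hQ : IsDirichletLaw β Q) (n : ℕ)
    {θ : EuclideanSpace ℝ (Fin n) → ℝ} (hθ : ContDiff ℝ 1 θ) (hc : HasCompactSupport θ)
    {f : I01 → ℝ} (hf : Integrable f) :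
    ∫ g, θ (gridEval n g) * affineFun (linCoef n f) (gridEval n g) ∂Q =
      ∫ g, θ (gridEval n g) * pairing f g ∂Q := by
  have := hQ.1
  obtain ⟨K, hK⟩ := hc.exists_bound_of_continuous hθ.continuous
  have hsw : ∀ R : QuantileFun × I01 → ℝ, Measurable R → (∀ z, |R z| ≤ 1) →
      ∫ g, θ (gridEval n g) * (∫ t, f t * R (g, t)) ∂Q =
        ∫ t, f t * ∫ g, θ (gridEval n g) * R (g, t) ∂Q := by
    intro R hR hR1
    have hm : Measurable fun g => θ (gridEval n g) :=
      hθ.continuous.measurable.comp (measurable_gridEval n)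
    have hi : Integrable (fun z : QuantileFun × I01 => f z.2 * (θ (gridEval n z.1) * R z))
        (Q.prod volume) := by
      refine (hf.comp_snd Q).mul_bdd (c := K * 1)
        ((hm.comp measurable_fst).mul hR).aestronglyMeasurable (ae_of_all _ fun z => ?_)
      rw [norm_mul]
      exact mul_le_mul (hK _) (hR1 z) (norm_nonneg _) ((norm_nonneg _).trans (hK 0))
    have h := integral_integral_swap (f := fun g t => f t * (θ (gridEval n g) * R (g, t))) hi
    simp only [integral_const_mul] at h
    rw [← h]
    refine integral_congr_ae (ae_of_all _ fun g => ?_)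
    simp only
    rw [← integral_const_mul]
    refine integral_congr_ae (ae_of_all _ fun t => ?_)
    simp only
    ring
  have hb : ∀ y ∈ Set.Icc (0 : ℝ) 1, |y| ≤ 1 := fun y hy => by
    rw [abs_of_nonneg hy.1]; exact hy.2
  simp only [affineFun_linCoef_gridEval hf]
  rw [hsw (fun z => linVal n z.1 z.2) (measurable_linVal n) fun z => hb _ (linVal_mem_Icc n _ _)]
  change _ = ∫ g, θ (gridEval n g) * (∫ t, f t * g t) ∂Q
  rw [hsw (fun z => z.1 z.2) measurable_eval_prod fun z => z.1.abs_le_one _]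
  refine integral_congr_ae ?_
  filter_upwards [ae_pos_I01] with t ht
  have h1 := hQ.integral_mul_linVal hβ n hθ ht
  have hi : ∀ R : QuantileFun → ℝ, Measurable R → (∀ g, |R g| ≤ 1) →
      Integrable (fun g => θ (gridEval n g) * R g) Q := fun R hR hR1 => by
    refine Integrable.mul_bdd (c := 1) ?_ hR.aestronglyMeasurable (ae_of_all _ hR1)
    exact Integrable.of_bound (hθ.continuous.measurable.comp
      (measurable_gridEval n)).aestronglyMeasurable K (ae_of_all _ fun g => hK _)
  simp only [mul_sub] at h1
  have i1 : Integrable (fun g => θ (gridEval n g) * linVal n g t) Q :=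
    hi _ ((measurable_linVal n).comp measurable_prodMk_right) fun g => hb _ (linVal_mem_Icc n _ _)
  have i2 : Integrable (fun g : QuantileFun => θ (gridEval n g) * g t) Q :=
    hi _ (measurable_eval t) fun g => g.abs_le_one t
  rw [integral_sub i1 i2, sub_eq_zero] at h1
  exact congrArg (f t * ·) h1

theorem measurable_Phi (Q : Measure QuantileFun) (n : ℕ) (u : QuantileFun → ℝ) :
    Measurable (Phi Q n u) :=
  (exists_gridCondExp Q n u).choose_spec.1

theorem condExp_eq_Phi (Q : Measure QuantileFun) (n : ℕ) (u : QuantileFun → ℝ) :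
    Q[u | MeasurableSpace.comap (gridEval n) inferInstance] = Phi Q n u ∘ gridEval n :=
  (exists_gridCondExp Q n u).choose_spec.2

/-- The conditional expectation of `⟨f, g⟩` given the grid values of `g` is the pairing of `f`
with the linear interpolation. -/
theorem IsDirichletLaw.Phi_pairing_ae_eq (hβ : 0 < β) (hQ : IsDirichletLaw β Q) (n : ℕ)
    {f : I01 → ℝ} (hf : MemLp f 2 volume) :
    Phi Q n (pairing f) =ᵐ[q β n] affineFun (linCoef n f) := by
  have := hQ.1
  have := hQ.isProbabilityMeasure_q n
  have hfin : IsFiniteMeasure (orderedDirichlet fun _ : Fin (n + 1) => β / ((n + 1 : ℕ) : ℝ)) :=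
    (inferInstance : IsFiniteMeasure (q β n))
  have hfi := integrable_of_memLp_two hf
  have hle : MeasurableSpace.comap (gridEval n) inferInstance ≤
      (inferInstance : MeasurableSpace QuantileFun) := (measurable_gridEval n).comap_le
  have hpi : Integrable (pairing f) Q :=
    Integrable.of_bound (continuous_pairing hf).aestronglyMeasurable _
      (ae_of_all _ fun g => abs_pairing_le hfi g)
  have hPhi : Integrable (Phi Q n (pairing f)) (q β n) := by
    rw [← hQ.map_gridEval n, integrable_map_measure (measurable_Phi _ _ _).aestronglyMeasurable
      (measurable_gridEval n).aemeasurable, ← condExp_eq_Phi]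
    exact integrable_condExp
  have haff : Continuous (affineFun (linCoef n f)) :=
    (contDiff_affineFun (m := 0) (linCoef n f)).continuous
  have haffi : Integrable (affineFun (linCoef n f)) (q β n) :=
    memLp_one_iff_integrable.1 (memLp_of_continuous _ haff)
  -- It suffices to test with smooth compactly supported `θ`: such a factor passes through the
  -- conditional expectation, and the preceding identity applies.
  refine ae_eq_of_integral_contDiff_smul_eq hPhi.locallyIntegrable haffi.locallyIntegrable
    fun θ hθ hc => ?_
  obtain ⟨K, hK⟩ := hc.exists_bound_of_continuous hθ.continuous
  have hmg := (measurable_gridEval n).aemeasurable (μ := Q)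
  have m1 : AEStronglyMeasurable (fun x => θ x • Phi Q n (pairing f) x) (Q.map (gridEval n)) :=
    (hθ.continuous.measurable.smul (measurable_Phi _ _ _)).aestronglyMeasurable
  have m2 : AEStronglyMeasurable (fun x => θ x • affineFun (linCoef n f) x) (Q.map (gridEval n)) :=
    (hθ.continuous.smul haff).aestronglyMeasurable
  rw [← hQ.map_gridEval n, integral_map hmg m1, integral_map hmg m2]
  simp only [smul_eq_mul]
  rw [hQ.integral_mul_affineFun hβ n (hθ.of_le (by simp)) hc hfi]
  have hθm : StronglyMeasurable[MeasurableSpace.comap (gridEval n) inferInstance]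
      fun g => θ (gridEval n g) :=
    (hθ.continuous.measurable.comp (comap_measurable _)).stronglyMeasurable
  have hθi : Integrable (fun g => θ (gridEval n g) * pairing f g) Q :=
    Integrable.bdd_mul hpi (c := K) (hθm.mono hle).aestronglyMeasurable (ae_of_all _ fun g => hK _)
  have h1 := condExp_mul_of_stronglyMeasurable_left (μ := Q) hθm hθi hpi
  rw [← integral_condExp hle (f := fun g => θ (gridEval n g) * pairing f g)]
  refine integral_congr_ae ?_
  rw [condExp_eq_Phi Q n (pairing f)] at h1
  exact h1.symm

end Interpolation

/-! ### Polynomial approximation in `C¹` -/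

section Weierstrass

variable {m : ℕ}

theorem contDiff_mvPolynomial_eval (P : MvPolynomial (Fin m) ℝ) {r : WithTop ℕ∞} :
    ContDiff ℝ r fun x : Fin m → ℝ => MvPolynomial.eval x P :=
  (AnalyticOnNhd.eval_mvPolynomial P).contDiff

/-- Convolution with a polynomial kernel is a polynomial. The induction runs over the kernel with
`V` arbitrary, because the factor `x i - y i` produces a term in which `y i` is absorbed into `V`.
-/
theorem exists_eval_eq_integral {V : (Fin m → ℝ) → ℝ} (hV : Continuous V) (hc : HasCompactSupport V)
    (R : MvPolynomial (Fin m) ℝ) : ∃ P : MvPolynomial (Fin m) ℝ, ∀ x : Fin m → ℝ,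
      MvPolynomial.eval x P = ∫ y, V y * MvPolynomial.eval (x - y) R := by
  induction R using MvPolynomial.induction_on generalizing V with
  | C a =>
    refine ⟨MvPolynomial.C (∫ y, V y * a), fun x => ?_⟩
    simp only [MvPolynomial.eval_C]
  | add p q hp hq =>
    obtain ⟨P, hP⟩ := hp hV hc
    obtain ⟨P', hP'⟩ := hq hV hc
    have hi : ∀ (r : MvPolynomial (Fin m) ℝ) (x : Fin m → ℝ),
        Integrable fun y => V y * MvPolynomial.eval (x - y) r := fun r x =>
      (hV.mul ((MvPolynomial.continuous_eval r).comp
        (continuous_const.sub continuous_id))).integrable_of_hasCompactSupport hc.mul_right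
    refine ⟨P + P', fun x => ?_⟩
    simp only [map_add, mul_add]
    rw [integral_add (hi p x) (hi q x), hP, hP']
  | mul_X p i hp =>
    obtain ⟨P, hP⟩ := hp hV hc
    obtain ⟨P', hP'⟩ := hp (V := fun y => V y * y i) (hV.mul (continuous_apply i)) hc.mul_right
    refine ⟨MvPolynomial.X i * P - P', fun x => ?_⟩
    have h1 : Integrable fun y => x i * (V y * MvPolynomial.eval (x - y) p) :=
      ((hV.mul ((MvPolynomial.continuous_eval p).comp
        (continuous_const.sub continuous_id))).integrable_of_hasCompactSupport
          hc.mul_right).const_mul _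
    have h2 : Integrable fun y => V y * y i * MvPolynomial.eval (x - y) p :=
      ((hV.mul (continuous_apply i)).mul ((MvPolynomial.continuous_eval p).comp
        (continuous_const.sub continuous_id))).integrable_of_hasCompactSupport
          hc.mul_right.mul_right
    rw [map_sub, map_mul, MvPolynomial.eval_X, hP, hP', ← integral_const_mul, ← integral_sub h1 h2]
    refine integral_congr_ae (ae_of_all _ fun y => ?_)
    simp only [map_mul, MvPolynomial.eval_X, Pi.sub_apply]
    ring

/-- On every ball, a `C¹` function with compact support is the limit of a sequence of polynomials,
boundedly and pointwise together with the derivatives. -/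
theorem exists_polynomial_approx {U : (Fin m → ℝ) → ℝ} (hU : ContDiff ℝ 1 U)
    (hc : HasCompactSupport U) (M : ℝ) :
    ∃ (P : ℕ → MvPolynomial (Fin m) ℝ) (B : ℝ), ∀ x : Fin m → ℝ, ‖x‖ < M →
      (∀ k, |MvPolynomial.eval x (P k)| ≤ B) ∧
      (∀ k, ‖fderiv ℝ (fun y => MvPolynomial.eval y (P k)) x‖ ≤ B) ∧
      Tendsto (fun k => MvPolynomial.eval x (P k)) atTop (𝓝 (U x)) ∧
      Tendsto (fun k => fderiv ℝ (fun y => MvPolynomial.eval y (P k)) x) atTop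
        (𝓝 (fderiv ℝ U x)) := by
  rcases le_or_gt M 0 with hM | hM
  · exact ⟨0, 0, fun x hx => absurd (hx.trans_le hM) (norm_nonneg x).not_gt⟩
  obtain ⟨A, hA⟩ := hc.isCompact.isBounded.exists_norm_le
  have hUd : Continuous (fderiv ℝ U) := hU.continuous_fderiv (by simp)
  obtain ⟨B₁, hB₁⟩ := hc.exists_bound_of_continuous hU.continuous
  obtain ⟨B₂, hB₂⟩ := (hc.fderiv ℝ).exists_bound_of_continuous hUd
  -- If `‖x‖ < M` and `x - z` lies in the support of `U`, then `‖z‖ ≤ ρ`; so restricting the kernel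
  -- to the ball of radius `ρ` loses nothing.
  set ρ : ℝ := |A| + M with hρ
  have hρ0 : 0 < ρ := by positivity
  -- A Landau-type kernel: positive on the ball, with unique maximum `1` at the origin, so its
  -- normalised powers concentrate there. The factor `m + 1` gives positivity, since the sum of
  -- squares is at most `m ρ²` in the sup norm.
  let R : MvPolynomial (Fin m) ℝ :=
    1 - MvPolynomial.C (((m : ℝ) + 1) * ρ ^ 2)⁻¹ * ∑ i, MvPolynomial.X i ^ 2
  let c : (Fin m → ℝ) → ℝ := fun z => MvPolynomial.eval z R
  have hcz : ∀ z, c z = 1 - (((m : ℝ) + 1) * ρ ^ 2)⁻¹ * ∑ i, z i ^ 2 := fun z => by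
    simp [c, R]
  have hcc : Continuous c := MvPolynomial.continuous_eval R
  let s : Set (Fin m → ℝ) := Metric.closedBall 0 ρ
  have hs : IsCompact s := isCompact_closedBall _ _
  have hc0 : c 0 = 1 := by rw [hcz]; simp
  have hcpos : ∀ z ∈ s, 0 < c z := fun z hz => by
    have hz' : ‖z‖ ≤ ρ := by simpa [s] using hz
    have h1 : ∑ i, z i ^ 2 ≤ m * ρ ^ 2 := by
      calc ∑ i, z i ^ 2 ≤ ∑ _i : Fin m, ρ ^ 2 := Finset.sum_le_sum fun i _ => by
            rw [← sq_abs]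
            exact pow_le_pow_left₀ (abs_nonneg _) ((norm_le_pi_norm z i).trans hz') 2
        _ = m * ρ ^ 2 := by simp
    rw [hcz, sub_pos, inv_mul_lt_iff₀ (by positivity)]
    nlinarith [sq_pos_of_pos hρ0]
  have hclt : ∀ z ∈ s, z ≠ 0 → c z < c 0 := fun z _ hz => by
    rw [hc0, hcz, sub_lt_self_iff]
    obtain ⟨i, hi⟩ := Function.ne_iff.1 hz
    have : 0 < ∑ i, z i ^ 2 := Finset.sum_pos' (fun i _ => sq_nonneg _)
      ⟨i, Finset.mem_univ i, sq_pos_of_ne_zero hi⟩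
    positivity
  have hcl : (0 : Fin m → ℝ) ∈ closure (interior s) :=
    subset_closure (mem_interior_iff_mem_nhds.2 (Metric.closedBall_mem_nhds _ hρ0))
  have hlim : ∀ {E : Type} [NormedAddCommGroup E] [NormedSpace ℝ E] [CompleteSpace E]
      {g : (Fin m → ℝ) → E}, Continuous g →
      Tendsto (fun k => (∫ z in s, c z ^ k)⁻¹ • ∫ z in s, c z ^ k • g z) atTop (𝓝 (g 0)) :=
    fun {E} _ _ _ g hg => tendsto_setIntegral_pow_smul_of_unique_maximum_of_isCompact_of_continuousOn
      hs hcc.continuousOn hclt (fun z hz => (hcpos z hz).le) (by rw [hc0]; exact one_pos) hcl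
      hg.continuousOn
  have hint : ∀ k, IntegrableOn (fun z => c z ^ k) s := fun k =>
    (hcc.pow k).continuousOn.integrableOn_compact hs
  have hIpos : ∀ k, 0 < ∫ z in s, c z ^ k := fun k => by
    refine (setIntegral_pos_iff_support_of_nonneg_ae ?_ (hint k)).2 ?_
    · filter_upwards [ae_restrict_mem hs.measurableSet] with z hz using (pow_pos (hcpos z hz) k).le
    · refine lt_of_lt_of_le (Metric.measure_closedBall_pos volume (0 : Fin m → ℝ) hρ0)
        (measure_mono fun z hz => ⟨(pow_pos (hcpos z hz) k).ne', hz⟩)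
  have hbd : ∀ {E : Type} [NormedAddCommGroup E] [NormedSpace ℝ E] {g : (Fin m → ℝ) → E} {B : ℝ},
      (∀ z, ‖g z‖ ≤ B) → ∀ k, ‖(∫ z in s, c z ^ k)⁻¹ • ∫ z in s, c z ^ k • g z‖ ≤ B := by
    intro E _ _ g B hB k
    rw [norm_smul, norm_inv, Real.norm_of_nonneg (hIpos k).le, inv_mul_le_iff₀ (hIpos k),
      ← integral_mul_const]
    refine norm_integral_le_of_norm_le ((hint k).mul_const B) ?_
    filter_upwards [ae_restrict_mem hs.measurableSet] with z hz
    rw [norm_smul, Real.norm_of_nonneg (pow_pos (hcpos z hz) k).le]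
    exact mul_le_mul_of_nonneg_left (hB z) (pow_pos (hcpos z hz) k).le
  have hex : ∀ k, ∃ P : MvPolynomial (Fin m) ℝ, ∀ x : Fin m → ℝ,
      MvPolynomial.eval x P = ∫ y, U y * MvPolynomial.eval (x - y) (R ^ k) := fun k =>
    exists_eval_eq_integral hU.continuous hc (R ^ k)
  choose P hP using hex
  have heq : ∀ k x, ‖x‖ < M → ∫ y, U y * MvPolynomial.eval (x - y) (R ^ k) =
      ∫ z in s, c z ^ k • U (x - z) := fun k x hx => by
    rw [setIntegral_eq_integral_of_forall_compl_eq_zero, ← integral_sub_left_eq_self _ _ x]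
    · refine integral_congr_ae (ae_of_all _ fun y => ?_)
      simp only [map_pow, sub_sub_cancel, smul_eq_mul, c]
      ring
    · intro z hz
      rw [smul_eq_mul, mul_eq_zero]
      refine Or.inr (by_contra fun h => hz ?_)
      have h1 := hA _ (subset_tsupport U h)
      have h2 : ‖z‖ ≤ ‖x‖ + ‖x - z‖ := by
        have := norm_sub_le x (x - z)
        rwa [sub_sub_cancel] at this
      have h3 := le_abs_self A
      simp only [s, mem_closedBall_zero_iff]
      linarith
  have hev : ∀ k x, ‖x‖ < M → MvPolynomial.eval x (MvPolynomial.C (∫ z in s, c z ^ k)⁻¹ * P k) =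
      (∫ z in s, c z ^ k)⁻¹ • ∫ z in s, c z ^ k • U (x - z) := fun k x hx => by
    rw [map_mul, MvPolynomial.eval_C, hP, heq k x hx, smul_eq_mul]
  have hfin : IsFiniteMeasure (volume.restrict s) := ⟨by
    rw [Measure.restrict_apply_univ]; exact hs.measure_lt_top⟩
  -- Differentiation under the integral puts the derivative on `U`, so the derivatives of the
  -- polynomials are the same averages of `fderiv ℝ U`. The formula for the polynomial holds only on
  -- the open ball, which is enough for local equality.
  have hder : ∀ k x, ‖x‖ < M →
      fderiv ℝ (fun y => MvPolynomial.eval y (MvPolynomial.C (∫ z in s, c z ^ k)⁻¹ * P k)) x =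
        (∫ z in s, c z ^ k)⁻¹ • ∫ z in s, c z ^ k • fderiv ℝ U (x - z) := fun k x hx => by
    have h1 : HasFDerivAt (fun x => ∫ z in s, c z ^ k • U (x - z))
        (∫ z in s, c z ^ k • fderiv ℝ U (x - z)) x := by
      refine hasFDerivAt_integral_of_dominated_of_fderiv_le (s := Set.univ) univ_mem
        (F' := fun x z => c z ^ k • fderiv ℝ U (x - z)) (bound := fun z => c z ^ k * B₂)
        ?_ ?_ ?_ ?_ ?_ ?_
      · exact Eventually.of_forall fun x => ((hcc.pow k).smul
          (hU.continuous.comp (continuous_const.sub continuous_id))).aestronglyMeasurable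
      · exact ((hcc.pow k).smul (hU.continuous.comp
          (continuous_const.sub continuous_id))).continuousOn.integrableOn_compact hs
      · exact ((hcc.pow k).smul
          (hUd.comp (continuous_const.sub continuous_id))).aestronglyMeasurable
      · filter_upwards [ae_restrict_mem hs.measurableSet] with z hz x _
        rw [norm_smul, Real.norm_of_nonneg (pow_pos (hcpos z hz) k).le]
        exact mul_le_mul_of_nonneg_left (hB₂ _) (pow_pos (hcpos z hz) k).le
      · exact (hint k).mul_const B₂
      · refine ae_of_all _ fun z x _ => ?_
        have h2 : HasFDerivAt (fun y => U (y - z)) (fderiv ℝ U (x - z)) x :=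
          (hasFDerivAt_comp_sub z).2 (hU.differentiable (by simp) (x - z)).hasFDerivAt
        exact h2.const_smul (c z ^ k)
    have h2 := (h1.const_smul (∫ z in s, c z ^ k)⁻¹)
    refine (h2.congr_of_eventuallyEq ?_).fderiv
    filter_upwards [(continuous_norm.tendsto x).eventually (gt_mem_nhds hx)] with y hy
    exact hev k y hy
  refine ⟨fun k => MvPolynomial.C (∫ z in s, c z ^ k)⁻¹ * P k, max B₁ B₂, fun x hx => ⟨fun k => ?_,
    fun k => ?_, ?_, ?_⟩⟩
  · rw [hev k x hx, ← Real.norm_eq_abs]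
    exact (hbd (fun z => hB₁ (x - z)) k).trans (le_max_left _ _)
  · rw [hder k x hx]
    exact (hbd (fun z => hB₂ (x - z)) k).trans (le_max_right _ _)
  · simp only [hev _ x hx]
    have := hlim (g := fun z => U (x - z)) (hU.continuous.comp (continuous_const.sub continuous_id))
    rwa [sub_zero] at this
  · simp only [hder _ x hx]
    have := hlim (g := fun z => fderiv ℝ U (x - z))
      (hUd.comp (continuous_const.sub continuous_id))
    rwa [sub_zero] at this

end Weierstrass

/-! ### The polynomials form a core -/

section Core

variable {β : ℝ} {Q : Measure QuantileFun}

theorem eLpNorm_two_sq {α V : Type*} [MeasurableSpace α] [NormedAddCommGroup V] (f : α → V)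
    (μ : Measure α) : eLpNorm f 2 μ ^ 2 = ∫⁻ x, ‖f x‖ₑ ^ 2 ∂μ := by
  have := eLpNorm_nnreal_pow_eq_lintegral (f := f) (μ := μ) (p := 2) two_ne_zero
  simpa using this

theorem eLpNorm_two_sub_lt {α : Type*} [MeasurableSpace α] {μ : Measure α} {u v w : α → ℝ}
    (hu : MemLp u 2 μ) (hv : MemLp v 2 μ) (hw : MemLp w 2 μ) {δ ε : ℝ≥0∞}
    (h1 : eLpNorm (v - u) 2 μ < δ) (h2 : eLpNorm (v - w) 2 μ < ε) :
    eLpNorm (u - w) 2 μ < δ + ε := by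
  rw [← sub_add_sub_cancel u v w]
  refine (eLpNorm_add_le (hu.sub hv).1 (hv.sub hw).1 (by norm_num)).trans_lt ?_
  rw [eLpNorm_sub_comm u v]
  exact ENNReal.add_lt_add h1 h2

theorem tendsto_eLpNorm_of_bounded {α : Type*} [MeasurableSpace α] {μ : Measure α}
    [IsFiniteMeasure μ] {a : ℕ → α → ℝ} {a' : α → ℝ} (ha : ∀ k, AEStronglyMeasurable (a k) μ)
    {M : ℝ} (hM : ∀ k x, |a k x| ≤ M) (hlim : ∀ᵐ x ∂μ, Tendsto (fun k => a k x) atTop (𝓝 (a' x))) :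
    Tendsto (fun k => eLpNorm (a k - a') 2 μ) atTop (𝓝 0) := by
  have ha' : AEStronglyMeasurable a' μ := aestronglyMeasurable_of_tendsto_ae _ ha hlim
  have h1 : Tendsto (fun k => ∫⁻ x, ‖a k x - a' x‖ₑ ^ 2 ∂μ) atTop (𝓝 (∫⁻ _, 0 ∂μ)) := by
    refine tendsto_lintegral_of_dominated_convergence' (fun _ => ENNReal.ofReal (2 * M) ^ 2)
      (fun k => ((ha k).sub ha').enorm.pow_const 2) (fun k => ?_) ?_ ?_
    · filter_upwards [hlim] with x hx
      have h2 : |a' x| ≤ M := le_of_tendsto hx.abs (Eventually.of_forall fun k => hM k x)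
      rw [← ofReal_norm]
      gcongr
      calc ‖a k x - a' x‖ ≤ |a k x| + |a' x| := norm_sub_le _ _
        _ ≤ 2 * M := by linarith [hM k x]
    · rw [lintegral_const]
      exact ENNReal.mul_ne_top (ENNReal.pow_ne_top ENNReal.ofReal_ne_top) (measure_ne_top _ _)
    · filter_upwards [hlim] with x hx
      have h2 : Tendsto (fun k => ‖a k x - a' x‖ₑ ^ 2) atTop (𝓝 (‖a' x - a' x‖ₑ ^ 2)) :=
        ((ENNReal.continuous_pow 2).comp continuous_enorm).continuousAt.tendsto.comp
          (hx.sub_const (a' x))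
      simpa using h2
  have h2 : Tendsto (fun k => eLpNorm (a k - a') 2 μ ^ 2) atTop (𝓝 0) := by
    simpa [eLpNorm_two_sq] using h1
  have h3 := (ENNReal.continuous_rpow_const (y := 1 / 2)).continuousAt.tendsto.comp h2
  simp only [Function.comp_def, ← ENNReal.rpow_natCast, ← ENNReal.rpow_mul] at h3
  simpa using h3

theorem eLpNorm_mul_prod {a : QuantileFun → ℝ} (ha : AEStronglyMeasurable a Q) {f : I01 → ℝ}
    (hf : AEStronglyMeasurable f volume) :
    eLpNorm (fun z : QuantileFun × I01 => a z.1 * f z.2) 2 (Q.prod volume) =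
      eLpNorm a 2 Q * eLpNorm f 2 volume := by
  refine (ENNReal.pow_right_strictMono two_ne_zero).injective ?_
  rw [mul_pow, eLpNorm_two_sq, eLpNorm_two_sq, eLpNorm_two_sq,
    ← lintegral_prod_mul (ha.enorm.pow_const 2) (hf.enorm.pow_const 2)]
  simp only [enorm_mul, mul_pow]

variable [IsProbabilityMeasure Q]

theorem tendsto_eLpNorm_mul_prod {a : ℕ → QuantileFun → ℝ} {a' : QuantileFun → ℝ}
    (ha : ∀ k, AEStronglyMeasurable (a k) Q) {M : ℝ} (hM : ∀ k g, |a k g| ≤ M)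
    (hlim : ∀ g, Tendsto (fun k => a k g) atTop (𝓝 (a' g))) {f : ℕ → I01 → ℝ} {f' : I01 → ℝ}
    (hf : ∀ k, MemLp (f k) 2 volume) (hf' : MemLp f' 2 volume)
    (hff : Tendsto (fun k => eLpNorm (f k - f') 2 volume) atTop (𝓝 0)) :
    Tendsto (fun k => eLpNorm (fun z : QuantileFun × I01 => a k z.1 * f k z.2 - a' z.1 * f' z.2) 2
      (Q.prod volume)) atTop (𝓝 0) := by
  have ha' : AEStronglyMeasurable a' Q :=
    aestronglyMeasurable_of_tendsto_ae _ ha (ae_of_all _ hlim)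
  have h1 := tendsto_eLpNorm_of_bounded ha hM (ae_of_all _ hlim)
  have h2 : Tendsto (fun k => ENNReal.ofReal M * eLpNorm (f k - f') 2 volume +
      eLpNorm (a k - a') 2 Q * eLpNorm f' 2 volume) atTop (𝓝 0) := by
    simpa using (ENNReal.Tendsto.const_mul hff (Or.inr ENNReal.ofReal_ne_top)).add
      (ENNReal.Tendsto.mul_const h1 (Or.inr hf'.2.ne))
  refine tendsto_of_tendsto_of_tendsto_of_le_of_le tendsto_const_nhds h2 (fun _ => zero_le)
    fun k => ?_
  -- The first term is controlled by the uniform bound on `a k`, the second by L² convergence of `a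
  -- k`; each is a product of one-variable functions, whose norm factorises.
  have h3 : (fun z : QuantileFun × I01 => a k z.1 * f k z.2 - a' z.1 * f' z.2) =
      (fun z => a k z.1 * (f k - f') z.2) + fun z => (a k - a') z.1 * f' z.2 := by
    ext z
    simp only [Pi.add_apply, Pi.sub_apply]
    ring
  have m1 : AEStronglyMeasurable (fun z : QuantileFun × I01 => a k z.1 * (f k - f') z.2)
    (Q.prod volume) := (ha k).comp_fst.mul ((hf k).sub hf').1.comp_snd
  have m2 : AEStronglyMeasurable (fun z : QuantileFun × I01 => (a k - a') z.1 * f' z.2)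
    (Q.prod volume) := ((ha k).sub ha').comp_fst.mul hf'.1.comp_snd
  rw [h3]
  refine (eLpNorm_add_le m1 m2 (by norm_num)).trans ?_
  rw [eLpNorm_mul_prod (ha k) ((hf k).sub hf').1, eLpNorm_mul_prod ((ha k).sub ha') hf'.1]
  gcongr
  refine (eLpNorm_le_of_ae_bound (C := M) (ae_of_all _ (hM k))).trans ?_
  simp

theorem tendsto_pairing {f : ℕ → I01 → ℝ} {f' : I01 → ℝ} (hf : ∀ k, MemLp (f k) 2 volume)
    (hf' : MemLp f' 2 volume) (hff : Tendsto (fun k => eLpNorm (f k - f') 2 volume) atTop (𝓝 0))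
    (g : QuantileFun) : Tendsto (fun k => pairing (f k) g) atTop (𝓝 (pairing f' g)) :=
  tendsto_integral_mul_of_tendsto_eLpNorm hf hf' g.memLp hff

/-- Convergence of cylinder functions together with their gradients. -/
theorem tendsto_eLpNorm_cylinder {m : ℕ} {U : ℕ → (Fin m → ℝ) → ℝ} {U' : (Fin m → ℝ) → ℝ}
    (hU : ∀ k, ContDiff ℝ 1 (U k)) {f : ℕ → Fin m → I01 → ℝ} {f' : Fin m → I01 → ℝ}
    (hf : ∀ k i, MemLp (f k i) 2 volume) (hf' : ∀ i, MemLp (f' i) 2 volume)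
    (hff : ∀ i, Tendsto (fun k => eLpNorm (f k i - f' i) 2 volume) atTop (𝓝 0)) {B : ℝ}
    (hB : ∀ k g, |U k fun i => pairing (f k i) g| ≤ B)
    (hB' : ∀ k g, ‖fderiv ℝ (U k) fun i => pairing (f k i) g‖ ≤ B)
    (hlim : ∀ g, Tendsto (fun k => U k fun i => pairing (f k i) g) atTop
      (𝓝 (U' fun i => pairing (f' i) g)))
    (hlim' : ∀ g, Tendsto (fun k => fderiv ℝ (U k) fun i => pairing (f k i) g) atTop
      (𝓝 (fderiv ℝ U' fun i => pairing (f' i) g))) :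
    Tendsto (fun k => eLpNorm ((fun g => U k fun i => pairing (f k i) g) -
      fun g => U' fun i => pairing (f' i) g) 2 Q) atTop (𝓝 0) ∧
    Tendsto (fun k => eLpNorm (cylGrad (U k) (f k) - cylGrad U' f') 2 (Q.prod volume))
      atTop (𝓝 0) := by
  refine ⟨tendsto_eLpNorm_of_bounded (fun k => (memLp_comp_pairings (hU k).continuous (hf k) 2).1)
    hB (ae_of_all _ hlim), ?_⟩
  have hc : ∀ k i, Continuous fun g => fderiv ℝ (U k) (fun j => pairing (f k j) g) (Pi.single i 1) :=
    fun k i => ((((hU k).continuous_fderiv (by simp)).clm_apply continuous_const).comp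
      (continuous_pairings (hf k)))
  have hap : ∀ i g, Tendsto
      (fun k => fderiv ℝ (U k) (fun j => pairing (f k j) g) (Pi.single i (1 : ℝ))) atTop
      (𝓝 (fderiv ℝ U' (fun j => pairing (f' j) g) (Pi.single i (1 : ℝ)))) := fun i g =>
    ((ContinuousLinearMap.apply ℝ ℝ (Pi.single i (1 : ℝ) : Fin m → ℝ)).continuous.tendsto _).comp
      (hlim' g)
  have h1 : ∀ i, Tendsto (fun k => eLpNorm (fun z : QuantileFun × I01 =>
      fderiv ℝ (U k) (fun j => pairing (f k j) z.1) (Pi.single i 1) * f k i z.2 -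
        fderiv ℝ U' (fun j => pairing (f' j) z.1) (Pi.single i 1) * f' i z.2) 2
      (Q.prod volume)) atTop (𝓝 0) := fun i => by
    refine tendsto_eLpNorm_mul_prod
      (a := fun k g => fderiv ℝ (U k) (fun j => pairing (f k j) g) (Pi.single i 1))
      (a' := fun g => fderiv ℝ U' (fun j => pairing (f' j) g) (Pi.single i 1))
      (f := fun k => f k i) (M := B) (fun k => (hc k i).aestronglyMeasurable) (fun k g => ?_)
      (fun g => ?_) (fun k => hf k i) (hf' i) (hff i)
    · refine ((fderiv ℝ (U k) _).le_opNorm _).trans ?_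
      rw [Pi.norm_single, norm_one, mul_one]
      exact hB' k g
    · exact hap i g
  have h2 : Tendsto (fun k => ∑ i, eLpNorm (fun z : QuantileFun × I01 =>
      fderiv ℝ (U k) (fun j => pairing (f k j) z.1) (Pi.single i 1) * f k i z.2 -
        fderiv ℝ U' (fun j => pairing (f' j) z.1) (Pi.single i 1) * f' i z.2) 2
      (Q.prod volume)) atTop (𝓝 0) := by
    simpa using tendsto_finsetSum Finset.univ fun i _ => h1 i
  refine tendsto_of_tendsto_of_tendsto_of_le_of_le tendsto_const_nhds h2 (fun _ => zero_le)
    fun k => ?_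
  have h3 : cylGrad (U k) (f k) - cylGrad U' f' = ∑ i, fun z : QuantileFun × I01 =>
      fderiv ℝ (U k) (fun j => pairing (f k j) z.1) (Pi.single i 1) * f k i z.2 -
        fderiv ℝ U' (fun j => pairing (f' j) z.1) (Pi.single i 1) * f' i z.2 := by
    ext z
    simp only [Pi.sub_apply, cylGrad, Finset.sum_apply, Finset.sum_sub_distrib]
  rw [h3]
  refine eLpNorm_sum_le (fun i _ => ?_) (by norm_num)
  have hc' : AEStronglyMeasurable
      (fun g => fderiv ℝ U' (fun j => pairing (f' j) g) (Pi.single i 1)) Q :=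
    aestronglyMeasurable_of_tendsto_ae atTop (fun k => (hc k i).aestronglyMeasurable)
      (ae_of_all _ (hap i))
  exact ((hc k i).aestronglyMeasurable.comp_fst.mul (hf k i).1.comp_snd).sub
    (hc'.comp_fst.mul (hf' i).1.comp_snd)

/-- The restriction of a continuous function on `[0,1]` to `[0,1)`. -/
def restrictI01 (f : C(Set.Icc (0 : ℝ) 1, ℝ)) (t : I01) : ℝ := f ⟨t, Set.Ico_subset_Icc_self t.2⟩

theorem continuous_restrictI01 (f : C(Set.Icc (0 : ℝ) 1, ℝ)) : Continuous (restrictI01 f) :=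
  f.continuous.comp (continuous_subtype_val.subtype_mk _)

theorem memLp_restrictI01 (f : C(Set.Icc (0 : ℝ) 1, ℝ)) : MemLp (restrictI01 f) 2 volume :=
  MemLp.of_bound (continuous_restrictI01 f).aestronglyMeasurable ‖f‖
    (ae_of_all _ fun _ => f.norm_coe_le_norm _)

/-- Bounded continuous functions on the line are dense in L² of Lebesgue measure restricted to `[0,
1)`; extending `f` by zero and restricting the approximations to `[0, 1]` transfers this. -/
theorem exists_tendsto_restrictI01 {f : I01 → ℝ} (hf : MemLp f 2 volume) :
    ∃ φ : ℕ → C(Set.Icc (0 : ℝ) 1, ℝ),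
      Tendsto (fun k => eLpNorm (restrictI01 (φ k) - f) 2 volume) atTop (𝓝 0) := by
  have hemb : MeasurableEmbedding (Subtype.val : I01 → ℝ) :=
    MeasurableEmbedding.subtype_coe measurableSet_Ico
  have hmap : Measure.map (Subtype.val : I01 → ℝ) volume = volume.restrict (Set.Ico 0 1) :=
    map_comap_subtype_coe measurableSet_Ico volume
  have hex : (Function.extend Subtype.val f 0) ∘ (Subtype.val : I01 → ℝ) = f :=
    Function.extend_comp Subtype.val_injective f 0
  have hF : MemLp (Function.extend (Subtype.val : I01 → ℝ) f 0) 2 (volume.restrict (Set.Ico 0 1)) := by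
    rw [← hmap, hemb.memLp_map_measure_iff, hex]
    exact hf
  have h1 : ∀ k : ℕ, ∃ φ : C(Set.Icc (0 : ℝ) 1, ℝ),
      eLpNorm (restrictI01 φ - f) 2 volume ≤ ((k : ℝ≥0∞) + 1)⁻¹ := fun k => by
    obtain ⟨G, hG, -⟩ := hF.exists_boundedContinuous_eLpNorm_sub_le (by norm_num)
      (ε := ((k : ℝ≥0∞) + 1)⁻¹) (by simp)
    refine ⟨⟨fun t => G t, G.continuous.comp continuous_subtype_val⟩, ?_⟩
    rw [eLpNorm_sub_comm]
    rw [← hmap, hemb.eLpNorm_map_measure] at hG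
    refine le_trans (le_of_eq ?_) hG
    congr 1
    ext t
    rw [Function.comp_apply, Pi.sub_apply, Pi.sub_apply, Subtype.val_injective.extend_apply]
    rfl
  choose φ hφ using h1
  refine ⟨φ, tendsto_of_tendsto_of_tendsto_of_le_of_le tendsto_const_nhds ?_ (fun _ => zero_le) hφ⟩
  have h2 := (tendsto_add_atTop_iff_nat 1).2 ENNReal.tendsto_inv_nat_nhds_zero
  simpa using h2

/-- The polynomial as a cylinder function. -/
theorem polyFun_mem {m : ℕ} (P : MvPolynomial (Fin m) ℝ) (f : Fin m → C(Set.Icc (0 : ℝ) 1, ℝ)) :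
    (polyFun P f, cylGrad (fun x => MvPolynomial.eval x P) fun i => restrictI01 (f i)) ∈
      cylinderGradients :=
  mem_cylinderGradients (contDiff_mvPolynomial_eval P) fun i => memLp_restrictI01 (f i)

theorem isClosureGradient_polyFun {m : ℕ} (P : MvPolynomial (Fin m) ℝ)
    (f : Fin m → C(Set.Icc (0 : ℝ) 1, ℝ)) :
    IsClosureGradient Q (Q.prod volume) cylinderGradients (polyFun P f)
      (cylGrad (fun x => MvPolynomial.eval x P) fun i => restrictI01 (f i)) :=
  .of_mem (polyFun_mem P f) (cylinderGradients_memLp (polyFun_mem P f)).1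
    (cylinderGradients_memLp (polyFun_mem P f)).2

/-- Cylinder functions are approximated by polynomials in the graph norm. -/
theorem exists_polyFun_near {p : (QuantileFun → ℝ) × (QuantileFun × I01 → ℝ)}
    (hp : p ∈ cylinderGradients) {ε : ℝ≥0∞} (hε : 0 < ε) :
    ∃ (m : ℕ) (P : MvPolynomial (Fin m) ℝ) (φ : Fin m → C(Set.Icc (0 : ℝ) 1, ℝ)),
      eLpNorm (p.1 - polyFun P φ) 2 Q < ε ∧
      eLpNorm (p.2 - cylGrad (fun x => MvPolynomial.eval x P) fun i => restrictI01 (φ i)) 2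
        (Q.prod volume) < ε := by
  obtain ⟨m, U, f, hU, hc, hf, hp1, hp2⟩ := hp
  have hp2 : p.2 = cylGrad U f := hp2
  have hUd : Continuous (fderiv ℝ U) := hU.continuous_fderiv (by simp)
  obtain ⟨B₁, hB₁⟩ := hc.exists_bound_of_continuous hU.continuous
  obtain ⟨B₂, hB₂⟩ := (hc.fderiv ℝ).exists_bound_of_continuous hUd
  have hε2 : 0 < ε / 2 := ENNReal.half_pos hε.ne'
  choose φ hφ using fun i => exists_tendsto_restrictI01 (hf i)
  have hpt : ∀ g, Tendsto (fun k i => pairing (restrictI01 (φ i k)) g) atTop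
      (𝓝 fun i => pairing (f i) g) := fun g => tendsto_pi_nhds.2 fun i =>
    tendsto_pairing (fun k => memLp_restrictI01 (φ i k)) (hf i) (hφ i) g
  -- Here `U` is kept and the test functions become continuous. The ball for the polynomial
  -- approximation depends on the chosen continuous functions, so they are fixed before `U` is
  -- replaced.
  obtain ⟨a1, a2⟩ := tendsto_eLpNorm_cylinder (Q := Q) (U := fun _ => U) (U' := U)
    (f := fun k i => restrictI01 (φ i k)) (f' := f) (fun _ => hU)
    (fun k i => memLp_restrictI01 (φ i k)) hf hφ (B := max B₁ B₂)
    (fun k g => (hB₁ _).trans (le_max_left _ _)) (fun k g => (hB₂ _).trans (le_max_right _ _))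
    (fun g => (hU.continuous.tendsto _).comp (hpt g)) (fun g => (hUd.tendsto _).comp (hpt g))
  obtain ⟨k, hk1, hk2⟩ := ((a1.eventually (gt_mem_nhds hε2)).and
    (a2.eventually (gt_mem_nhds hε2))).exists
  have hψ : ∀ i, MemLp (restrictI01 (φ i k)) 2 volume := fun i => memLp_restrictI01 (φ i k)
  obtain ⟨M, -, hM⟩ := exists_norm_pairing_le fun i => integrable_of_memLp_two (hψ i)
  obtain ⟨P, B, hP⟩ := exists_polynomial_approx hU hc (M + 1)
  have hM' : ∀ g, ‖fun i => pairing (restrictI01 (φ i k)) g‖ < M + 1 := fun g =>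
    (hM g).trans_lt (lt_add_one M)
  obtain ⟨b1, b2⟩ := tendsto_eLpNorm_cylinder (Q := Q) (U := fun l x => MvPolynomial.eval x (P l))
    (U' := U) (f := fun _ i => restrictI01 (φ i k)) (f' := fun i => restrictI01 (φ i k))
    (fun l => contDiff_mvPolynomial_eval (P l)) (fun _ => hψ) hψ (by simp) (B := B)
    (fun l g => (hP _ (hM' g)).1 l) (fun l g => (hP _ (hM' g)).2.1 l)
    (fun g => (hP _ (hM' g)).2.2.1) (fun g => (hP _ (hM' g)).2.2.2)
  obtain ⟨l, hl1, hl2⟩ := ((b1.eventually (gt_mem_nhds hε2)).and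
    (b2.eventually (gt_mem_nhds hε2))).exists
  refine ⟨m, P l, fun i => φ i k, ?_, ?_⟩
  · rw [hp1]
    rw [eLpNorm_sub_comm] at hl1
    exact (eLpNorm_two_sub_lt (memLp_comp_pairings hU.continuous hf 2)
      (memLp_comp_pairings hU.continuous hψ 2) (cylinderGradients_memLp (polyFun_mem (P l) _)).1
      hk1 hl1).trans_eq (ENNReal.add_halves ε)
  · rw [hp2]
    rw [eLpNorm_sub_comm] at hl2
    exact (eLpNorm_two_sub_lt (memLp_cylGrad hU hf) (memLp_cylGrad hU hψ)
      (cylinderGradients_memLp (polyFun_mem (P l) _)).2 hk2 hl2).trans_eq (ENNReal.add_halves ε)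

/-- The polynomials in the functionals `l_f` form a core. -/
theorem isCore_polyClass : IsCore Q polyClass := by
  constructor
  · rintro _ ⟨m, P, f, rfl⟩
    exact ⟨_, isClosureGradient_polyFun P f⟩
  · rintro u ⟨G, hG⟩ ε hε
    obtain ⟨hu, hGm, p, hp, h1, h2⟩ := hG
    -- One `δ` for the cylinder approximation and one for the polynomial, both for functions and for
    -- gradients. Only the upper bound of the energy by a closure gradient is used, so closability
    -- plays no role here.
    obtain ⟨δ, hδ, hδε⟩ : ∃ δ : ℝ≥0∞, 0 < δ ∧ (δ + δ) ^ 2 + (δ + δ) ^ 2 < ε := by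
      have hc : Continuous fun δ : ℝ≥0∞ => (δ + δ) ^ 2 + (δ + δ) ^ 2 := by fun_prop
      have h3 : ∀ᶠ δ in 𝓝[>] (0 : ℝ≥0∞), (δ + δ) ^ 2 + (δ + δ) ^ 2 < ε :=
        ((hc.tendsto' 0 0 (by simp)).eventually (gt_mem_nhds hε)).filter_mono nhdsWithin_le_nhds
      obtain ⟨δ, h4, h5⟩ := (h3.and self_mem_nhdsWithin).exists
      exact ⟨δ, h5, h4⟩
    obtain ⟨k, hk1, hk2⟩ := ((h1.eventually (gt_mem_nhds hδ)).and
      (h2.eventually (gt_mem_nhds hδ))).exists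
    obtain ⟨m, P, φ, h3, h4⟩ := exists_polyFun_near (Q := Q) (hp k) hδ
    have hpm := cylinderGradients_memLp (Q := Q) (hp k)
    have hw := isClosureGradient_polyFun (Q := Q) P φ
    have hsub := IsClosureGradient.sub cylinderGradients_sub
      (fun p hp => ⟨(cylinderGradients_memLp hp).1.1, (cylinderGradients_memLp hp).2.1⟩)
      ⟨hu, hGm, p, hp, h1, h2⟩ hw
    refine ⟨_, ⟨m, P, φ, rfl⟩, lt_of_le_of_lt (add_le_add ?_ ((formValue_le hsub).trans ?_)) hδε⟩
    · exact pow_le_pow_left₀ zero_le (eLpNorm_two_sub_lt hu hpm.1 hw.1 hk1 h3).le 2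
    · exact pow_le_pow_left₀ zero_le (eLpNorm_two_sub_lt hGm hpm.2 hw.2.1 hk2 h4).le 2

end Core

/-! ### Convergence of the interpolations -/

section GridLimits

theorem abs_convexCombination_sub_le {w a b L ε : ℝ} (h0 : 0 ≤ w) (h1 : w ≤ 1) (ha : |a - L| ≤ ε)
    (hb : |b - L| ≤ ε) : |(1 - w) * a + w * b - L| ≤ ε := by
  rw [abs_le] at *
  constructor <;> nlinarith [mul_nonneg h0 (sub_nonneg.2 h1)]

theorem tendsto_cell_div (t : I01) :
    Tendsto (fun n : ℕ => ((cell n t : ℕ) : ℝ) / ((n : ℝ) + 1)) atTop (𝓝 t) := by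
  have h1 : Tendsto (fun n : ℕ => (t : ℝ) - 1 / ((n : ℝ) + 1)) atTop (𝓝 t) := by
    simpa using (tendsto_one_div_add_atTop_nhds_zero_nat (𝕜 := ℝ)).const_sub (t : ℝ)
  refine tendsto_of_tendsto_of_tendsto_of_le_of_le h1 tendsto_const_nhds (fun n => ?_) fun n => ?_
  · have := lt_cell_add_one n t
    simp only
    rw [sub_le_iff_le_add, ← add_div, le_div_iff₀ (by positivity)]
    linarith
  · simp only
    rw [div_le_iff₀ (by positivity)]
    linarith [cell_le n t]

theorem eventually_cell_pos {t : I01} (ht : 0 < (t : ℝ)) : ∀ᶠ n in atTop, 0 < (cell n t : ℕ) := by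
  filter_upwards [(tendsto_cell_div t).eventually_const_lt ht] with n hn
  have hn' : (0 : ℝ) < (n : ℝ) + 1 := by positivity
  exact_mod_cast (div_pos_iff_of_pos_right hn').1 hn

/-- The left grid points approach `t` from below, so right continuity is not enough; positivity of
`t` makes their index eventually positive, away from the conventional value at `0`. -/
theorem tendsto_gridVal_castSucc (g : QuantileFun) {t : I01} (ht : 0 < (t : ℝ))
    (hg : ContinuousAt (g : I01 → ℝ) t) :
    Tendsto (fun n => gridVal n g (cell n t).castSucc) atTop (𝓝 (g t)) := by
  let s : ℕ → I01 := fun n => ⟨((cell n t : ℕ) : ℝ) / ((n : ℝ) + 1), by positivity, by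
    have h : ((cell n t : ℕ) : ℝ) ≤ n := by exact_mod_cast Nat.lt_succ_iff.1 (cell n t).2
    rw [div_lt_one (by positivity)]
    linarith⟩
  have hs : Tendsto s atTop (𝓝 t) := tendsto_subtype_rng.2 (tendsto_cell_div t)
  refine (hg.tendsto.comp hs).congr' ?_
  filter_upwards [eventually_cell_pos ht] with n hn
  exact (gridVal_of_eq g _ (s n) hn rfl).symm

/-- A monotone function has countably many discontinuities, and at a continuity point both
neighbouring grid values converge to `g t`. -/
theorem ae_tendsto_linVal (g : QuantileFun) :
    ∀ᵐ t : I01, Tendsto (fun n => linVal n g t) atTop (𝓝 (g t)) := by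
  have hc : ∀ᵐ t : I01, ContinuousAt (g : I01 → ℝ) t := by
    rw [ae_iff]
    exact g.mono.countable_not_continuousAt.measure_zero _
  filter_upwards [hc, ae_pos_I01] with t h1 ht
  rw [Metric.tendsto_atTop']
  intro ε hε
  obtain ⟨N, hN⟩ := eventually_atTop.1 (((Metric.tendsto_nhds.1 (tendsto_gridVal_castSucc g ht h1))
    (ε / 2) (half_pos hε)).and ((Metric.tendsto_nhds.1 (tendsto_gridVal_succ g t))
    (ε / 2) (half_pos hε)))
  refine ⟨N, fun n hn => ?_⟩
  obtain ⟨h2, h3⟩ := hN n hn.le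
  exact (abs_convexCombination_sub_le (frac_nonneg n t) (frac_lt_one n t).le h2.le h3.le).trans_lt
    (half_lt_self hε)

theorem tendsto_affineFun_linCoef {f : I01 → ℝ} (hf : Integrable f) (g : QuantileFun) :
    Tendsto (fun n => affineFun (linCoef n f) (gridEval n g)) atTop (𝓝 (pairing f g)) := by
  simp only [affineFun_linCoef_gridEval hf]
  exact tendsto_integral_mul_comp hf continuous_id
    (fun n => (measurable_linVal n).comp measurable_prodMk_left) (fun n t => linVal_mem_Icc n g t)
    (ae_tendsto_linVal g)

theorem abs_affineFun_linCoef_le {f : I01 → ℝ} (hf : Integrable f) (n : ℕ) (g : QuantileFun) :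
    |affineFun (linCoef n f) (gridEval n g)| ≤ ∫ t, |f t| := by
  rw [affineFun_linCoef_gridEval hf]
  refine (abs_integral_mul_le hf (M := 1) fun t => ?_).trans_eq (mul_one _)
  rw [abs_of_nonneg (linVal_mem_Icc n g t).1]
  exact (linVal_mem_Icc n g t).2

/-! ### Hat functions and the limit of the rescaled Gram matrices. -/

/-- Integration over a grid cell. -/
theorem integral_cell_frac (n : ℕ) (j : Fin (n + 1)) (φ : ℝ → ℝ) :
    ∫ t, (if j = cell n t then φ (frac n t) else 0) = ((n : ℝ) + 1)⁻¹ * ∫ x in (0 : ℝ)..1, φ x := by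
  have hn : (0 : ℝ) < (n : ℝ) + 1 := by positivity
  have hj : ((j : ℕ) : ℝ) + 1 ≤ (n : ℝ) + 1 := by exact_mod_cast j.2
  set a : ℝ := ((j : ℕ) : ℝ) / ((n : ℝ) + 1) with ha
  set b : ℝ := (((j : ℕ) : ℝ) + 1) / ((n : ℝ) + 1) with hb
  have hab : a ≤ b := by rw [ha, hb]; gcongr; linarith
  have h1 : ∀ t : I01, (if j = cell n t then φ (frac n t) else 0) =
      (Set.Ico a b).indicator (fun x => φ (((n : ℝ) + 1) * x - (j : ℕ))) (t : ℝ) := fun t => by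
    have hiff : (t : ℝ) ∈ Set.Ico a b ↔ j = cell n t := by
      rw [Set.mem_Ico, ha, hb, div_le_iff₀ hn, lt_div_iff₀ hn, mul_comm, Fin.ext_iff]
      exact (Nat.floor_eq_iff (mul_nonneg hn.le t.2.1)).symm.trans eq_comm
    by_cases h : j = cell n t
    · rw [if_pos h, Set.indicator_of_mem (hiff.2 h), frac, ← h]
    · rw [if_neg h, Set.indicator_of_notMem (fun h' => h (hiff.1 h'))]
  simp only [h1]
  refine (integral_subtype_comap (μ := volume) measurableSet_Ico _).trans ?_
  have h2 : Set.Ico (0 : ℝ) 1 ∩ Set.Ico a b = Set.Ico a b := by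
    refine Set.inter_eq_right.2 (Set.Ico_subset_Ico (by positivity) ?_)
    rw [hb]
    exact (div_le_one hn).2 hj
  rw [setIntegral_indicator measurableSet_Ico, h2, integral_Ico_eq_integral_Ioc,
    ← intervalIntegral.integral_of_le hab, intervalIntegral.integral_comp_mul_sub φ hn.ne',
    smul_eq_mul, ha, hb, mul_div_cancel₀ _ hn.ne', mul_div_cancel₀ _ hn.ne', sub_self,
    add_sub_cancel_left]

/-- The piecewise linear function with value `1` at the grid point `k` and `0` at the others. -/
def hat (n : ℕ) (k : Fin (n + 2)) (t : I01) : ℝ :=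
  (1 - frac n t) * (if k = (cell n t).castSucc then 1 else 0) +
    frac n t * (if k = (cell n t).succ then 1 else 0)

theorem hat_nonneg (n : ℕ) (k : Fin (n + 2)) (t : I01) : 0 ≤ hat n k t := by
  have h1 := frac_nonneg n t
  have h2 := (frac_lt_one n t).le
  refine add_nonneg (mul_nonneg (by linarith) ?_) (mul_nonneg h1 ?_) <;> split_ifs <;> norm_num

theorem hat_le_one (n : ℕ) (k : Fin (n + 2)) (t : I01) : hat n k t ≤ 1 := by
  have h1 := frac_nonneg n t
  have h2 := (frac_lt_one n t).le
  rw [hat]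
  split_ifs <;> linarith

theorem measurable_hat (n : ℕ) (k : Fin (n + 2)) : Measurable (hat n k) :=
  ((measurable_const.sub (measurable_frac n)).mul ((measurable_of_finite
    fun i : Fin (n + 1) => if k = i.castSucc then (1 : ℝ) else 0).comp (measurable_cell n))).add
  ((measurable_frac n).mul ((measurable_of_finite
    fun i : Fin (n + 1) => if k = i.succ then (1 : ℝ) else 0).comp (measurable_cell n)))

theorem integrable_hat (n : ℕ) (k : Fin (n + 2)) : Integrable (hat n k) :=
  Integrable.of_bound (measurable_hat n k).aestronglyMeasurable 1 (ae_of_all _ fun t => by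
    rw [Real.norm_of_nonneg (hat_nonneg n k t)]; exact hat_le_one n k t)

theorem linCoef_eq_integral_hat {f : I01 → ℝ} (hf : Integrable f) (n : ℕ) (k : Fin (n + 2)) :
    linCoef n f k = ∫ t, f t * hat n k t := by
  have := sum_linCoef_mul hf n (fun l => if k = l then 1 else 0)
  simpa [hat] using this

theorem abs_sub_le_of_hat_ne_zero {n : ℕ} {k : Fin (n + 2)} {t : I01} (h : hat n k t ≠ 0) :
    |(t : ℝ) - ((k : ℕ) : ℝ) / ((n : ℝ) + 1)| ≤ 1 / ((n : ℝ) + 1) := by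
  have hn : (0 : ℝ) < (n : ℝ) + 1 := by positivity
  have h1 := cell_le n t
  have h2 := (lt_cell_add_one n t).le
  have h3 : (t : ℝ) - ((k : ℕ) : ℝ) / ((n : ℝ) + 1) =
      (((n : ℝ) + 1) * t - ((k : ℕ) : ℝ)) / ((n : ℝ) + 1) := by field_simp
  rw [h3, abs_div, abs_of_pos hn]
  gcongr
  have hk : k = (cell n t).castSucc ∨ k = (cell n t).succ := by
    by_contra! hk
    exact h (by rw [hat, if_neg hk.1, if_neg hk.2]; ring)
  rcases hk with rfl | rfl
  · rw [Fin.val_castSucc, abs_le]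
    constructor <;> linarith
  · rw [Fin.val_succ, abs_le]
    push_cast
    constructor <;> linarith

/-- An interior hat rises on one cell and falls on the next, each half contributing `1 / (2 (n +
1))`. -/
theorem integral_hat (n : ℕ) (i : Fin n) : ∫ t, hat n i.castSucc.succ t = ((n : ℝ) + 1)⁻¹ := by
  have h1 : ∀ t, hat n i.castSucc.succ t = (if i.succ = cell n t then 1 - frac n t else 0) +
      (if i.castSucc = cell n t then frac n t else 0) := fun t => by
    rw [hat, ← Fin.castSucc_succ]
    simp only [Fin.castSucc_inj]
    rw [Fin.castSucc_succ]
    simp only [Fin.succ_inj, mul_ite, mul_one, mul_zero]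
  have hi : ∀ (j : Fin (n + 1)) {φ : ℝ → ℝ}, Continuous φ →
      Integrable fun t => if j = cell n t then φ (frac n t) else 0 := fun j φ hφ => by
    obtain ⟨K, hK⟩ := (isCompact_Icc (a := (0 : ℝ)) (b := 1)).exists_bound_of_continuousOn
      hφ.continuousOn
    have hm : Measurable fun t => if j = cell n t then φ (frac n t) else 0 :=
      Measurable.ite ((measurable_cell n) (MeasurableSet.of_discrete (s := {l | j = l})))
        (hφ.measurable.comp (measurable_frac n)) measurable_const
    refine Integrable.of_bound hm.aestronglyMeasurable K (ae_of_all _ fun t => ?_)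
    have h2 := hK _ ⟨frac_nonneg n t, (frac_lt_one n t).le⟩
    split_ifs
    · exact h2
    · rw [norm_zero]
      exact (norm_nonneg _).trans h2
  simp only [h1]
  rw [integral_add (hi i.succ (φ := fun x => 1 - x) (by fun_prop))
    (hi i.castSucc (φ := fun x => x) continuous_id),
    integral_cell_frac n i.succ fun x => 1 - x, integral_cell_frac n i.castSucc fun x => x]
  rw [intervalIntegral.integral_sub (by simp) (by simp)]
  simp
  ring

/-- The rescaled coefficient is an average of `h` against a probability density supported within one
mesh width of the grid point. -/
theorem abs_linCoef_sub_le {h : I01 → ℝ} (hh : Integrable h) (n : ℕ) (i : Fin n) {c ε : ℝ}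
    (hε : ∀ s : I01, |(s : ℝ) - ((i.castSucc.succ : ℕ) : ℝ) / ((n : ℝ) + 1)| ≤ 1 / ((n : ℝ) + 1) →
      |h s - c| ≤ ε) :
    |((n : ℝ) + 1) * linCoef n h i.castSucc.succ - c| ≤ ε := by
  have hn : (0 : ℝ) < (n : ℝ) + 1 := by positivity
  set k := i.castSucc.succ with hk
  have i1 : Integrable fun t => h t * hat n k t :=
    hh.mul_bdd (c := 1) (measurable_hat n k).aestronglyMeasurable (ae_of_all _ fun t => by
      rw [Real.norm_of_nonneg (hat_nonneg n k t)]; exact hat_le_one n k t)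
  have i2 : Integrable fun t => c * hat n k t := (integrable_hat n k).const_mul c
  have h1 : ((n : ℝ) + 1) * linCoef n h k - c =
      ((n : ℝ) + 1) * ∫ t, (h t * hat n k t - c * hat n k t) := by
    rw [integral_sub i1 i2, integral_const_mul, linCoef_eq_integral_hat hh, hk, integral_hat]
    field_simp
  have h2 : |∫ t, (h t * hat n k t - c * hat n k t)| ≤ ε * ((n : ℝ) + 1)⁻¹ := by
    rw [← integral_hat n i, ← integral_const_mul, ← Real.norm_eq_abs]
    refine norm_integral_le_of_norm_le ((integrable_hat n k).const_mul ε) (ae_of_all _ fun t => ?_)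
    rw [← sub_mul, norm_mul, Real.norm_of_nonneg (hat_nonneg n k t)]
    rcases eq_or_ne (hat n k t) 0 with h0 | h0
    · rw [h0, mul_zero, mul_zero]
    · exact mul_le_mul_of_nonneg_right (hε t (abs_sub_le_of_hat_ne_zero h0)) (hat_nonneg n k t)
  rw [h1, abs_mul, abs_of_pos hn]
  calc ((n : ℝ) + 1) * |∫ t, (h t * hat n k t - c * hat n k t)|
      ≤ ((n : ℝ) + 1) * (ε * ((n : ℝ) + 1)⁻¹) := by gcongr
    _ = ε := by field_simp

/-- The rescaled coefficients of `l_f` and `l_h` on the grid have inner products converging to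
that of `f` and `h`. -/
theorem tendsto_sum_linCoef_mul {f h : I01 → ℝ} (hf : Integrable f) (hh : Continuous h) {C : ℝ}
    (hC : ∀ t, |h t| ≤ C) :
    Tendsto (fun n : ℕ => ((n : ℝ) + 1) *
      ∑ i : Fin n, linCoef n f i.castSucc.succ * linCoef n h i.castSucc.succ) atTop
      (𝓝 (∫ t, f t * h t)) := by
  have hC0 : 0 ≤ C := (abs_nonneg _).trans (hC ⟨0, by simp⟩)
  have hhi : Integrable h :=
    Integrable.of_bound hh.aestronglyMeasurable C (ae_of_all _ hC)
  -- Rescaled coefficients of `h`, set to `0` at the two ends because the sum runs over interior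
  -- indices only. The sum then equals the pairing of `f` with their linear interpolation `J`, and
  -- it remains to see that `J → h` boundedly a.e.
  let y : (n : ℕ) → Fin (n + 2) → ℝ := fun n =>
    zeroEnds fun i : Fin n => ((n : ℝ) + 1) * linCoef n h i.castSucc.succ
  let J : ℕ → I01 → ℝ := fun n t =>
    (1 - frac n t) * y n (cell n t).castSucc + frac n t * y n (cell n t).succ
  have hJ : ∀ n : ℕ, ((n : ℝ) + 1) *
      ∑ i : Fin n, linCoef n f i.castSucc.succ * linCoef n h i.castSucc.succ =
        ∫ t, f t * J n t := fun n => by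
    rw [← sum_linCoef_mul hf n (y n), Fin.sum_univ_succ, Fin.sum_univ_castSucc, Finset.mul_sum]
    simp only [y, Fin.succ_last, zeroEnds_zero, zeroEnds_last, zeroEnds_mid, mul_zero, zero_add,
      add_zero]
    exact Finset.sum_congr rfl fun i _ => by ring
  have hy : ∀ n k, |y n k| ≤ C := fun n k => by
    induction k using ends_cases with
    | h0 => simpa [y] using hC0
    | hl => simpa [y] using hC0
    | hm i =>
      simp only [y, zeroEnds_mid]
      have := abs_linCoef_sub_le hhi n i (c := 0) (ε := C) fun s _ => by simpa using hC s
      simpa using this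
  have hJC : ∀ n t, |J n t| ≤ C := fun n t => by
    have := abs_convexCombination_sub_le (L := 0) (frac_nonneg n t) (frac_lt_one n t).le
      (by simpa using hy n (cell n t).castSucc) (by simpa using hy n (cell n t).succ)
    simpa using this
  have hJm : ∀ n, Measurable (J n) := fun n =>
    ((measurable_const.sub (measurable_frac n)).mul ((measurable_of_finite
      fun i : Fin (n + 1) => y n i.castSucc).comp (measurable_cell n))).add
    ((measurable_frac n).mul ((measurable_of_finite
      fun i : Fin (n + 1) => y n i.succ).comp (measurable_cell n)))
  have hlim : ∀ᵐ t : I01, Tendsto (fun n => J n t) atTop (𝓝 (h t)) := by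
    filter_upwards [ae_pos_I01] with t ht
    rw [Metric.tendsto_nhds]
    intro ε hε
    obtain ⟨δ, hδ, hδε⟩ := Metric.continuous_iff.1 hh t (ε / 2) (half_pos hε)
    have hN := tendsto_one_div_add_atTop_nhds_zero_nat (𝕜 := ℝ)
    -- For `0 < t < 1` and large `n` both corners of the cell are interior, so the artificial zeros
    -- at the ends are not seen. The half of `δ` allows for two mesh widths: from `s` to the grid
    -- point and from there to `t`.
    filter_upwards [hN.eventually_lt_const (half_pos hδ), eventually_cell_pos ht,
      hN.eventually_lt_const (sub_pos.2 t.2.2)] with n h1 h2 h3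
    have hn : (0 : ℝ) < (n : ℝ) + 1 := by positivity
    have h4 := cell_le n t
    have h5 := (lt_cell_add_one n t).le
    have h6 : (cell n t : ℕ) < n := by
      rw [div_lt_iff₀ hn] at h3
      have : ((cell n t : ℕ) : ℝ) < n := by linarith
      exact_mod_cast this
    have key : ∀ k : Fin (n + 2), k ≠ 0 → k ≠ Fin.last (n + 1) →
        |((k : ℕ) : ℝ) - ((n : ℝ) + 1) * t| ≤ 1 → |y n k - h t| ≤ ε / 2 := by
      intro k hk0 hkl hkt
      induction k using ends_cases with
      | h0 => exact absurd rfl hk0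
      | hl => exact absurd rfl hkl
      | hm i =>
        simp only [y, zeroEnds_mid]
        refine abs_linCoef_sub_le hhi n i fun s hs => (hδε s ?_).le
        have h7 : |((i.castSucc.succ : ℕ) : ℝ) / ((n : ℝ) + 1) - t| ≤ 1 / ((n : ℝ) + 1) := by
          have h8 : ((i.castSucc.succ : ℕ) : ℝ) / ((n : ℝ) + 1) - t =
              (((i.castSucc.succ : ℕ) : ℝ) - ((n : ℝ) + 1) * t) / ((n : ℝ) + 1) := by field_simp
          rw [h8, abs_div, abs_of_pos hn]
          gcongr
        calc dist s t = |(s : ℝ) - t| := rfl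
          _ ≤ _ := abs_sub_le (s : ℝ) (((i.castSucc.succ : ℕ) : ℝ) / ((n : ℝ) + 1)) t
          _ < δ := by linarith
    refine (abs_convexCombination_sub_le (frac_nonneg n t) (frac_lt_one n t).le
      (key _ ?_ ?_ ?_) (key _ ?_ ?_ ?_)).trans_lt (half_lt_self hε)
    · exact fun h => h2.ne' (by simpa using congrArg Fin.val h)
    · exact (Fin.castSucc_lt_last _).ne
    · rw [Fin.val_castSucc, abs_le]
      constructor <;> linarith
    · exact Fin.succ_ne_zero _
    · intro h
      have h9 := congrArg Fin.val h
      simp only [Fin.val_succ, Fin.val_last] at h9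
      omega
    · rw [Fin.val_succ, abs_le]
      push_cast
      constructor <;> linarith
  simp only [hJ]
  refine tendsto_integral_of_dominated_convergence (fun t => |f t| * C)
    (fun n => (hf.1.mul (hJm n).aestronglyMeasurable)) (hf.abs.mul_const C)
    (fun n => ae_of_all _ fun t => ?_) ?_
  · rw [norm_mul]
    exact mul_le_mul_of_nonneg_left (hJC n t) (abs_nonneg _)
  · filter_upwards [hlim] with t ht using ht.const_mul (f t)

end GridLimits

/-! ### The approximating polynomials -/

section Approximation

variable {β : ℝ} {Q : Measure QuantileFun} {m : ℕ}

/-- The polynomial in the pairings with the linear interpolation of the grid values. -/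
def gridPoly (P : MvPolynomial (Fin m) ℝ) (f : Fin m → C(Set.Icc (0 : ℝ) 1, ℝ)) (n : ℕ)
    (x : EuclideanSpace ℝ (Fin n)) : ℝ :=
  MvPolynomial.eval (fun i => affineFun (linCoef n (restrictI01 (f i))) x) P

theorem contDiff_gridPoly (P : MvPolynomial (Fin m) ℝ) (f : Fin m → C(Set.Icc (0 : ℝ) 1, ℝ))
    (n : ℕ) : ContDiff ℝ ∞ (gridPoly P f n) :=
  (contDiff_mvPolynomial_eval P).comp (contDiff_pi.2 fun _ => contDiff_affineFun _)

theorem integrable_restrictI01 (f : C(Set.Icc (0 : ℝ) 1, ℝ)) : Integrable (restrictI01 f) :=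
  integrable_of_memLp_two (memLp_restrictI01 f)

theorem IsDirichletLaw.polyApprox_ae_eq (hβ : 0 < β) (hQ : IsDirichletLaw β Q)
    (P : MvPolynomial (Fin m) ℝ) (f : Fin m → C(Set.Icc (0 : ℝ) 1, ℝ)) (n : ℕ) :
    polyApprox Q P f n =ᵐ[q β n] gridPoly P f n := by
  filter_upwards [ae_all_iff.2 fun i => hQ.Phi_pairing_ae_eq hβ n (memLp_restrictI01 (f i))]
    with x hx
  simp only [polyApprox, gridPoly, ← hx]
  rfl

theorem IsDirichletLaw.memLp_gridPoly (hQ : IsDirichletLaw β Q)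
    (P : MvPolynomial (Fin m) ℝ) (f : Fin m → C(Set.Icc (0 : ℝ) 1, ℝ)) (n : ℕ) :
    MemLp (gridPoly P f n) 2 (q β n) := by
  have := hQ.isProbabilityMeasure_q n
  have hfin : IsFiniteMeasure (orderedDirichlet fun _ : Fin (n + 1) => β / ((n + 1 : ℕ) : ℝ)) :=
    (inferInstance : IsFiniteMeasure (q β n))
  exact memLp_of_continuous _ (contDiff_gridPoly P f n).continuous

/-- `Phi` is determined only up to null sets; the smooth representative `gridPoly` lies in the
defining class, so its classical gradient serves. -/
theorem IsDirichletLaw.isClosureGradient_polyApprox (hβ : 0 < β) (hQ : IsDirichletLaw β Q)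
    (P : MvPolynomial (Fin m) ℝ) (f : Fin m → C(Set.Icc (0 : ℝ) 1, ℝ)) (n : ℕ) :
    IsClosureGradient (q β n) (q β n) (smoothGradients n) (polyApprox Q P f n)
      fun x => gradient (gridPoly P f n) x := by
  have := hQ.isProbabilityMeasure_q n
  have hfin : IsFiniteMeasure (orderedDirichlet fun _ : Fin (n + 1) => β / ((n + 1 : ℕ) : ℝ)) :=
    (inferInstance : IsFiniteMeasure (q β n))
  have hmem : (gridPoly P f n, fun x => gradient (gridPoly P f n) x) ∈ smoothGradients n :=
    ⟨contDiff_gridPoly P f n, rfl⟩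
  refine (IsClosureGradient.of_mem hmem (hQ.memLp_gridPoly P f n) ?_).congr (hQ.polyApprox_ae_eq hβ P f n).symm
  exact memLp_of_continuous _ (continuous_gradient ((contDiff_gridPoly P f n).of_le (by simp)))

theorem exists_norm_affineFun_le (f : Fin m → C(Set.Icc (0 : ℝ) 1, ℝ)) : ∃ M : ℝ, ∀ n g,
    ‖fun i => affineFun (linCoef n (restrictI01 (f i))) (gridEval n g)‖ ≤ M := by
  have hnn : ∀ i, 0 ≤ ∫ t, |restrictI01 (f i) t| := fun i => integral_nonneg fun _ => abs_nonneg _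
  refine ⟨∑ i, ∫ t, |restrictI01 (f i) t|, fun n g => ?_⟩
  refine (pi_norm_le_iff_of_nonneg (Finset.sum_nonneg fun i _ => hnn i)).2 fun i => ?_
  exact (abs_affineFun_linCoef_le (integrable_restrictI01 (f i)) n g).trans
    (Finset.single_le_sum (f := fun i => ∫ t, |restrictI01 (f i) t|) (fun i _ => hnn i)
      (Finset.mem_univ i))

theorem tendsto_affineFuns (f : Fin m → C(Set.Icc (0 : ℝ) 1, ℝ)) (g : QuantileFun) :
    Tendsto (fun n i => affineFun (linCoef n (restrictI01 (f i))) (gridEval n g)) atTop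
      (𝓝 fun i => pairing (restrictI01 (f i)) g) :=
  tendsto_pi_nhds.2 fun i => tendsto_affineFun_linCoef (integrable_restrictI01 (f i)) g

/-- On the grid, `Φ^N u - u_N` is the conditional expectation of `u - u_N(g(1/N), …)`. By
contractivity its norm is at most that of this difference, which tends to `0` by bounded
convergence; the constant sequence `u` is the witness. -/
theorem IsDirichletLaw.strongConv_polyApprox (hβ : 0 < β) (hQ : IsDirichletLaw β Q)
    (P : MvPolynomial (Fin m) ℝ) (f : Fin m → C(Set.Icc (0 : ℝ) 1, ℝ)) :
    StrongConv β Q (polyApprox Q P f) (polyFun P f) := by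
  have := hQ.1
  set u := polyFun P f with hu_def
  have hu : MemLp u 2 Q := (isClosureGradient_polyFun P f).1
  have hPc : Continuous fun x : Fin m → ℝ => MvPolynomial.eval x P := MvPolynomial.continuous_eval P
  obtain ⟨M, hM⟩ := exists_norm_affineFun_le f
  obtain ⟨K, hK⟩ := (isCompact_closedBall (0 : Fin m → ℝ) M).exists_bound_of_continuousOn
    hPc.continuousOn
  have hWm : ∀ n, Measurable fun g => gridPoly P f n (gridEval n g) := fun n =>
    (contDiff_gridPoly P f n).continuous.measurable.comp (measurable_gridEval n)
  have hWK : ∀ n g, |gridPoly P f n (gridEval n g)| ≤ K := fun n g =>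
    hK _ (mem_closedBall_zero_iff.2 (hM n g))
  have hW := tendsto_eLpNorm_of_bounded (μ := Q) (a := fun n g => gridPoly P f n (gridEval n g))
    (a' := u) (fun n => (hWm n).aestronglyMeasurable) hWK
    (ae_of_all _ fun g => (hPc.tendsto _).comp (tendsto_affineFuns f g))
  have hle : ∀ n, eLpNorm (Phi Q n u - polyApprox Q P f n) 2 (q β n) ≤
      eLpNorm ((fun g => gridPoly P f n (gridEval n g)) - u) 2 Q := fun n => by
    have hm : MeasurableSpace.comap (gridEval n) inferInstance ≤
      (inferInstance : MeasurableSpace QuantileFun) := (measurable_gridEval n).comap_le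
    have hWi : Integrable (fun g => gridPoly P f n (gridEval n g)) Q :=
      Integrable.of_bound (hWm n).aestronglyMeasurable K (ae_of_all _ (hWK n))
    have hWs : StronglyMeasurable[MeasurableSpace.comap (gridEval n) inferInstance]
        fun g => gridPoly P f n (gridEval n g) :=
      ((contDiff_gridPoly P f n).continuous.measurable.comp
        (comap_measurable _)).stronglyMeasurable
    have h1 : Phi Q n u - polyApprox Q P f n =ᵐ[q β n] Phi Q n u - gridPoly P f n :=
      EventuallyEq.rfl.sub (hQ.polyApprox_ae_eq hβ P f n)
    have h2 : (Phi Q n u - gridPoly P f n) ∘ gridEval n =ᵐ[Q]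
        Q[u - fun g => gridPoly P f n (gridEval n g) |
          MeasurableSpace.comap (gridEval n) inferInstance] := by
      refine EventuallyEq.trans (Eq.eventuallyEq ?_)
        (condExp_sub (hu.integrable (by norm_num)) hWi _).symm
      rw [condExp_eq_Phi, condExp_of_stronglyMeasurable hm hWs hWi]
      rfl
    rw [eLpNorm_congr_ae h1, ← hQ.map_gridEval n, eLpNorm_map_measure
      ((measurable_Phi Q n u).sub (contDiff_gridPoly P f n).continuous.measurable).aestronglyMeasurable
      (measurable_gridEval n).aemeasurable, eLpNorm_congr_ae h2, eLpNorm_sub_comm]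
    exact eLpNorm_condExp_le_eLpNorm _ (by norm_num)
  refine ⟨hu, fun n => (memLp_congr_ae (hQ.polyApprox_ae_eq hβ P f n)).2 (hQ.memLp_gridPoly P f n),
    fun _ => u, fun _ => hu, by simp, ?_⟩
  have h3 : Tendsto (fun n => eLpNorm (Phi Q n u - polyApprox Q P f n) 2 (q β n)) atTop (𝓝 0) :=
    tendsto_of_tendsto_of_tendsto_of_le_of_le tendsto_const_nhds hW (fun _ => zero_le) hle
  simp only [h3.limsup_eq]
  exact tendsto_const_nhds

/-- The quadratic form in the gradient of a polynomial. -/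
def gradForm (P : MvPolynomial (Fin m) ℝ) (z : (Fin m → ℝ) × (Fin m → Fin m → ℝ)) : ℝ :=
  ∑ i, ∑ k, fderiv ℝ (fun x => MvPolynomial.eval x P) z.1 (Pi.single i 1) *
    fderiv ℝ (fun x => MvPolynomial.eval x P) z.1 (Pi.single k 1) * z.2 i k

theorem continuous_gradForm (P : MvPolynomial (Fin m) ℝ) : Continuous (gradForm P) := by
  have h1 : ∀ i, Continuous fun x : Fin m → ℝ =>
      fderiv ℝ (fun x => MvPolynomial.eval x P) x (Pi.single i 1) := fun i =>
    ((contDiff_mvPolynomial_eval P (r := 1)).continuous_fderiv (by simp)).clm_apply continuous_const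
  refine continuous_finsetSum _ fun i _ => continuous_finsetSum _ fun k _ => ?_
  refine (((h1 i).comp continuous_fst).mul ((h1 k).comp continuous_fst)).mul ?_
  exact (continuous_apply k).comp ((continuous_apply i).comp continuous_snd)

theorem clm_apply_eq_sum (T : (Fin m → ℝ) →L[ℝ] ℝ) (v : Fin m → ℝ) :
    T v = ∑ i, T (Pi.single i 1) * v i := by
  have h : v = ∑ i, v i • (Pi.single i 1 : Fin m → ℝ) := by
    simpa using pi_eq_sum_univ' v
  conv_lhs => rw [h]
  simp [mul_comm]

/-- By the chain rule the gradient is the combination of the interior coefficient vectors with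
weights `∂ᵢP`; the end points are fixed and contribute nothing. -/
theorem sq_norm_gradient_gridPoly (P : MvPolynomial (Fin m) ℝ)
    (f : Fin m → C(Set.Icc (0 : ℝ) 1, ℝ)) (n : ℕ) (x : EuclideanSpace ℝ (Fin n)) :
    ((n : ℝ) + 1) * ‖gradient (gridPoly P f n) x‖ ^ 2 =
      gradForm P (fun i => affineFun (linCoef n (restrictI01 (f i))) x,
        fun i k => ((n : ℝ) + 1) * ∑ j : Fin n, linCoef n (restrictI01 (f i)) j.castSucc.succ *
          linCoef n (restrictI01 (f k)) j.castSucc.succ) := by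
  have h1 : ∀ j : Fin n, gradient (gridPoly P f n) x j =
      ∑ i, fderiv ℝ (fun x => MvPolynomial.eval x P)
        (fun i => affineFun (linCoef n (restrictI01 (f i))) x) (Pi.single i 1) *
          linCoef n (restrictI01 (f i)) j.castSucc.succ := fun j => by
    have h2 : ∀ c : Fin (n + 2) → ℝ, affineCLM c (EuclideanSpace.single j 1) = c j.castSucc.succ :=
      fun c => by
        rw [affineCLM_apply, Fin.sum_univ_succ, Fin.sum_univ_castSucc]
        simp only [Fin.succ_last, zeroEnds_zero, zeroEnds_last, zeroEnds_mid, mul_zero, zero_add,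
          add_zero]
        simp
    have h3 : fderiv ℝ (gridPoly P f n) x = _ := (hasFDerivAt_comp_affineFun
      (contDiff_mvPolynomial_eval P) (fun i => linCoef n (restrictI01 (f i))) x).fderiv
    rw [gradient_apply, h3, ContinuousLinearMap.comp_apply, clm_apply_eq_sum]
    simp only [ContinuousLinearMap.pi_apply, h2]
  rw [EuclideanSpace.real_norm_sq_eq, gradForm]
  simp only [h1, sq, Finset.sum_mul_sum]
  simp only [Finset.mul_sum]
  rw [Finset.sum_comm]
  refine Finset.sum_congr rfl fun i _ => ?_
  rw [Finset.sum_comm]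
  refine Finset.sum_congr rfl fun k _ => Finset.sum_congr rfl fun j _ => ?_
  ring

theorem integral_sq_cylGrad (P : MvPolynomial (Fin m) ℝ) (f : Fin m → C(Set.Icc (0 : ℝ) 1, ℝ))
    (g : QuantileFun) :
    ∫ t, cylGrad (fun x => MvPolynomial.eval x P) (fun i => restrictI01 (f i)) (g, t) ^ 2 =
      gradForm P (fun i => pairing (restrictI01 (f i)) g,
        fun i k => ∫ t, restrictI01 (f i) t * restrictI01 (f k) t) := by
  have hi : ∀ i k, Integrable fun t => restrictI01 (f i) t * restrictI01 (f k) t := fun i k =>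
    (memLp_restrictI01 (f i)).integrable_mul (memLp_restrictI01 (f k))
  set a : Fin m → ℝ := fun i => fderiv ℝ (fun x => MvPolynomial.eval x P)
    (fun i => pairing (restrictI01 (f i)) g) (Pi.single i 1) with ha
  have h : ∀ t, cylGrad (fun x => MvPolynomial.eval x P) (fun i => restrictI01 (f i)) (g, t) ^ 2 =
      ∑ i, ∑ k, a i * a k * (restrictI01 (f i) t * restrictI01 (f k) t) := fun t => by
    simp only [cylGrad, sq, Finset.sum_mul_sum]
    refine Finset.sum_congr rfl fun i _ => Finset.sum_congr rfl fun k _ => ?_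
    ring
  simp only [h, gradForm, ← integral_const_mul]
  rw [integral_finsetSum _ fun i _ => integrable_finsetSum _ fun k _ => (hi i k).const_mul _]
  refine Finset.sum_congr rfl fun i _ => ?_
  rw [integral_finsetSum _ fun k _ => (hi i k).const_mul _]

theorem eLpNorm_two_sq_eq_ofReal {α V : Type*} [MeasurableSpace α] [NormedAddCommGroup V]
    {μ : Measure α} {G : α → V} (hG : MemLp G 2 μ) :
    eLpNorm G 2 μ ^ 2 = ENNReal.ofReal (∫ x, ‖G x‖ ^ 2 ∂μ) := by
  rw [eLpNorm_two_sq, ofReal_integral_eq_lintegral_ofReal (hG.integrable_norm_pow two_ne_zero)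
    (ae_of_all _ fun x => by positivity)]
  simp only [ENNReal.ofReal_pow (norm_nonneg _), ofReal_norm]

/-- Pulled back to `𝒢`, both sides integrate the same continuous function `gradForm P`, whose
arguments are bounded and converge pointwise. Closability identifies the abstract energies with
these integrals. -/
theorem IsDirichletLaw.tendsto_energyN (hβ : 0 < β) (hQ : IsDirichletLaw β Q)
    (P : MvPolynomial (Fin m) ℝ) (f : Fin m → C(Set.Icc (0 : ℝ) 1, ℝ)) :
    Tendsto (fun n : ℕ => ((n + 1 : ℕ) : ℝ≥0∞) * energyN β n (polyApprox Q P f n)) atTop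
      (𝓝 (energy Q (polyFun P f))) := by
  have := hQ.1
  set A : ℕ → Fin m → Fin m → ℝ := fun n i k => ((n : ℝ) + 1) * ∑ j : Fin n,
    linCoef n (restrictI01 (f i)) j.castSucc.succ *
      linCoef n (restrictI01 (f k)) j.castSucc.succ with hA
  set A' : Fin m → Fin m → ℝ := fun i k => ∫ t, restrictI01 (f i) t * restrictI01 (f k) t with hA'
  set Y : ℕ → QuantileFun → Fin m → ℝ := fun n g i =>
    affineFun (linCoef n (restrictI01 (f i))) (gridEval n g) with hY
  have hAlim : Tendsto A atTop (𝓝 A') := tendsto_pi_nhds.2 fun i => tendsto_pi_nhds.2 fun k =>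
    tendsto_sum_linCoef_mul (integrable_restrictI01 (f i)) (continuous_restrictI01 (f k))
      fun t => (f k).norm_coe_le_norm _
  obtain ⟨M, hM⟩ := exists_norm_affineFun_le f
  obtain ⟨M', hM'⟩ := hAlim.norm.bddAbove_range
  have hN : ∀ n, ((n + 1 : ℕ) : ℝ≥0∞) * energyN β n (polyApprox Q P f n) =
      ENNReal.ofReal (∫ g, gradForm P (Y n g, A n) ∂Q) := fun n => by
    have hG := hQ.isClosureGradient_polyApprox hβ P f n
    have hgc : Continuous fun x => ‖gradient (gridPoly P f n) x‖ ^ 2 :=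
      (continuous_gradient ((contDiff_gridPoly P f n).of_le (by simp))).norm.pow 2
    rw [hQ.energyN_eq hβ hG, eLpNorm_two_sq_eq_ofReal hG.2.1, ← ENNReal.ofReal_natCast,
      ← ENNReal.ofReal_mul (by positivity), ← hQ.map_gridEval n,
      integral_map (measurable_gridEval n).aemeasurable hgc.aestronglyMeasurable,
      ← integral_const_mul]
    push_cast
    simp only [sq_norm_gradient_gridPoly]
    rfl
  have hE : energy Q (polyFun P f) =
      ENNReal.ofReal (∫ g, gradForm P (fun i => pairing (restrictI01 (f i)) g, A') ∂Q) := by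
    have hG := isClosureGradient_polyFun (Q := Q) P f
    rw [hQ.energy_eq hβ hG, eLpNorm_two_sq_eq_ofReal hG.2.1,
      integral_prod _ (hG.2.1.integrable_norm_pow two_ne_zero)]
    simp only [Real.norm_eq_abs, sq_abs, integral_sq_cylGrad]
    rfl
  simp only [hN, hE]
  refine ENNReal.tendsto_ofReal (tendsto_integral_comp_of_bounded (μ := Q)
    (a := fun n g => (Y n g, A n)) (a' := fun g => (fun i => pairing (restrictI01 (f i)) g, A'))
    (M := max M M') (fun n => ?_) (fun n g => ?_) (ae_of_all _ fun g => ?_) (continuous_gradForm P))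
  · refine Measurable.prodMk (measurable_pi_lambda _ fun i => ?_) measurable_const
    exact (contDiff_affineFun (m := 0) _).continuous.measurable.comp (measurable_gridEval n)
  · exact max_le_max (hM n g) (hM' ⟨n, rfl⟩)
  · exact (tendsto_affineFuns f g).prodMk_nhds hAlim

end Approximation

end WassersteinDiffusion

end

theorem mainTheorem7 (β : ℝ) (hβ : 0 < β) (Q : Measure QuantileFun) (hQ : IsDirichletLaw β Q) :
    IsCore Q polyClass ∧
      ∀ (m : ℕ) (P : MvPolynomial (Fin m) ℝ) (f : Fin m → C(Set.Icc (0 : ℝ) 1, ℝ)),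
        (∀ n : ℕ, polyApprox Q P f n ∈ domainN β n) ∧
        StrongConv β Q (polyApprox Q P f) (polyFun P f) ∧
        Tendsto (fun n : ℕ => ((n + 1 : ℕ) : ℝ≥0∞) * energyN β n (polyApprox Q P f n)) atTop
          (𝓝 (energy Q (polyFun P f))) := by
  have := hQ.1
  exact ⟨isCore_polyClass, fun m P f =>
    ⟨fun n => ⟨_, hQ.isClosureGradient_polyApprox hβ P f n⟩, hQ.strongConv_polyApprox hβ P f,
      hQ.tendsto_energyN hβ P f⟩⟩
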